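/- **Model.** Fix $N>M\ge 0$, request probabilities $p_1\ge\dots\ge p_N\ge0$ with $\sum_i p_i=1$, and put $\delta=\sum_{i\le M}p_i$; assume $\delta<1$. Let $\alpha\in[0,1]$, $\theta\in(0,1]$, $2<\beta\le4$, $P>0$, $\lambda_b,\lambda_e>0$, and assume the noise power is $\sigma^2=0$ (interference-limited regime). Put $$\lambda_{b_1}=\tfrac{\alpha(1-\delta)}{1-\alpha\delta}\lambda_b,\qquad \lambda_{b_3}=\tfrac{(1-\alpha)(1-\delta)}{1-\alpha\delta}\lambda_b,\qquad \gamma_{th_0}=\tfrac{\theta}{1-\theta}\in(0,\infty]\quad(\gamma_{th_0}=\infty\text{ if }\theta=1).$$ The base stations (BSs) form a homogeneous Poisson point process (PPP) $\Phi_b$ of density $\lambda_b$ on $\mathbb R^2$. Independently, each BS is in state 1 (secure transmission), 2 (normal transmission of a pre-cached file) or 3 (normal transmission of another file) with probabilities $\frac{\alpha(1-\delta)}{1-\alpha\delta}$, $\frac{(1-\alpha)\delta}{1-\alpha\delta}$, $\frac{(1-\alpha)(1-\delta)}{1-\alpha\delta}$; $\Phi_{b_i}$ is the set of BSs in state $i$.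 The typical cache-enabled user is at the origin and is served, by secure transmission, by its nearest BS $b_0$. All small-scale fading power gains $|h|^2$ are $\mathrm{Exp}(1)$. The signal-to-interference-plus-noise ratio (SINR) of the user is $$\gamma_u=\frac{\theta P\,|b_0|^{-\beta}|h_{b_0}|^2}{\theta P\sum_{b\in\Phi_{b_1}\setminus b_0}|b|^{-\beta}|h_b|^2+P\sum_{b\in\Phi_{b_3}\setminus b_0}|b|^{-\beta}|h_b|^2+\sigma^2}.$$ The eavesdroppers form a PPP $\Phi_e=\{e_j\}$ of density $\lambda_e$, and the SINR of $e_j$ is $$\mathrm{SINR}_{e_j}=\frac{\theta P\,|h_{e_j,b_0}|^2|e_j-b_0|^{-\beta}}{P\,I_j+(1-\theta)P\,|h_{e_j,b_0}|^2|e_j-b_0|^{-\beta}+\sigma^2},\qquad I_j=\sum_{b\in\Psi_j}|h_{e_j,b}|^2|e_j-b|^{-\beta},$$ where $\Psi_j$ denotes the BSs other than $b_0$ that interfere at $e_j$. As is customary, $\Psi_j$ is taken to be a PPP of density $\lambda_b$, the fields $\Psi_j$ being independent for different eavesdroppers and independent of the user's link. Explicitly, $\Phi_b$, $\Phi_e$,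 all the $\Psi_j$, all the BS states and all the fading gains are mutually independent. Let $\gamma_e=\sup_j\mathrm{SINR}_{e_j}$. The average secrecy rate of secure transmission is $$\overline{\mathcal C}_{ST}=\mathbb E\big[\max\{\log_2(1+\gamma_u)-\log_2(1+\gamma_e),\,0\}\big].$$ **Theorem.** $\overline{\mathcal C}_{ST}$ is finite, and $$\overline{\mathcal C}_{ST}=\frac1{\ln2}\int_0^{\gamma_{th_0}}\frac{\exp\Big\{-\dfrac{\lambda_e/\lambda_b}{\Gamma(1+\frac2\beta)\Gamma(1-\frac2\beta)\big[\frac{\gamma}{\theta-(1-\theta)\gamma}\big]^{2/\beta}}\Big\}}{(1+\gamma)\big[\mathcal Z(\gamma)\frac{\lambda_{b_1}}{\lambda_b}+\mathcal Z(\frac\gamma\theta)\frac{\lambda_{b_3}}{\lambda_b}+1\big]}\,d\gamma+\frac1{\ln2}\int_{\gamma_{th_0}}^\infty\frac{d\gamma}{(1+\gamma)\big[\mathcal Z(\gamma)\frac{\lambda_{b_1}}{\lambda_b}+\mathcal Z(\frac\gamma\theta)\frac{\lambda_{b_3}}{\lambda_b}+1\big]},$$ where both integrals converge, the second one is $0$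 if $\theta=1$, $\mathcal Z(\gamma)=\frac{2\gamma}{\beta-2}\,{}_2F_1\big[1,1-\frac2\beta;2-\frac2\beta;-\gamma\big]$, and ${}_2F_1$ is the (analytically continued) Gauss hypergeometric function. -/

import Mathlib

open MeasureTheory ProbabilityTheory Set
open scoped ENNReal NNReal

noncomputable section

namespace CacheNet

/-- The Euclidean plane in which all nodes live. -/
abbrev Plane : Type := EuclideanSpace ℝ (Fin 2)

/-! ### Poisson point processes -/

/-- The number of points of the configuration `x` (counted with multiplicity) in `B`. -/
def count (x : ℕ → Plane) (B : Set Plane) : ℕ∞ := {n | x n ∈ B}.encard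

/-- `X 0, X 1, …` is a (measurable) enumeration of the points of a homogeneous Poisson point
process of density `lam` on the plane: the number of points in a Borel set `B` of finite area is
Poisson with mean `lam * area B`, and the numbers of points in disjoint sets are independent. -/
structure IsPoissonProcess {Ω : Type*} [MeasurableSpace Ω] (μ : Measure Ω)
    (X : ℕ → Ω → Plane) (lam : ℝ) : Prop where
  measurable : ∀ n, Measurable (X n)
  count_law : ∀ B : Set Plane, MeasurableSet B → volume B ≠ ∞ → ∀ k : ℕ,
    μ {ω | count (fun n => X n ω) B = k}
      = poissonMeasure (lam * (volume B).toReal).toNNReal {k}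
  indep : ∀ (m : ℕ) (B : Fin m → Set Plane), (∀ i, MeasurableSet (B i)) →
    (∀ i, volume (B i) ≠ ∞) → Pairwise (fun i j => Disjoint (B i) (B j)) →
    iIndepFun (fun i ω => count (fun n => X n ω) (B i)) μ

/-! ### Parameters of the network -/

/-- State of a base station: secure transmission, or normal transmission of a file which is
(respectively is not) one of the pre-cached files. -/
inductive BSState
  | secure
  | normalCached
  | normalUncached

instance : MeasurableSpace BSState := ⊤

/-- Parameters of the network: a library of `N` files with request probabilities `p`, of which the
`M` most popular are pre-cached; the proportion `α` of users with a cache; the fraction `θ` of the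
power that carries the requested file; the path-loss exponent `β`; the transmission power `P`;
the noise power `σ2`; and the densities of base stations and eavesdroppers. -/
structure Params where
  N : ℕ
  M : ℕ
  p : Fin N → ℝ
  α : ℝ
  θ : ℝ
  β : ℝ
  P : ℝ
  σ2 : ℝ
  lamB : ℝ
  lamE : ℝ

namespace Params

variable (c : Params)

/-- The standing assumptions on the parameters. -/
structure Valid : Prop where
  M_lt_N : c.M < c.N
  p_nonneg : ∀ i, 0 ≤ c.p i
  p_antitone : Antitone c.p
  p_sum : ∑ i, c.p i = 1
  α_nonneg : 0 ≤ c.α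
  α_le_one : c.α ≤ 1
  θ_pos : 0 < c.θ
  θ_le_one : c.θ ≤ 1
  two_lt_β : 2 < c.β
  β_le_four : c.β ≤ 4
  P_pos : 0 < c.P
  σ2_nonneg : 0 ≤ c.σ2
  lamB_pos : 0 < c.lamB
  lamE_pos : 0 < c.lamE

/-- Cache hit probability `δ`: a request falls among the `M` most popular files. -/
def δ : ℝ := ∑ i : Fin c.N with i.val < c.M, c.p i

/-- Proportion of all requests which are of the given transmission type; the remaining proportion
`α δ` is served from the user's own cache. -/
def requestShare : BSState → ℝ
  | .secure => c.α * (1 - c.δ)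
  | .normalCached => (1 - c.α) * c.δ
  | .normalUncached => (1 - c.α) * (1 - c.δ)

/-- Probability that a base station, which serves one of the transmission requests chosen
uniformly at random, is in the given state. -/
def stateProb (s : BSState) : ℝ :=
  c.requestShare s /
    (c.requestShare .secure + c.requestShare .normalCached + c.requestShare .normalUncached)

/-- Density of the base stations in secure transmission. -/
def lamB1 : ℝ := c.stateProb .secure * c.lamB

/-- Density of the base stations in normal transmission of a file that is not pre-cached. -/
def lamB3 : ℝ := c.stateProb .normalUncached * c.lamB

/-- The threshold `θ / (1 - θ)`, which is `∞` for `θ = 1`. -/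
def gammaTh0 : ℝ≥0∞ := ENNReal.ofReal c.θ / ENNReal.ofReal (1 - c.θ)

end Params

/-! ### The random network seen from a typical cache-enabled user at the origin -/

/-- The random objects of the network. -/
structure Network (Ω : Type*) where
  /-- locations of the base stations -/
  bs : ℕ → Ω → Plane
  /-- states of the base stations -/
  state : ℕ → Ω → BSState
  /-- power gains of the small-scale fading from the base stations to the typical user -/
  gainU : ℕ → Ω → ℝ
  /-- locations of the eavesdroppers -/
  er : ℕ → Ω → Plane
  /-- power gains of the small-scale fading from the serving base station to the eavesdroppers -/
  gainE : ℕ → Ω → ℝ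
  /-- `field j k`: location of the `k`-th interfering base station in the interference
  at eavesdropper `j` -/
  field : ℕ → ℕ → Ω → Plane
  /-- `gainI j k`: power gain of the small-scale fading from `field j k` to eavesdropper `j` -/
  gainI : ℕ → ℕ → Ω → ℝ

/-- Labels of the independent sources of randomness. -/
inductive Source
  | bs
  | state (n : ℕ)
  | gainU (n : ℕ)
  | er
  | gainE (j : ℕ)
  | field (j : ℕ)
  | gainI (j k : ℕ)

namespace Network

variable {Ω : Type*} (W : Network Ω)

/-- The σ-algebra generated by a source of randomness. -/
def sigma : Source → MeasurableSpace Ω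
  | .bs => ⨆ n, MeasurableSpace.comap (W.bs n) inferInstance
  | .state n => MeasurableSpace.comap (W.state n) inferInstance
  | .gainU n => MeasurableSpace.comap (W.gainU n) inferInstance
  | .er => ⨆ j, MeasurableSpace.comap (W.er j) inferInstance
  | .gainE j => MeasurableSpace.comap (W.gainE j) inferInstance
  | .field j => ⨆ k, MeasurableSpace.comap (W.field j k) inferInstance
  | .gainI j k => MeasurableSpace.comap (W.gainI j k) inferInstance

/-- The probabilistic model. Base stations and eavesdroppers are independent Poisson processes,
the states of the base stations are an independent thinning, all fading gains are
exponential with mean one (Rayleigh fading). The base stations that interfere at an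
eavesdropper are distributed as the (reduced Palm version of the) Poisson process of base
stations, and the interference fields of different eavesdroppers and of the user are
independent. All sources are mutually independent. -/
structure IsModel [MeasurableSpace Ω] (μ : Measure Ω) (c : Params) : Prop where
  bs_poisson : IsPoissonProcess μ W.bs c.lamB
  state_measurable : ∀ n, Measurable (W.state n)
  state_law : ∀ n s, μ {ω | W.state n ω = s} = ENNReal.ofReal (c.stateProb s)
  gainU_law : ∀ n, Measurable (W.gainU n) ∧ μ.map (W.gainU n) = expMeasure 1
  er_poisson : IsPoissonProcess μ W.er c.lamE
  gainE_law : ∀ j, Measurable (W.gainE j) ∧ μ.map (W.gainE j) = expMeasure 1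
  field_poisson : ∀ j, IsPoissonProcess μ (W.field j) c.lamB
  gainI_law : ∀ j k, Measurable (W.gainI j k) ∧ μ.map (W.gainI j k) = expMeasure 1
  indep : iIndep W.sigma μ

/-- Index of the serving base station `b₀`: the base station nearest to the origin. -/
def serving (ω : Ω) : ℕ := sInf {n | ∀ k, ‖W.bs n ω‖ ≤ ‖W.bs k ω‖}

variable (c : Params)

open Classical in
/-- Interference at the typical user from the base stations other than `b₀` in state `s`,
per unit of transmission power. -/
def interferenceU (s : BSState) (ω : Ω) : ℝ≥0∞ :=
  ∑' n, if n ≠ W.serving ω ∧ W.state n ω = s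
    then ENNReal.ofReal (‖W.bs n ω‖ ^ (-c.β) * W.gainU n ω) else 0

/-- SINR `γ_u` of the typical cache-enabled user: the pre-cached component of the signals of
base stations in secure transmission, and all the signals of pre-cached files, are cancelled. -/
def sinrU (ω : Ω) : ℝ≥0∞ :=
  ENNReal.ofReal
      (c.θ * c.P * ‖W.bs (W.serving ω) ω‖ ^ (-c.β) * W.gainU (W.serving ω) ω) /
    (ENNReal.ofReal (c.θ * c.P) * W.interferenceU c .secure ω
      + ENNReal.ofReal c.P * W.interferenceU c .normalUncached ω + ENNReal.ofReal c.σ2)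

/-- Interference at eavesdropper `j` from the base stations other than `b₀`,
per unit of transmission power. -/
def interferenceE (j : ℕ) (ω : Ω) : ℝ≥0∞ :=
  ∑' k, ENNReal.ofReal (dist (W.er j ω) (W.field j k ω) ^ (-c.β) * W.gainI j k ω)

/-- Power received by eavesdropper `j` from `b₀`, per unit of transmission power. -/
def receivedE (j : ℕ) (ω : Ω) : ℝ :=
  W.gainE j ω * dist (W.er j ω) (W.bs (W.serving ω) ω) ^ (-c.β)

/-- SINR of eavesdropper `j`; the pre-cached component of the signal acts as interference. -/
def sinrE (j : ℕ) (ω : Ω) : ℝ≥0∞ :=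
  ENNReal.ofReal (c.θ * c.P * W.receivedE c j ω) /
    (ENNReal.ofReal c.P * W.interferenceE c j ω
      + ENNReal.ofReal ((1 - c.θ) * c.P * W.receivedE c j ω) + ENNReal.ofReal c.σ2)

/-- SINR `γ_e` of the most detrimental eavesdropper. -/
def sinrMaxE (ω : Ω) : ℝ≥0∞ := ⨆ j, W.sinrE c j ω

/-- Instantaneous secrecy rate `[log₂ (1 + γ_u) - log₂ (1 + γ_e)]⁺`. -/
def secrecyRate (ω : Ω) : ℝ :=
  max (Real.logb 2 (1 + (W.sinrU c ω).toReal) - Real.logb 2 (1 + (W.sinrMaxE c ω).toReal)) 0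

end Network

/-! ### The functions in the closed form -/

/-- Gauss hypergeometric function `₂F₁[a, b; c; z]` for `0 < b < c` and real `z < 1`, by Euler's
integral (the power series converges only for `|z| < 1`, and this is its analytic
continuation). -/
def hyp2F1 (a b c z : ℝ) : ℝ :=
  Real.Gamma c / (Real.Gamma b * Real.Gamma (c - b)) *
    ∫ t in (0 : ℝ)..1, t ^ (b - 1) * (1 - t) ^ (c - b - 1) * (1 - z * t) ^ (-a)

namespace Params

variable (c : Params)

/-- `Z(γ) = 2γ/(β-2) · ₂F₁[1, 1-2/β; 2-2/β; -γ]`. -/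
def Z (γ : ℝ) : ℝ :=
  2 * γ / (c.β - 2) * hyp2F1 1 (1 - 2 / c.β) (2 - 2 / c.β) (-γ)

/-- Integrand beyond `γ_th0`. -/
def tailIntegrand (γ : ℝ) : ℝ :=
  1 / ((1 + γ) * (c.Z γ * (c.lamB1 / c.lamB) + c.Z (γ / c.θ) * (c.lamB3 / c.lamB) + 1))

/-- Integrand below `γ_th0`. -/
def headIntegrand (γ : ℝ) : ℝ :=
  Real.exp (-((c.lamE / c.lamB) /
      (Real.Gamma (1 + 2 / c.β) * Real.Gamma (1 - 2 / c.β)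
        * (γ / (c.θ - (1 - c.θ) * γ)) ^ (2 / c.β)))) /
    ((1 + γ) * (c.Z γ * (c.lamB1 / c.lamB) + c.Z (γ / c.θ) * (c.lamB3 / c.lamB) + 1))

/-- The interval `(0, γ_th0)`. -/
def headSet : Set ℝ := {γ | 0 < γ ∧ ENNReal.ofReal γ < c.gammaTh0}

/-- The interval `[γ_th0, ∞)`, empty for `θ = 1`. -/
def tailSet : Set ℝ := {γ | 0 < γ ∧ c.gammaTh0 ≤ ENNReal.ofReal γ}

end Params

end CacheNet

end

noncomputable section

namespace CacheNet

open Filter Topology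

/-! By the layer-cake formula (`lintegral_indicator_one_div_eq_rate`) and Tonelli, the mean rate is
`1 / ln 2` times the integral over `γ > 0` of `P(γ_e ≤ γ < γ_u) / (1 + γ)`. Everything rests on this
joint probability (`measure_lt_sinrU_and_sinrMaxE_le`). Given the base stations, `γ_u` and `γ_e`
depend on disjoint sources and are independent. The conditional law of `γ_e` does not depend on
where `b₀` is, by translation invariance, so the probability factors even after averaging over the
base stations.

The user: the serving gain is exponential, so conditional coverage is the Laplace transform of the
relative interference, a product over the base stations other than `b₀`. With `R` the distance of
the nearest one, the average is formally the integral of `2πλ r exp(-πλr²) exp(-πλr² A)` over `r >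
0`, which is `1 / (1 + A)`; here `A = totalZ γ`, and the exponent is proportional to `r²` by
scaling. Rather than conditioning on the nearest point, `lintegral_expNeg_sumBeyond` cuts the plane
into annuli with `ε` points on average, bounds each contribution by Laplace functionals of `shell`
functions, sums geometric series and lets `ε → 0`.

The eavesdroppers: one at distance `d` from `b₀` exceeds `γ` with probability `exp(-κ d²)`, `κ =
rateE γ`. The exceedances are independent marks on the eavesdropper process, so its Laplace
functional and a Gaussian integral give `P(γ_e ≤ γ) = exp(-λ_e π / κ)`. Beyond `θ / (1 - θ)` the
pre-cached component alone keeps every eavesdropper below `γ`, the probability is 1, and the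
integral splits there.

Probabilities are written as `expNeg` of series in `[0, ∞]`, where every series has a sum, with
`negLog` turning factors into terms; vanishing factors and divergent series need no separate
treatment. -/

section

/-! ### The function `a ↦ exp (-a)` on `[0, ∞]` -/

/-- `exp (-a)` for `a ∈ [0, ∞]`. -/
def expNeg (a : ℝ≥0∞) : ℝ≥0∞ := EReal.exp (-(a : EReal))

/-- `-log p` for `p ∈ [0, 1]`, extended by `0` to `p ≥ 1`. -/
def negLog (p : ℝ≥0∞) : ℝ≥0∞ := (-(ENNReal.log p)).toENNReal

@[simp] lemma expNeg_zero : expNeg 0 = 1 := by simp [expNeg]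

@[simp] lemma expNeg_top : expNeg ∞ = 0 := by simp [expNeg]

lemma expNeg_add (a b : ℝ≥0∞) : expNeg (a + b) = expNeg a * expNeg b := by
  rw [expNeg, EReal.coe_ennreal_add, EReal.neg_add, sub_eq_add_neg, EReal.exp_add, expNeg, expNeg]
  · left; simp
  · right; simp

lemma expNeg_antitone : Antitone expNeg := fun _ _ h =>
  EReal.exp_monotone (EReal.neg_le_neg_iff.2 (EReal.coe_ennreal_le_coe_ennreal_iff.2 h))

lemma expNeg_le_one (a : ℝ≥0∞) : expNeg a ≤ 1 := by
  simpa using expNeg_antitone (zero_le (a := a))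

lemma continuous_expNeg : Continuous expNeg :=
  ENNReal.continuous_exp.comp (continuous_neg.comp continuous_coe_ennreal_ereal)

lemma measurable_expNeg : Measurable expNeg := continuous_expNeg.measurable

lemma expNeg_ofReal {x : ℝ} (hx : 0 ≤ x) :
    expNeg (ENNReal.ofReal x) = ENNReal.ofReal (Real.exp (-x)) := by
  rw [expNeg, EReal.coe_ennreal_ofReal, max_eq_left hx, ← EReal.coe_neg, EReal.exp_coe]

lemma measurable_negLog : Measurable negLog :=
  measurable_ereal_toENNReal.comp (ENNReal.measurable_log.neg)

/-- The value `p = 0` is included, with `negLog 0 = ∞`. Any product of probabilities thus becomes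
the exponential of a series, the form to which the Laplace functional applies. -/
lemma expNeg_negLog {p : ℝ≥0∞} (hp : p ≤ 1) : expNeg (negLog p) = p := by
  have : (0 : EReal) ≤ -(ENNReal.log p) := by
    rw [EReal.le_neg, neg_zero]; simpa using hp
  rw [expNeg, negLog, EReal.coe_toENNReal this, neg_neg, ENNReal.exp_log]

lemma expNeg_sum {ι : Type*} (s : Finset ι) (f : ι → ℝ≥0∞) :
    expNeg (∑ i ∈ s, f i) = ∏ i ∈ s, expNeg (f i) := by
  classical
  induction s using Finset.induction_on with
  | empty => simp
  | insert i s hi ih => rw [Finset.sum_insert hi, Finset.prod_insert hi, expNeg_add, ih]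

lemma expNeg_mul_natCast (a : ℝ≥0∞) (k : ℕ) : expNeg (a * k) = expNeg a ^ k := by
  induction k with
  | zero => simp
  | succ k ih => rw [Nat.cast_succ, mul_add, mul_one, expNeg_add, ih, pow_succ]

/-- No summability is required: `expNeg` is continuous at `∞`, so a divergent series gives the
product `0`. -/
lemma tendsto_prod_expNeg (f : ℕ → ℝ≥0∞) :
    Tendsto (fun N => ∏ n ∈ Finset.range N, expNeg (f n)) atTop (𝓝 (expNeg (∑' n, f n))) := by
  simp_rw [← expNeg_sum]
  exact (continuous_expNeg.tendsto _).comp ENNReal.summable.hasSum.tendsto_sum_nat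

end

section

/-! ### The Laplace functional of a Poisson process -/

lemma count_eq_tsum (x : ℕ → Plane) (B : Set Plane) :
    (count x B : ℝ≥0∞) = ∑' n, B.indicator (fun _ => (1 : ℝ≥0∞)) (x n) := by
  rw [count, ← ENNReal.tsum_set_one, tsum_subtype {n | x n ∈ B} (fun _ => (1 : ℝ≥0∞))]
  rfl

lemma count_eq_zero_iff {x : ℕ → Plane} {B : Set Plane} : count x B = 0 ↔ ∀ n, x n ∉ B := by
  simp [count, Set.eq_empty_iff_forall_notMem]

lemma tsum_indicator_eq_mul_count (x : ℕ → Plane) (B : Set Plane) (a : ℝ≥0∞) :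
    ∑' n, B.indicator (fun _ => a) (x n) = a * count x B := by
  rw [count_eq_tsum, ← ENNReal.tsum_mul_left]
  congr 1 with n
  by_cases h : x n ∈ B <;> simp [h]

variable {Ω : Type*} [MeasurableSpace Ω] {μ : Measure Ω} {X : ℕ → Ω → Plane} {lam : ℝ}

lemma measurable_count (hX : ∀ n, Measurable (X n)) {B : Set Plane} (hB : MeasurableSet B) :
    Measurable fun ω => count (fun n => X n ω) B := by
  have h : Measurable fun ω => (count (fun n => X n ω) B : ℝ≥0∞) := by
    simp_rw [count_eq_tsum]
    exact Measurable.tsum fun n => (measurable_const.indicator hB).comp (hX n)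
  -- `ℕ∞` is countable, so it suffices to pull back singletons, and these can be pulled back through
  -- the cast to `ℝ≥0∞`.
  refine measurable_to_countable' fun y => ?_
  have : (fun ω => count (fun n => X n ω) B) ⁻¹' {y}
      = (fun ω => (count (fun n => X n ω) B : ℝ≥0∞)) ⁻¹' {(y : ℝ≥0∞)} := by
    ext ω; simp
  rw [this]
  exact h (measurableSet_singleton _)

/-- The law of the count is prescribed on finite values only, but these already carry the total mass
1. -/
lemma IsPoissonProcess.ae_count_ne_top [IsProbabilityMeasure μ] (h : IsPoissonProcess μ X lam)
    {B : Set Plane} (hB : MeasurableSet B) (hBv : volume B ≠ ∞) :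
    ∀ᵐ ω ∂μ, count (fun n => X n ω) B ≠ ⊤ := by
  have hm := measurable_count h.measurable hB
  have hset : {ω | count (fun n => X n ω) B ≠ ⊤} = ⋃ k : ℕ, {ω | count (fun n => X n ω) B = k} := by
    ext ω
    simp only [mem_ofPred_eq, mem_iUnion, ENat.ne_top_iff_exists, eq_comm]
  have hmk : ∀ k : ℕ, MeasurableSet {ω | count (fun n => X n ω) B = k} :=
    fun k => hm (measurableSet_singleton _)
  have : μ {ω | count (fun n => X n ω) B ≠ ⊤} = 1 := by
    rw [hset, measure_iUnion _ hmk]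
    · simp_rw [h.count_law B hB hBv]
      rw [← measure_univ (μ := poissonMeasure (lam * (volume B).toReal).toNNReal),
        ← Measure.tsum_indicator_apply_singleton _ _ MeasurableSet.univ]
      simp
    · intro i j hij
      refine Set.disjoint_left.2 fun ω h1 h2 => hij ?_
      have : (i : ℕ∞) = j := h1.symm.trans h2
      exact_mod_cast this
  rwa [← prob_compl_eq_zero_iff (by rw [hset]; exact .iUnion hmk)] at this

/-- The generating function of the Poisson law, from the exponential series at `r * p`. -/
lemma tsum_poisson_mul_pow {r : ℝ} (hr : 0 ≤ r) {p : ℝ≥0∞} (hp : p ≤ 1) :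
    ∑' k : ℕ, poissonMeasure r.toNNReal {k} * p ^ k = expNeg (ENNReal.ofReal r * (1 - p)) := by
  lift p to ℝ≥0 using ne_top_of_le_ne_top ENNReal.one_ne_top hp
  have hp1 : (p : ℝ) ≤ 1 := by exact_mod_cast hp
  have h1 : ∀ k : ℕ, poissonMeasure r.toNNReal {k} * (p : ℝ≥0∞) ^ k
      = ENNReal.ofReal (Real.exp (-r) * ((r * p) ^ k / k.factorial)) := by
    intro k
    rw [poissonMeasure_singleton, Real.coe_toNNReal _ hr, ← ENNReal.ofReal_coe_nnreal,
      ← ENNReal.ofReal_pow p.coe_nonneg, ← ENNReal.ofReal_mul (by positivity)]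
    congr 1
    rw [mul_pow]; ring
  have hs : HasSum (fun k : ℕ => Real.exp (-r) * ((r * p) ^ k / k.factorial))
      (Real.exp (-r) * Real.exp (r * p)) := by
    have := NormedSpace.expSeries_div_hasSum_exp (r * p : ℝ)
    rw [← Real.exp_eq_exp_ℝ] at this
    exact this.mul_left _
  simp_rw [h1]
  rw [← ENNReal.ofReal_tsum_of_nonneg (fun k => by positivity) hs.summable, hs.tsum_eq,
    ← Real.exp_add]
  have h2 : ENNReal.ofReal r * (1 - (p : ℝ≥0∞)) = ENNReal.ofReal (r * (1 - p)) := by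
    rw [ENNReal.ofReal_mul hr, ENNReal.ofReal_sub _ p.coe_nonneg]; simp
  rw [h2, expNeg_ofReal (mul_nonneg hr (by linarith))]
  congr 2; ring

/-- The case `a = ∞` is the void probability, because `∞ * 0 = 0`; the shells below use it. -/
lemma IsPoissonProcess.lintegral_expNeg_mul_count [IsProbabilityMeasure μ]
    (h : IsPoissonProcess μ X lam) (hlam : 0 ≤ lam)
    {B : Set Plane} (hB : MeasurableSet B) (hBv : volume B ≠ ∞) (a : ℝ≥0∞) :
    ∫⁻ ω, expNeg (a * count (fun n => X n ω) B) ∂μ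
      = expNeg (ENNReal.ofReal lam * (volume B * (1 - expNeg a))) := by
  have hm := measurable_count h.measurable hB
  have hmk : ∀ k : ℕ, MeasurableSet {ω | count (fun n => X n ω) B = k} :=
    fun k => hm (measurableSet_singleton _)
  have h1 : ∫⁻ ω, expNeg (a * count (fun n => X n ω) B) ∂μ
      = ∫⁻ ω, ∑' k : ℕ, {ω | count (fun n => X n ω) B = k}.indicator
          (fun _ => expNeg a ^ k) ω ∂μ := by
    refine lintegral_congr_ae ?_
    filter_upwards [h.ae_count_ne_top hB hBv] with ω hω
    obtain ⟨k, hk⟩ := ENat.ne_top_iff_exists.1 hω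
    rw [tsum_eq_single k]
    · rw [Set.indicator_of_mem (show ω ∈ {ω | count (fun n => X n ω) B = k} from hk.symm), ← hk]
      simp [expNeg_mul_natCast]
    · intro j hj
      refine Set.indicator_of_notMem (fun hj' => hj ?_) _
      have : (j : ℕ∞) = k := hj'.symm.trans hk.symm
      exact_mod_cast this
  rw [h1, lintegral_tsum fun k => (measurable_const.indicator (hmk k)).aemeasurable]
  simp_rw [lintegral_indicator_const (hmk _), h.count_law B hB hBv]
  have h2 := tsum_poisson_mul_pow (r := lam * (volume B).toReal) (by positivity)
    (expNeg_le_one a)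
  simp_rw [mul_comm (_ ^ _)]
  rw [h2, ENNReal.ofReal_mul hlam, ENNReal.ofReal_toReal hBv, mul_assoc]

/-- The Laplace functional of a Poisson process, for step functions. -/
lemma IsPoissonProcess.lintegral_expNeg_tsum_simpleFunc [IsProbabilityMeasure μ]
    (h : IsPoissonProcess μ X lam) (hlam : 0 ≤ lam) (f : SimpleFunc Plane ℝ≥0∞)
    (hf : volume (Function.support f) ≠ ∞) :
    ∫⁻ ω, expNeg (∑' n, f (X n ω)) ∂μ
      = expNeg (ENNReal.ofReal lam * ∫⁻ x, (1 - expNeg (f x))) := by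
  classical
  -- The value `0` is left out because its level set has infinite area; the others are indexed by
  -- `Fin` to match `indep`.
  set s : Finset ℝ≥0∞ := f.range.filter (· ≠ 0) with hs
  set e := s.equivFin.symm with he
  set B : Fin s.card → Set Plane := fun i => f ⁻¹' {(e i : ℝ≥0∞)} with hBdef
  have hBm : ∀ i, MeasurableSet (B i) := fun i => f.measurableSet_preimage _
  have hne : ∀ i, (e i : ℝ≥0∞) ≠ 0 := fun i => (Finset.mem_filter.1 (e i).2).2
  have hBv : ∀ i, volume (B i) ≠ ∞ := fun i => by
    refine ne_top_of_le_ne_top hf (measure_mono fun x hx => ?_)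
    have : f x = e i := hx
    simpa [this] using hne i
  have hdis : Pairwise fun i j => Disjoint (B i) (B j) := by
    intro i j hij
    refine Set.disjoint_left.2 fun x h1 h2 => hij ?_
    have h1' : f x = e i := h1
    have h2' : f x = e j := h2
    exact e.injective (Subtype.ext (h1'.symm.trans h2'))
  -- Used with `φ = id` for the sum over the points and with `φ = 1 - expNeg` for the integral over
  -- the plane.
  have key : ∀ φ : ℝ≥0∞ → ℝ≥0∞, φ 0 = 0 → ∀ x,
      φ (f x) = ∑ i, (B i).indicator (fun _ => φ (e i)) x := by
    intro φ hφ x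
    by_cases hx : f x = 0
    · rw [hx, hφ]
      refine (Finset.sum_eq_zero fun i _ => Set.indicator_of_notMem (fun hi => hne i ?_) _).symm
      exact (show f x = e i from hi).symm.trans hx
    · have hmem : f x ∈ s := Finset.mem_filter.2 ⟨f.mem_range_self x, hx⟩
      obtain ⟨i, hi⟩ := e.surjective ⟨f x, hmem⟩
      have hi' : (e i : ℝ≥0∞) = f x := by rw [hi]
      rw [Finset.sum_eq_single i]
      · rw [Set.indicator_of_mem (show x ∈ B i from hi'.symm), hi']
      · intro j _ hj
        refine Set.indicator_of_notMem (fun hj' => hj (e.injective (Subtype.ext ?_))) _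
        exact (show f x = e j from hj').symm.trans hi'.symm
      · simp
  have hL : ∀ ω, expNeg (∑' n, f (X n ω))
      = ∏ i, expNeg ((e i : ℝ≥0∞) * count (fun n => X n ω) (B i)) := by
    intro ω
    rw [← expNeg_sum]
    congr 1
    refine (tsum_congr fun n => key id rfl (X n ω)).trans ?_
    rw [Summable.tsum_finsetSum fun _ _ => ENNReal.summable]
    exact Finset.sum_congr rfl fun i _ => tsum_indicator_eq_mul_count (fun n => X n ω) _ _
  have hR : ∫⁻ x, (1 - expNeg (f x)) = ∑ i, volume (B i) * (1 - expNeg (e i)) := by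
    rw [lintegral_congr fun x => key (fun a => 1 - expNeg a) (by simp) x,
      lintegral_finsetSum _ fun i _ => measurable_const.indicator (hBm i)]
    exact Finset.sum_congr rfl fun i _ => by rw [lintegral_indicator_const (hBm i), mul_comm]
  have hind := h.indep s.card B hBm hBv hdis
  have hg : ∀ i, Measurable fun y : ℕ∞ => expNeg ((e i : ℝ≥0∞) * y) := fun i =>
    measurable_from_top
  have := lintegral_prod_eq_prod_lintegral_of_indepFun Finset.univ _ (hind.comp _ hg)
    fun i => (hg i).comp (measurable_count h.measurable (hBm i))
  simp only [Function.comp_def] at this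
  simp_rw [hL]
  rw [this, hR, Finset.mul_sum, expNeg_sum]
  exact Finset.prod_congr rfl fun i _ => h.lintegral_expNeg_mul_count hlam (hBm i) (hBv i) _

/-- The Laplace functional of a Poisson process. -/
theorem IsPoissonProcess.lintegral_expNeg_tsum [IsProbabilityMeasure μ]
    (h : IsPoissonProcess μ X lam) (hlam : 0 ≤ lam) {f : Plane → ℝ≥0∞} (hf : Measurable f) :
    ∫⁻ ω, expNeg (∑' n, f (X n ω)) ∂μ
      = expNeg (ENNReal.ofReal lam * ∫⁻ x, (1 - expNeg (f x))) := by
  -- Truncation to balls gives the supports finite area and keeps the approximation increasing.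
  let g : ℕ → SimpleFunc Plane ℝ≥0∞ := fun k => (SimpleFunc.eapprox f k).restrict (Metric.ball 0 k)
  have hgapp : ∀ k x, g k x = (Metric.ball (0 : Plane) k).indicator (SimpleFunc.eapprox f k) x :=
    fun k x => by rw [SimpleFunc.restrict_apply _ measurableSet_ball]
  have hmono : ∀ x, Monotone fun k => g k x := by
    intro x j k hjk
    simp only [hgapp]
    refine (Set.indicator_le_indicator_of_subset
      (Metric.ball_subset_ball (Nat.cast_le.2 hjk)) (fun _ => zero_le) x).trans ?_
    exact Set.indicator_le_indicator (SimpleFunc.monotone_eapprox f hjk x)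
  have hsup : ∀ x, ⨆ k, g k x = f x := by
    intro x
    refine le_antisymm (iSup_le fun k => ?_) ?_
    · rw [hgapp]
      refine (Set.indicator_le_self _ _ x).trans ?_
      rw [← SimpleFunc.iSup_eapprox_apply hf x]
      exact le_iSup (fun k => SimpleFunc.eapprox f k x) k
    · rw [← SimpleFunc.iSup_eapprox_apply hf x]
      refine iSup_le fun k => ?_
      obtain ⟨N, hN⟩ := exists_nat_gt ‖x‖
      refine le_iSup_of_le (max k N) ?_
      rw [hgapp, Set.indicator_of_mem]
      · exact SimpleFunc.monotone_eapprox f (le_max_left k N) x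
      · rw [mem_ball_zero_iff]
        exact hN.trans_le (by exact_mod_cast le_max_right k N)
  have hlim : ∀ x, Tendsto (fun k => g k x) atTop (𝓝 (f x)) := fun x => by
    rw [← hsup]; exact tendsto_atTop_iSup (hmono x)
  have hsum : ∀ ω, Tendsto (fun k => ∑' n, g k (X n ω)) atTop (𝓝 (∑' n, f (X n ω))) := by
    intro ω
    -- A series is an integral for the counting measure, so monotone convergence applies.
    simp_rw [← lintegral_count]
    exact lintegral_tendsto_of_tendsto_of_monotone (fun k => measurable_from_top.aemeasurable)
      (ae_of_all _ fun n => hmono _) (ae_of_all _ fun n => hlim _)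
  have hLHS : Tendsto (fun k => ∫⁻ ω, expNeg (∑' n, g k (X n ω)) ∂μ) atTop
      (𝓝 (∫⁻ ω, expNeg (∑' n, f (X n ω)) ∂μ)) := by
    refine tendsto_lintegral_of_dominated_convergence (fun _ => 1) (fun k => ?_)
      (fun k => ae_of_all _ fun ω => expNeg_le_one _) (by simp)
      (ae_of_all _ fun ω => (continuous_expNeg.tendsto _).comp (hsum ω))
    exact measurable_expNeg.comp (Measurable.tsum fun n =>
      (g k).measurable.comp (h.measurable n))
  have hRHS : Tendsto (fun k => expNeg (ENNReal.ofReal lam * ∫⁻ x, (1 - expNeg (g k x)))) atTop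
      (𝓝 (expNeg (ENNReal.ofReal lam * ∫⁻ x, (1 - expNeg (f x))))) := by
    refine (continuous_expNeg.tendsto _).comp (ENNReal.Tendsto.const_mul ?_
      (Or.inr ENNReal.ofReal_ne_top))
    refine lintegral_tendsto_of_tendsto_of_monotone
      (fun k => (measurable_const.sub (measurable_expNeg.comp (g k).measurable)).aemeasurable)
      (ae_of_all _ fun x j k hjk => ?_) (ae_of_all _ fun x => ?_)
    · exact tsub_le_tsub_left (expNeg_antitone (hmono x hjk)) _
    · exact ((ENNReal.continuous_sub_left ENNReal.one_ne_top).tendsto _).comp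
        ((continuous_expNeg.tendsto _).comp (hlim x))
  refine tendsto_nhds_unique hLHS (hRHS.congr fun k => ?_)
  refine (h.lintegral_expNeg_tsum_simpleFunc hlam (g k) ?_).symm
  refine ne_top_of_le_ne_top (measure_ball_lt_top (μ := volume) (x := (0 : Plane)) (r := k)).ne
    (measure_mono fun x hx => ?_)
  by_contra hx'
  exact hx (by rw [hgapp, Set.indicator_of_notMem hx'])

end

section

/-! ### The nearest point of a Poisson process -/

/-- The index of the point of the configuration `x` which is nearest to the origin. -/
def nearest (x : ℕ → Plane) : ℕ := sInf {n | ∀ k, ‖x n‖ ≤ ‖x k‖}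

lemma measurable_nearest : Measurable nearest := by
  have hm : ∀ n, MeasurableSet {x : ℕ → Plane | ∀ k, ‖x n‖ ≤ ‖x k‖} := fun n => by
    simp only [Set.ofPred_forall]
    exact MeasurableSet.iInter fun k => measurableSet_le
      (measurable_pi_apply n).norm (measurable_pi_apply k).norm
  refine measurable_to_countable' fun m => ?_
  -- Either `m` is the first minimiser, or there is none and `m` is the default value `sInf ∅ = 0`.
  have : nearest ⁻¹' {m} = ({x | ∀ k, ‖x m‖ ≤ ‖x k‖} ∩ ⋂ n, ⋂ (_ : n < m),
      {x : ℕ → Plane | ∀ k, ‖x n‖ ≤ ‖x k‖}ᶜ) ∪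
      ((⋂ n, {x : ℕ → Plane | ∀ k, ‖x n‖ ≤ ‖x k‖}ᶜ) ∩ {_x | m = 0}) := by
    ext x
    simp only [mem_preimage, mem_singleton_iff, mem_union, mem_inter_iff, mem_iInter]
    constructor
    · intro h
      by_cases hne : {n | ∀ k, ‖x n‖ ≤ ‖x k‖}.Nonempty
      · left
        rw [← h]
        exact ⟨Nat.sInf_mem hne, fun n hn => Nat.notMem_of_lt_sInf hn⟩
      · right
        rw [Set.not_nonempty_iff_eq_empty] at hne
        refine ⟨fun n hn => ?_, ?_⟩
        · have : n ∈ {n | ∀ k, ‖x n‖ ≤ ‖x k‖} := hn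
          rw [hne] at this
          exact this
        · rw [nearest, hne, Nat.sInf_empty] at h
          exact h.symm
    · rintro (⟨h1, h2⟩ | ⟨h1, h2⟩)
      · refine le_antisymm (Nat.sInf_le h1) (not_lt.1 fun hlt => ?_)
        exact h2 _ hlt (Nat.sInf_mem (s := {n | ∀ k, ‖x n‖ ≤ ‖x k‖}) ⟨m, h1⟩)
      · have : {n | ∀ k, ‖x n‖ ≤ ‖x k‖} = ∅ := Set.eq_empty_iff_forall_notMem.2 h1
        rw [nearest, this, Nat.sInf_empty]
        exact (show m = 0 from h2).symm
  rw [this]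
  refine ((hm m).inter (.iInter fun n => .iInter fun _ => (hm n).compl)).union
    ((MeasurableSet.iInter fun n => (hm n).compl).inter (.const _))

lemma measurable_apply_nearest : Measurable fun x : ℕ → Plane => x (nearest x) :=
  (measurable_from_prod_countable_right (f := fun p : ℕ × (ℕ → Plane) => p.2 p.1)
    fun n => measurable_pi_apply n).comp (measurable_nearest.prodMk measurable_id)

variable {Ω : Type*} [MeasurableSpace Ω] {μ : Measure Ω} {X : ℕ → Ω → Plane} {lam : ℝ}

/-- Almost surely each ball of natural radius contains finitely many points; in one that contains `X
0` the minimal norm is attained. -/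
lemma IsPoissonProcess.ae_nearest_le [IsProbabilityMeasure μ] (h : IsPoissonProcess μ X lam) :
    ∀ᵐ ω ∂μ, ∀ k, ‖X (nearest fun n => X n ω) ω‖ ≤ ‖X k ω‖ := by
  have : ∀ᵐ ω ∂μ, ∀ N : ℕ, count (fun n => X n ω) (Metric.ball 0 N) ≠ ⊤ :=
    ae_all_iff.2 fun N => h.ae_count_ne_top measurableSet_ball measure_ball_lt_top.ne
  filter_upwards [this] with ω hω
  obtain ⟨N, hN⟩ := exists_nat_gt ‖X 0 ω‖
  have hfin : {n | X n ω ∈ Metric.ball 0 (N : ℝ)}.Finite := by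
    have := hω N
    rwa [count, Set.encard_ne_top_iff] at this
  obtain ⟨m, hm, hmin⟩ := Set.exists_min_image _ (fun n => ‖X n ω‖) hfin ⟨0, by simpa using hN⟩
  refine Nat.sInf_mem (s := {n | ∀ k, ‖X n ω‖ ≤ ‖X k ω‖}) ⟨m, fun k => ?_⟩
  by_cases hk : X k ω ∈ Metric.ball 0 (N : ℝ)
  · exact hmin k hk
  · have h1 : ‖X m ω‖ < N := by simpa using hm
    have h2 : (N : ℝ) ≤ ‖X k ω‖ := by simpa using hk
    linarith

/-- A Poisson variable of mean 0 vanishes. This keeps the base stations off the origin, where `‖x‖ ^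
(-β)` would take the default value 0. -/
lemma IsPoissonProcess.ae_forall_notMem [IsProbabilityMeasure μ] (h : IsPoissonProcess μ X lam)
    {B : Set Plane} (hB : MeasurableSet B) (hB0 : volume B = 0) :
    ∀ᵐ ω ∂μ, ∀ n, X n ω ∉ B := by
  have h1 := h.count_law B hB (by simp [hB0]) 0
  rw [hB0, poissonMeasure_singleton] at h1
  have h2 : μ {ω | count (fun n => X n ω) B = 0} = 1 := by simpa using h1
  have hm : MeasurableSet {ω | count (fun n => X n ω) B = 0} :=
    measurable_count h.measurable hB (measurableSet_singleton _)
  rw [← prob_compl_eq_zero_iff hm] at h2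
  filter_upwards [show ∀ᵐ ω ∂μ, count (fun n => X n ω) B = 0 from h2] with ω hω
  exact count_eq_zero_iff.1 hω

/-- The function which is `∞` in the open ball of radius `a`, equal to `c` in the annulus between
the radii `a` and `b`, and equal to `φ` further out. -/
def shell (a b : ℝ) (c : ℝ≥0∞) (φ : Plane → ℝ≥0∞) (x : Plane) : ℝ≥0∞ :=
  if ‖x‖ < a then ∞ else if ‖x‖ < b then c else φ x

lemma measurable_shell (a b : ℝ) (c : ℝ≥0∞) {φ : Plane → ℝ≥0∞} (hφ : Measurable φ) :
    Measurable (shell a b c φ) :=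
  Measurable.ite (measurableSet_lt measurable_norm measurable_const) measurable_const
    (Measurable.ite (measurableSet_lt measurable_norm measurable_const) measurable_const hφ)

lemma volume_ball_plane {a : ℝ} (ha : 0 ≤ a) (x : Plane) :
    volume (Metric.ball x a) = ENNReal.ofReal (Real.pi * a ^ 2) := by
  rw [InnerProductSpace.volume_ball_of_dim_even (k := 1) (by simp)]
  simp only [finrank_euclideanSpace, Fintype.card_fin, pow_one, Nat.factorial_one, Nat.cast_one,
    div_one]
  rw [← ENNReal.ofReal_pow ha, ← ENNReal.ofReal_mul (by positivity), mul_comm]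

lemma volume_annulus {a b : ℝ} (ha : 0 ≤ a) (hab : a ≤ b) :
    volume (Metric.ball (0 : Plane) b \ Metric.ball 0 a)
      = ENNReal.ofReal (Real.pi * (b ^ 2 - a ^ 2)) := by
  rw [measure_sdiff (Metric.ball_subset_ball hab) measurableSet_ball.nullMeasurableSet
    measure_ball_lt_top.ne, volume_ball_plane ha, volume_ball_plane (ha.trans hab),
    ← ENNReal.ofReal_sub _ (by positivity)]
  congr 1; ring

lemma lintegral_one_sub_expNeg_shell {a b : ℝ} (ha : 0 ≤ a) (hab : a ≤ b) (c : ℝ≥0∞)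
    (φ : Plane → ℝ≥0∞) :
    ∫⁻ x, (1 - expNeg (shell a b c φ x))
      = ENNReal.ofReal (Real.pi * a ^ 2)
        + ENNReal.ofReal (Real.pi * (b ^ 2 - a ^ 2)) * (1 - expNeg c)
        + ∫⁻ x in (Metric.ball 0 b)ᶜ, (1 - expNeg (φ x)) := by
  have h1 : ∀ x, 1 - expNeg (shell a b c φ x)
      = (Metric.ball (0 : Plane) a).indicator (fun _ => (1 : ℝ≥0∞)) x
        + (Metric.ball (0 : Plane) b \ Metric.ball 0 a).indicator (fun _ => 1 - expNeg c) x
        + ((Metric.ball (0 : Plane) b)ᶜ).indicator (fun x => 1 - expNeg (φ x)) x := by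
    intro x
    simp only [shell, Set.indicator, mem_ball_zero_iff, Set.mem_sdiff, mem_compl_iff, not_lt]
    rcases lt_or_ge ‖x‖ a with h | h
    · simp [h, h.trans_le hab, h.not_ge, (h.trans_le hab).not_ge]
    · rcases lt_or_ge ‖x‖ b with h' | h'
      · simp [h.not_gt, h', h'.not_ge]
      · simp [h.not_gt, h', h'.not_gt]
  rw [lintegral_congr h1, lintegral_add_left, lintegral_add_left,
    lintegral_indicator_const measurableSet_ball,
    lintegral_indicator_const (measurableSet_ball.diff measurableSet_ball),
    lintegral_indicator measurableSet_ball.compl, one_mul, volume_ball_plane ha,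
    volume_annulus ha hab, mul_comm (1 - expNeg c)]
  · exact measurable_const.indicator measurableSet_ball
  · exact (measurable_const.indicator measurableSet_ball).add
      (measurable_const.indicator (measurableSet_ball.diff measurableSet_ball))

/-- The value `∞` on the inner ball restricts the expectation to configurations without points
there, and each point of the annulus costs a factor `expNeg c`. With `c = 0` the annulus is ignored
and with `c = ∞` it must be empty, so the difference of the two isolates the event that the nearest
point lies in the annulus. -/
lemma IsPoissonProcess.lintegral_expNeg_shell [IsProbabilityMeasure μ]
    (h : IsPoissonProcess μ X lam) (hlam : 0 ≤ lam) {a b : ℝ} (ha : 0 ≤ a) (hab : a ≤ b)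
    (c : ℝ≥0∞) {φ : Plane → ℝ≥0∞} (hφ : Measurable φ) :
    ∫⁻ ω, expNeg (∑' n, shell a b c φ (X n ω)) ∂μ
      = ENNReal.ofReal (Real.exp (-(lam * Real.pi * a ^ 2
          + lam * Real.pi * (b ^ 2 - a ^ 2) * (1 - (expNeg c).toReal))))
        * expNeg (ENNReal.ofReal lam * ∫⁻ x in (Metric.ball 0 b)ᶜ, (1 - expNeg (φ x))) := by
  have hc : (expNeg c).toReal ≤ 1 := by
    simpa using ENNReal.toReal_mono ENNReal.one_ne_top (expNeg_le_one c)
  have hc' : 1 - expNeg c = ENNReal.ofReal (1 - (expNeg c).toReal) := by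
    rw [ENNReal.ofReal_sub _ ENNReal.toReal_nonneg, ENNReal.ofReal_one,
      ENNReal.ofReal_toReal (ne_top_of_le_ne_top ENNReal.one_ne_top (expNeg_le_one c))]
  have hba : 0 ≤ b ^ 2 - a ^ 2 := by nlinarith
  have hp := Real.pi_pos
  have h0 : 0 ≤ 1 - (expNeg c).toReal := by linarith
  rw [h.lintegral_expNeg_tsum hlam (measurable_shell a b c hφ),
    lintegral_one_sub_expNeg_shell ha hab c φ, mul_add, expNeg_add, hc',
    ← ENNReal.ofReal_mul (by positivity), ← ENNReal.ofReal_add (by positivity) (by positivity),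
    ← ENNReal.ofReal_mul hlam, expNeg_ofReal (by positivity)]
  congr 4; ring

end

/-! ### Bounds on the event that the nearest point lies in a given annulus -/

section

variable {Ω : Type*} [MeasurableSpace Ω] {μ : Measure Ω} {X : ℕ → Ω → Plane} {lam : ℝ}

/-- `∑ f(xₙ, r)` over the points other than the nearest one, with `r` the distance of the latter. -/
def sumBeyond (f : Plane → ℝ → ℝ≥0∞) (x : ℕ → Plane) : ℝ≥0∞ :=
  ∑' n, if n = nearest x then 0 else f (x n) ‖x (nearest x)‖

section Pointwise

variable {f : Plane → ℝ → ℝ≥0∞} {x : ℕ → Plane} {a b : ℝ}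

/-- The subtracted term is 0, as the annulus is occupied. Dropping the other points of the annulus
and replacing the distance of the nearest point by the smaller `a` only lowers the exponent. -/
lemma expNeg_sumBeyond_le (hmono : ∀ y, MonotoneOn (f y) (Ici 0)) (ha : 0 ≤ a)
    (hmin : ∀ k, ‖x (nearest x)‖ ≤ ‖x k‖) (h1 : a ≤ ‖x (nearest x)‖)
    (h2 : ‖x (nearest x)‖ < b) :
    expNeg (sumBeyond f x) ≤ expNeg (∑' n, shell a b 0 (f · a) (x n))
      - expNeg (∑' n, shell a b ∞ (f · a) (x n)) := by
  have htop : ∑' n, shell a b ∞ (f · a) (x n) = ∞ := by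
    refine top_le_iff.1 (le_trans ?_ (ENNReal.le_tsum (nearest x)))
    simp [shell, h2]
  rw [htop, expNeg_top, tsub_zero]
  refine expNeg_antitone (ENNReal.tsum_le_tsum fun n => ?_)
  have hn : ¬ ‖x n‖ < a := not_lt.2 (h1.trans (hmin n))
  rw [shell, if_neg hn]
  split_ifs with h3 h4 h4
  · exact le_rfl
  · exact zero_le
  · rw [h4] at h3; exact absurd h2 h3
  · exact hmono _ ha (ha.trans h1) h1

/-- The difference vanishes unless the inner ball is empty and the annulus is not. A single point in
the annulus is the nearest one and accounts for one factor `expNeg c`, the others being compared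
through `f(·, r) ≤ f(·, b)`. Two points or more give at most `expNeg c * expNeg c`, of second order
when `expNeg c` is small. -/
lemma expNeg_shell_sub_le (hmono : ∀ y, MonotoneOn (f y) (Ici 0)) (ha : 0 ≤ a) (hab : a ≤ b)
    (hmin : ∀ k, ‖x (nearest x)‖ ≤ ‖x k‖) (c : ℝ≥0∞) :
    expNeg (∑' n, shell a b c (f · b) (x n)) - expNeg (∑' n, shell a b ∞ (f · b) (x n))
      ≤ expNeg c * {x : ℕ → Plane | a ≤ ‖x (nearest x)‖ ∧ ‖x (nearest x)‖ < b}.indicator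
          (fun x => expNeg (sumBeyond f x)) x + expNeg c * expNeg c := by
  by_cases hin : ∃ n, ‖x n‖ < a
  · obtain ⟨n, hn⟩ := hin
    have : ∑' n, shell a b c (f · b) (x n) = ∞ :=
      top_le_iff.1 (le_trans (by simp [shell, hn]) (ENNReal.le_tsum n))
    simp [this]
  push Not at hin
  by_cases hann : ∃ n, ‖x n‖ < b
  swap
  · push Not at hann
    have : ∀ c n, shell a b c (f · b) (x n) = f (x n) b := fun c n => by
      simp [shell, (hin n).not_gt, (hann n).not_gt]
    simp [this]
  obtain ⟨m, hm⟩ := hann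
  refine tsub_le_self.trans ?_
  have hshell : ∀ n, ‖x n‖ < b → shell a b c (f · b) (x n) = c := fun n hn => by
    simp [shell, (hin n).not_gt, hn]
  by_cases huniq : ∃ m' ≠ m, ‖x m'‖ < b
  · obtain ⟨m', hne, hm'⟩ := huniq
    refine le_add_left ?_
    rw [← expNeg_add]
    refine expNeg_antitone ?_
    have := ENNReal.sum_le_tsum (f := fun n => shell a b c (f · b) (x n)) {m', m}
    rwa [Finset.sum_pair hne, hshell m' hm', hshell m hm] at this
  push Not at huniq
  have hs : nearest x = m := by
    by_contra hne
    exact absurd (hmin m) (not_le.2 (hm.trans_le (huniq _ hne)))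
  refine le_add_right ?_
  rw [Set.indicator_of_mem (show x ∈ {x : ℕ → Plane | a ≤ ‖x (nearest x)‖ ∧
    ‖x (nearest x)‖ < b} from ⟨hin _, hs ▸ hm⟩), ← expNeg_add]
  refine expNeg_antitone ?_
  -- The lone annulus term is spread out as a series, so that the exponents can be compared term by
  -- term.
  have hc : c = ∑' n, if n = m then c else 0 := by rw [tsum_ite_eq]
  conv_lhs => rw [hc]
  rw [sumBeyond, ← ENNReal.tsum_add]
  refine ENNReal.tsum_le_tsum fun n => ?_
  rw [hs]
  by_cases hn : n = m
  · subst hn; simp [hshell n hm]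
  · simp only [if_neg hn, zero_add]
    simp only [shell, (hin n).not_gt, (huniq n hn).not_gt, if_false]
    exact hmono _ (ha.trans (hin m)) (ha.trans hab) hm.le

end Pointwise

lemma measurable_path (hX : ∀ n, Measurable (X n)) : Measurable fun ω n => X n ω :=
  measurable_pi_lambda _ hX

variable {f : Plane → ℝ → ℝ≥0∞} {A a b : ℝ}

lemma measurableSet_nearest_mem (hX : ∀ n, Measurable (X n)) (a b : ℝ) :
    MeasurableSet {ω | a ≤ ‖X (nearest fun n => X n ω) ω‖
      ∧ ‖X (nearest fun n => X n ω) ω‖ < b} := by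
  have hm : Measurable fun ω => ‖X (nearest fun n => X n ω) ω‖ :=
    (measurable_apply_nearest.comp (measurable_path hX)).norm
  exact (measurableSet_le measurable_const hm).inter (measurableSet_lt hm measurable_const)

lemma IsPoissonProcess.measurable_tsum_shell (h : IsPoissonProcess μ X lam) (a b : ℝ) (c : ℝ≥0∞)
    {φ : Plane → ℝ≥0∞} (hφ : Measurable φ) :
    Measurable fun ω => expNeg (∑' n, shell a b c φ (X n ω)) :=
  measurable_expNeg.comp (Measurable.tsum fun n => (measurable_shell a b c hφ).comp
    (h.measurable n))

/-- With `u` and `d` the mean numbers of points in the inner ball and in the annulus, the shells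
give `exp(-u) (1 - exp(-d))` times a factor at most `exp(-(u A - d))`, and `1 - exp(-d) ≤ d`. The
extra `exp d` is the price of evaluating `f` at radius `a` while integrating only beyond `b`. -/
lemma IsPoissonProcess.setLIntegral_nearest_le [IsProbabilityMeasure μ]
    (h : IsPoissonProcess μ X lam) (hlam : 0 < lam) (hf : ∀ r, Measurable (f · r))
    (hmono : ∀ y, MonotoneOn (f y) (Ici 0))
    (hInt : ∀ r, 0 < r → ∫⁻ x in (Metric.ball 0 r)ᶜ, (1 - expNeg (f x r))
      = ENNReal.ofReal (Real.pi * r ^ 2 * A)) (ha : 0 ≤ a) (hab : a ≤ b) :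
    ∫⁻ ω in {ω | a ≤ ‖X (nearest fun n => X n ω) ω‖ ∧ ‖X (nearest fun n => X n ω) ω‖ < b},
        expNeg (sumBeyond f fun n => X n ω) ∂μ
      ≤ ENNReal.ofReal (lam * Real.pi * (b ^ 2 - a ^ 2)
          * Real.exp (lam * Real.pi * (b ^ 2 - a ^ 2))
          * Real.exp (-(lam * Real.pi * a ^ 2 * (1 + A)))) := by
  set J := ∫⁻ x in (Metric.ball 0 b)ᶜ, (1 - expNeg (f x a)) with hJ
  set u := lam * Real.pi * a ^ 2 with hu
  set d := lam * Real.pi * (b ^ 2 - a ^ 2) with hd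
  have hp := Real.pi_pos
  have hd0 : 0 ≤ d := mul_nonneg (by positivity) (by nlinarith)
  have hu0 : 0 ≤ u := by positivity
  have step1 : ∫⁻ ω in {ω | a ≤ ‖X (nearest fun n => X n ω) ω‖
        ∧ ‖X (nearest fun n => X n ω) ω‖ < b}, expNeg (sumBeyond f fun n => X n ω) ∂μ
      ≤ ∫⁻ ω, expNeg (∑' n, shell a b 0 (f · a) (X n ω))
          - expNeg (∑' n, shell a b ∞ (f · a) (X n ω)) ∂μ := by
    rw [← lintegral_indicator (measurableSet_nearest_mem h.measurable a b)]
    refine lintegral_mono_ae ?_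
    filter_upwards [h.ae_nearest_le] with ω hω
    by_cases hm : ω ∈ {ω | a ≤ ‖X (nearest fun n => X n ω) ω‖
        ∧ ‖X (nearest fun n => X n ω) ω‖ < b}
    · rw [Set.indicator_of_mem hm]
      exact expNeg_sumBeyond_le (x := fun n => X n ω) hmono ha hω hm.1 hm.2
    · rw [Set.indicator_of_notMem hm]; exact zero_le
  have hle : ∀ ω, expNeg (∑' n, shell a b ∞ (f · a) (X n ω))
      ≤ expNeg (∑' n, shell a b 0 (f · a) (X n ω)) := fun ω => by
    refine expNeg_antitone (ENNReal.tsum_le_tsum fun n => ?_)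
    simp only [shell]
    split_ifs <;> simp
  -- `hInt` at radius `a` also covers the annulus, whose share is at most its area. For `a = 0`,
  -- where `hInt` says nothing, the left side is 0.
  have step2 : ENNReal.ofReal (u * A - d) ≤ ENNReal.ofReal lam * J := by
    rcases ha.eq_or_lt with rfl | ha'
    · rw [ENNReal.ofReal_of_nonpos]
      · exact zero_le
      · simp [hu, hd0]
    have h1 : ENNReal.ofReal (Real.pi * a ^ 2 * A)
        ≤ J + ENNReal.ofReal (Real.pi * (b ^ 2 - a ^ 2)) := by
      rw [← hInt a ha', ← volume_annulus ha hab, hJ]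
      have hset : (Metric.ball (0 : Plane) a)ᶜ
          = (Metric.ball 0 b)ᶜ ∪ (Metric.ball 0 b \ Metric.ball 0 a) := by
        ext y
        simp only [mem_compl_iff, mem_ball_zero_iff, mem_union, Set.mem_sdiff, not_lt]
        constructor
        · intro hy
          rcases lt_or_ge ‖y‖ b with h' | h'
          · exact Or.inr ⟨h', hy⟩
          · exact Or.inl h'
        · rintro (h' | h')
          · exact hab.trans h'
          · exact h'.2
      rw [hset]
      refine (lintegral_union_le _ _ _).trans (add_le_add_right ?_ _)
      refine (lintegral_mono fun y => (tsub_le_self : 1 - expNeg (f y a) ≤ 1)).trans ?_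
      simp
    have h2 : ENNReal.ofReal (u * A)
        ≤ ENNReal.ofReal lam * J + ENNReal.ofReal d := by
      have := mul_le_mul_right h1 (ENNReal.ofReal lam)
      rw [mul_add, ← ENNReal.ofReal_mul hlam.le, ← ENNReal.ofReal_mul hlam.le] at this
      rwa [show lam * (Real.pi * a ^ 2 * A) = u * A by rw [hu]; ring, ← mul_assoc lam] at this
    rw [ENNReal.ofReal_sub _ hd0]
    exact tsub_le_iff_right.2 h2
  have step3 : expNeg (ENNReal.ofReal lam * J) ≤ ENNReal.ofReal (Real.exp (-(u * A - d))) := by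
    rcases le_total 0 (u * A - d) with h0 | h0
    · rw [← expNeg_ofReal h0]; exact expNeg_antitone step2
    · refine (expNeg_le_one _).trans ?_
      rw [ENNReal.one_le_ofReal]; exact Real.one_le_exp (by linarith)
  refine step1.trans ?_
  rw [lintegral_sub (h.measurable_tsum_shell a b ∞ (hf a)) _ (ae_of_all _ hle),
    h.lintegral_expNeg_shell hlam.le ha hab 0 (hf a),
    h.lintegral_expNeg_shell hlam.le ha hab ∞ (hf a), ← hJ]
  · simp only [expNeg_zero, expNeg_top, ENNReal.toReal_one, ENNReal.toReal_zero, sub_self,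
      sub_zero, mul_zero, add_zero, mul_one, ← hu, ← hd]
    rw [← ENNReal.sub_mul (fun _ _ => ne_top_of_le_ne_top ENNReal.one_ne_top (expNeg_le_one _)),
      ← ENNReal.ofReal_sub _ (Real.exp_pos _).le]
    refine (mul_le_mul_right step3 _).trans ?_
    rw [← ENNReal.ofReal_mul']
    swap
    · positivity
    refine ENNReal.ofReal_le_ofReal ?_
    have e1 : Real.exp (-(u + d)) = Real.exp (-u) * Real.exp (-d) := by
      rw [← Real.exp_add]; ring_nf
    have e2 : Real.exp (-(u * A - d)) = Real.exp d * Real.exp (-(u * A)) := by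
      rw [← Real.exp_add]; ring_nf
    have e3 : Real.exp (-(u * (1 + A))) = Real.exp (-u) * Real.exp (-(u * A)) := by
      rw [← Real.exp_add]; ring_nf
    rw [e1, e2, e3]
    have e4 : 1 - Real.exp (-d) ≤ d := by linarith [Real.add_one_le_exp (-d)]
    have : 0 ≤ Real.exp (-u) * (Real.exp d * Real.exp (-(u * A))) := by positivity
    nlinarith [mul_le_mul_of_nonneg_left e4 this]
  · refine ne_top_of_le_ne_top ENNReal.one_ne_top
      ((lintegral_mono fun ω => expNeg_le_one _).trans ?_)
    simp

/-- Radius `b` serves both for `f` and for the domain of integration, so `hInt` applies exactly. The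
second-order term of `expNeg_shell_sub_le` is removed by a limit. -/
lemma IsPoissonProcess.le_setLIntegral_nearest [IsProbabilityMeasure μ]
    (h : IsPoissonProcess μ X lam) (hlam : 0 < lam) (hf : ∀ r, Measurable (f · r))
    (hmono : ∀ y, MonotoneOn (f y) (Ici 0)) (hA : 0 ≤ A)
    (hInt : ∀ r, 0 < r → ∫⁻ x in (Metric.ball 0 r)ᶜ, (1 - expNeg (f x r))
      = ENNReal.ofReal (Real.pi * r ^ 2 * A)) (ha : 0 ≤ a) (hab : a < b) :
    ENNReal.ofReal (lam * Real.pi * (b ^ 2 - a ^ 2)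
        * Real.exp (-(lam * Real.pi * b ^ 2 * (1 + A))))
      ≤ ∫⁻ ω in {ω | a ≤ ‖X (nearest fun n => X n ω) ω‖ ∧ ‖X (nearest fun n => X n ω) ω‖ < b},
          expNeg (sumBeyond f fun n => X n ω) ∂μ := by
  set I := ∫⁻ ω in {ω | a ≤ ‖X (nearest fun n => X n ω) ω‖
    ∧ ‖X (nearest fun n => X n ω) ω‖ < b}, expNeg (sumBeyond f fun n => X n ω) ∂μ with hI
  have hS := measurableSet_nearest_mem h.measurable a b
  set v := lam * Real.pi * b ^ 2 with hv
  set d := lam * Real.pi * (b ^ 2 - a ^ 2) with hd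
  have hp := Real.pi_pos
  have hd0 : 0 ≤ d := mul_nonneg (by positivity) (by nlinarith)
  have hv0 : 0 ≤ v := by positivity
  -- Here `z = expNeg c` is the weight of an annulus point. The difference of the shells is at least
  -- `z` times the left side and at most `z I + z²`; division by `z` leaves an error `z`, which then
  -- tends to 0.
  have hbound : ∀ z : ℝ, 0 < z → z < 1 →
      ENNReal.ofReal (d * Real.exp (-(v * (1 + A)))) ≤ I + ENNReal.ofReal z := by
    intro z hz hz1
    set c := ENNReal.ofReal (-Real.log z) with hc
    have hec : expNeg c = ENNReal.ofReal z := by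
      rw [hc, expNeg_ofReal (by linarith [Real.log_neg hz hz1]), neg_neg, Real.exp_log hz]
    have hle : ∀ ω, expNeg (∑' n, shell a b ∞ (f · b) (X n ω))
        ≤ expNeg (∑' n, shell a b c (f · b) (X n ω)) := fun ω => by
      refine expNeg_antitone (ENNReal.tsum_le_tsum fun n => ?_)
      simp only [shell]
      split_ifs <;> simp
    have h1 : ∫⁻ ω, expNeg (∑' n, shell a b c (f · b) (X n ω))
          - expNeg (∑' n, shell a b ∞ (f · b) (X n ω)) ∂μ
        ≤ ENNReal.ofReal z * I + ENNReal.ofReal z * ENNReal.ofReal z := by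
      calc _ ≤ ∫⁻ ω, ENNReal.ofReal z * {ω | a ≤ ‖X (nearest fun n => X n ω) ω‖
              ∧ ‖X (nearest fun n => X n ω) ω‖ < b}.indicator
                (fun ω => expNeg (sumBeyond f fun n => X n ω)) ω
              + ENNReal.ofReal z * ENNReal.ofReal z ∂μ := by
            refine lintegral_mono_ae ?_
            filter_upwards [h.ae_nearest_le] with ω hω
            rw [← hec]
            exact expNeg_shell_sub_le (x := fun n => X n ω) hmono ha hab.le hω c
        _ = _ := by
            rw [lintegral_add_right _ measurable_const, lintegral_const_mul' _ _ (by simp),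
              lintegral_indicator hS, lintegral_const, measure_univ, mul_one]
    rw [lintegral_sub (h.measurable_tsum_shell a b ∞ (hf b)) _ (ae_of_all _ hle),
      h.lintegral_expNeg_shell hlam.le ha hab.le c (hf b),
      h.lintegral_expNeg_shell hlam.le ha hab.le ∞ (hf b), hInt b (ha.trans_lt hab), hec] at h1
    · rw [← ENNReal.ofReal_mul hlam.le, expNeg_ofReal (by positivity),
        ← ENNReal.ofReal_mul (by positivity), ← ENNReal.ofReal_mul (by positivity),
        ← ENNReal.ofReal_sub _ (by positivity), ← mul_add] at h1
      simp only [expNeg_top, ENNReal.toReal_zero, ENNReal.toReal_ofReal hz.le, sub_zero,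
        mul_one] at h1
      have e1 : lam * Real.pi * a ^ 2 + d * (1 - z) = v - d * z := by simp only [hd, hv]; ring
      have e2 : lam * Real.pi * a ^ 2 + d = v := by simp only [hd, hv]; ring
      have e3 : lam * (Real.pi * b ^ 2 * A) = v * A := by simp only [hv]; ring
      rw [e1, e2, e3] at h1
      have h2 : z * (d * Real.exp (-(v * (1 + A))))
          ≤ Real.exp (-(v - d * z)) * Real.exp (-(v * A)) - Real.exp (-v) * Real.exp (-(v * A)) := by
        have e4 : Real.exp (-(v * (1 + A))) = Real.exp (-v) * Real.exp (-(v * A)) := by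
          rw [← Real.exp_add]; ring_nf
        have e5 : Real.exp (-(v - d * z)) = Real.exp (-v) * Real.exp (d * z) := by
          rw [← Real.exp_add]; ring_nf
        rw [e4, e5]
        have e6 : d * z ≤ Real.exp (d * z) - 1 := by linarith [Real.add_one_le_exp (d * z)]
        have : 0 ≤ Real.exp (-v) * Real.exp (-(v * A)) := by positivity
        nlinarith [mul_le_mul_of_nonneg_left e6 this]
      have h3 := (ENNReal.ofReal_le_ofReal h2).trans h1
      rw [ENNReal.ofReal_mul hz.le] at h3
      exact (ENNReal.mul_le_mul_iff_right (by simpa using hz) ENNReal.ofReal_ne_top).1 h3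
    · refine ne_top_of_le_ne_top ENNReal.one_ne_top
        ((lintegral_mono fun ω => expNeg_le_one _).trans ?_)
      simp
  have hlim : Tendsto (fun z : ℝ => I + ENNReal.ofReal z) (𝓝[>] 0) (𝓝 (I + ENNReal.ofReal 0)) :=
    ((ENNReal.continuous_ofReal.tendsto 0).mono_left nhdsWithin_le_nhds).const_add I
  rw [ENNReal.ofReal_zero, add_zero] at hlim
  refine ge_of_tendsto hlim ?_
  filter_upwards [Ioo_mem_nhdsGT (show (0 : ℝ) < 1 by norm_num)] with z hz
  exact hbound z hz.1 hz.2

end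

/-! ### Summation over thin annuli -/

section

lemma tsum_ofReal_mul_pow {C q : ℝ} (hC : 0 ≤ C) (hq : 0 ≤ q) (hq1 : q < 1) :
    ∑' k : ℕ, ENNReal.ofReal (C * q ^ k) = ENNReal.ofReal (C / (1 - q)) := by
  have hs := (hasSum_geometric_of_lt_one hq hq1).mul_left C
  rw [← ENNReal.ofReal_tsum_of_nonneg (fun k => by positivity) hs.summable, hs.tsum_eq,
    div_eq_mul_inv]

variable {Ω : Type*} [MeasurableSpace Ω] {μ : Measure Ω} {X : ℕ → Ω → Plane} {lam : ℝ}
  {f : Plane → ℝ → ℝ≥0∞} {A : ℝ}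

/-- The annulus bounds form geometric series of ratio `q = exp(-ε (1 + A))`: they sum to `ε q / (1 -
q)` from below and `ε exp(ε) / (1 - q)` from above. Both tend to `1 / (1 + A)` as `ε → 0`. -/
lemma IsPoissonProcess.lintegral_expNeg_sumBeyond_bounds [IsProbabilityMeasure μ]
    (h : IsPoissonProcess μ X lam) (hlam : 0 < lam) (hf : ∀ r, Measurable (f · r))
    (hmono : ∀ y, MonotoneOn (f y) (Ici 0)) (hA : 0 ≤ A)
    (hInt : ∀ r, 0 < r → ∫⁻ x in (Metric.ball 0 r)ᶜ, (1 - expNeg (f x r))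
      = ENNReal.ofReal (Real.pi * r ^ 2 * A)) {ε : ℝ} (hε : 0 < ε) :
    ENNReal.ofReal (Real.exp (-(ε * (1 + A))) / (1 + A))
        ≤ ∫⁻ ω, expNeg (sumBeyond f fun n => X n ω) ∂μ ∧
      ∫⁻ ω, expNeg (sumBeyond f fun n => X n ω) ∂μ
        ≤ ENNReal.ofReal (Real.exp ε * (1 + ε * (1 + A)) / (1 + A)) := by
  have hp := Real.pi_pos
  -- Radii for which every annulus contains `ε` points on average.
  set r : ℕ → ℝ := fun k => Real.sqrt (k * ε / (lam * Real.pi)) with hr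
  have hr2 : ∀ k, lam * Real.pi * r k ^ 2 = k * ε := fun k => by
    rw [hr, Real.sq_sqrt (by positivity)]; field_simp
  have hr0 : ∀ k, 0 ≤ r k := fun k => Real.sqrt_nonneg _
  have hrlt : StrictMono r := strictMono_nat_of_lt_succ fun k => by
    refine Real.sqrt_lt_sqrt (by positivity) ?_
    gcongr; simp
  have hd : ∀ k, lam * Real.pi * (r (k + 1) ^ 2 - r k ^ 2) = ε := fun k => by
    rw [mul_sub, hr2, hr2]; push_cast; ring
  have hrtop : Tendsto r atTop atTop := by
    refine Real.tendsto_sqrt_atTop.comp ?_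
    exact (tendsto_natCast_atTop_atTop.atTop_mul_const hε).atTop_div_const (by positivity)
  set S : ℕ → Set Ω := fun k => {ω | r k ≤ ‖X (nearest fun n => X n ω) ω‖
    ∧ ‖X (nearest fun n => X n ω) ω‖ < r (k + 1)} with hS
  have hSm : ∀ k, MeasurableSet (S k) := fun k => measurableSet_nearest_mem h.measurable _ _
  have hSdis : Pairwise fun i j => Disjoint (S i) (S j) := by
    have aux : ∀ i j, i < j → Disjoint (S i) (S j) := fun i j hij =>
      Set.disjoint_left.2 fun ω h1 h2 => by
        have : r (i + 1) ≤ r j := hrlt.monotone hij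
        exact absurd (h2.1.trans_lt h1.2) (not_lt.2 this)
    intro i j hij
    rcases hij.lt_or_gt with h' | h'
    · exact aux i j h'
    · exact (aux j i h').symm
  have hSU : ⋃ k, S k = univ := by
    refine Set.eq_univ_of_forall fun ω => ?_
    have hex : ∃ k, ‖X (nearest fun n => X n ω) ω‖ < r (k + 1) :=
      ((hrtop.comp (tendsto_add_atTop_nat 1)).eventually_gt_atTop _).exists
    classical
    refine mem_iUnion.2 ⟨Nat.find hex, ?_, Nat.find_spec hex⟩
    rcases hk : Nat.find hex with _ | k
    · simp [hr]
    · exact not_lt.1 (Nat.find_min hex (m := k) (by omega))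
  have hsum : ∫⁻ ω, expNeg (sumBeyond f fun n => X n ω) ∂μ
      = ∑' k, ∫⁻ ω in S k, expNeg (sumBeyond f fun n => X n ω) ∂μ := by
    rw [← setLIntegral_univ, ← hSU, lintegral_iUnion hSm hSdis]
  set q := Real.exp (-(ε * (1 + A))) with hq
  have hεA : 0 < ε * (1 + A) := by positivity
  have hq0 : 0 < q := Real.exp_pos _
  have hq1 : q < 1 := Real.exp_lt_one_iff.2 (by linarith)
  have hqk : ∀ k : ℕ, Real.exp (-(k * ε * (1 + A))) = q ^ k := fun k => by
    rw [hq, ← Real.exp_nat_mul]; ring_nf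
  rw [hsum]
  constructor
  · calc ENNReal.ofReal (q / (1 + A)) ≤ ENNReal.ofReal (ε * q / (1 - q)) := by
          refine ENNReal.ofReal_le_ofReal ?_
          rw [div_le_div_iff₀ (by positivity) (by linarith)]
          have : 1 - q ≤ ε * (1 + A) := by linarith [Real.add_one_le_exp (-(ε * (1 + A)))]
          nlinarith
      _ = ∑' k : ℕ, ENNReal.ofReal (ε * q * q ^ k) :=
          (tsum_ofReal_mul_pow (by positivity) hq0.le hq1).symm
      _ ≤ _ := by
          refine ENNReal.tsum_le_tsum fun k => ?_
          have := h.le_setLIntegral_nearest hlam hf hmono hA hInt (hr0 k) (hrlt k.lt_succ_self)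
          rw [hd, hr2, hqk] at this
          rwa [mul_assoc, ← pow_succ']
  · calc _ ≤ ∑' k : ℕ, ENNReal.ofReal (ε * Real.exp ε * q ^ k) := by
          refine ENNReal.tsum_le_tsum fun k => ?_
          have := h.setLIntegral_nearest_le hlam hf hmono hInt (hr0 k)
            (hrlt k.lt_succ_self).le
          rwa [hd, hr2, hqk] at this
      _ = ENNReal.ofReal (ε * Real.exp ε / (1 - q)) :=
          tsum_ofReal_mul_pow (by positivity) hq0.le hq1
      _ ≤ _ := by
          refine ENNReal.ofReal_le_ofReal ?_
          rw [div_le_div_iff₀ (by linarith) (by positivity)]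
          have h1 : q * (1 + ε * (1 + A)) ≤ 1 := by
            have h2 := Real.add_one_le_exp (ε * (1 + A))
            have h3 : q * Real.exp (ε * (1 + A)) = 1 := by rw [hq, ← Real.exp_add]; simp
            nlinarith
          have h4 : ε * (1 + A) ≤ (1 + ε * (1 + A)) * (1 - q) := by nlinarith
          nlinarith [mul_le_mul_of_nonneg_left h4 (Real.exp_pos ε).le]

/-- Averages of products over the points of a Poisson process seen from its nearest point. If
`1 - exp (-f(·, r))` has integral `π r² A` beyond the distance `r`, for every `r`, then
`𝔼 exp (-∑ f(Xₙ, R)) = 1 / (1 + A)`, where `R` is the distance of the nearest point and the sum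
runs over the other points. -/
theorem IsPoissonProcess.lintegral_expNeg_sumBeyond [IsProbabilityMeasure μ]
    (h : IsPoissonProcess μ X lam) (hlam : 0 < lam) (hf : ∀ r, Measurable (f · r))
    (hmono : ∀ y, MonotoneOn (f y) (Ici 0)) (hA : 0 ≤ A)
    (hInt : ∀ r, 0 < r → ∫⁻ x in (Metric.ball 0 r)ᶜ, (1 - expNeg (f x r))
      = ENNReal.ofReal (Real.pi * r ^ 2 * A)) :
    ∫⁻ ω, expNeg (sumBeyond f fun n => X n ω) ∂μ = ENNReal.ofReal (1 / (1 + A)) := by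
  have hb := fun (ε : ℝ) (hε : 0 < ε) =>
    h.lintegral_expNeg_sumBeyond_bounds hlam hf hmono hA hInt hε
  have c1 : Continuous fun ε : ℝ => ENNReal.ofReal (Real.exp (-(ε * (1 + A))) / (1 + A)) := by
    refine ENNReal.continuous_ofReal.comp ?_; fun_prop
  have c2 : Continuous fun ε : ℝ =>
      ENNReal.ofReal (Real.exp ε * (1 + ε * (1 + A)) / (1 + A)) := by
    refine ENNReal.continuous_ofReal.comp ?_; fun_prop
  have t1 := (c1.tendsto 0).mono_left (nhdsWithin_le_nhds (s := Ioi 0))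
  have t2 := (c2.tendsto 0).mono_left (nhdsWithin_le_nhds (s := Ioi 0))
  simp only [zero_mul, neg_zero, Real.exp_zero, add_zero, one_mul] at t1 t2
  refine le_antisymm (ge_of_tendsto t2 ?_) (le_of_tendsto t1 ?_)
  · filter_upwards [self_mem_nhdsWithin] with ε hε using (hb ε hε).2
  · filter_upwards [self_mem_nhdsWithin] with ε hε using (hb ε hε).1

end

section

/-! ### The exponential distribution -/

instance : IsProbabilityMeasure (expMeasure 1) := isProbabilityMeasure_expMeasure one_pos

lemma lintegral_expMeasure {g : ℝ → ℝ≥0∞} (hg : Measurable g) :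
    ∫⁻ x, g x ∂(expMeasure 1) = ∫⁻ x in Ioi 0, ENNReal.ofReal (Real.exp (-x)) * g x := by
  have hm : Measurable (exponentialPDF 1) :=
    (measurable_exponentialPDFReal 1).ennreal_ofReal
  have h1 : expMeasure 1 = volume.withDensity (exponentialPDF 1) := rfl
  rw [h1, lintegral_withDensity_eq_lintegral_mul _ hm hg, ← lintegral_indicator measurableSet_Ioi]
  refine lintegral_congr_ae ?_
  filter_upwards [(measure_eq_zero_iff_ae_notMem.1 (measure_singleton (0 : ℝ)))] with x hx
  rcases lt_trichotomy x 0 with h | h | h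
  · simp [exponentialPDF_of_neg h, h.not_gt]
  · exact absurd h hx
  · simp [exponentialPDF_of_nonneg h.le, h]

lemma expMeasure_lt_ofReal (T : ℝ≥0∞) : expMeasure 1 {h | T < ENNReal.ofReal h} = expNeg T := by
  rcases eq_or_ne T ∞ with rfl | hT
  · simp
  have ht : 0 ≤ T.toReal := ENNReal.toReal_nonneg
  have hset : {h | T < ENNReal.ofReal h} = (Iic T.toReal)ᶜ := by
    ext h
    simp only [mem_ofPred_eq, mem_compl_iff, mem_Iic, not_le]
    rw [ENNReal.lt_ofReal_iff_toReal_lt hT]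
  have hcdf := cdf_expMeasure_eq one_pos T.toReal
  rw [if_pos ht, one_mul, cdf_eq_real] at hcdf
  rw [hset, prob_compl_eq_one_sub measurableSet_Iic, ← ofReal_measureReal, hcdf]
  conv_rhs => rw [← ENNReal.ofReal_toReal hT, expNeg_ofReal ht]
  rw [← ENNReal.ofReal_one, ← ENNReal.ofReal_sub _ (by simp [ht])]
  congr 1; ring

lemma ae_expMeasure_pos : ∀ᵐ h ∂(expMeasure 1), 0 < h := by
  have := expMeasure_lt_ofReal 0
  rw [expNeg_zero, ← prob_compl_eq_zero_iff] at this
  · filter_upwards [show ∀ᵐ h ∂(expMeasure 1), 0 < ENNReal.ofReal h from this] with h hh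
    simpa using hh
  · exact measurableSet_lt measurable_const ENNReal.measurable_ofReal

lemma lintegral_expNeg_expMeasure {t : ℝ} (ht : 0 ≤ t) :
    ∫⁻ h, expNeg (ENNReal.ofReal (t * h)) ∂(expMeasure 1) = ENNReal.ofReal (1 / (1 + t)) := by
  have hm : Measurable fun h : ℝ => expNeg (ENNReal.ofReal (t * h)) :=
    measurable_expNeg.comp (by fun_prop)
  rw [lintegral_expMeasure hm]
  have hneg : -(1 + t) < 0 := by linarith
  have h1 : ∫⁻ x in Ioi 0, ENNReal.ofReal (Real.exp (-x)) * expNeg (ENNReal.ofReal (t * x))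
      = ∫⁻ x in Ioi (0 : ℝ), ENNReal.ofReal (Real.exp (-(1 + t) * x)) := by
    refine setLIntegral_congr_fun measurableSet_Ioi fun x (hx : 0 < x) => ?_
    rw [expNeg_ofReal (by positivity), ← ENNReal.ofReal_mul (Real.exp_pos _).le, ← Real.exp_add]
    congr 2; ring
  rw [h1, ← ofReal_integral_eq_lintegral_ofReal (integrableOn_exp_mul_Ioi hneg 0)
    (ae_of_all _ fun x => (Real.exp_pos _).le), integral_exp_mul_Ioi hneg]
  rw [mul_zero, Real.exp_zero, neg_div_neg_eq]

lemma lintegral_rpow_expMeasure {p : ℝ} (hp : -1 < p) :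
    ∫⁻ h, ENNReal.ofReal (h ^ p) ∂(expMeasure 1) = ENNReal.ofReal (Real.Gamma (1 + p)) := by
  have hp' : 0 < 1 + p := by linarith
  rw [lintegral_expMeasure (by fun_prop), Real.Gamma_eq_integral hp',
    ofReal_integral_eq_lintegral_ofReal (Real.GammaIntegral_convergent hp')]
  · refine setLIntegral_congr_fun measurableSet_Ioi fun x (hx : 0 < x) => ?_
    rw [← ENNReal.ofReal_mul (Real.exp_pos _).le, add_sub_cancel_left]
  · refine (ae_restrict_iff' measurableSet_Ioi).2 (ae_of_all _ fun x (hx : 0 < x) => ?_)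
    positivity

/-! ### Integrals over the plane -/

lemma volume_le_mul_rpow_neg {β k e : ℝ} (hβ : 0 < β) (hk : 0 < k) (he : 0 < e) :
    volume {x : Plane | e ≤ k * ‖x‖ ^ (-β)}
      = ENNReal.ofReal (Real.pi * (k ^ (2 / β) * e ^ (-(2 / β)))) := by
  -- The origin is removed because `0 ^ (-β) = 0` by convention.
  have hset : {x : Plane | e ≤ k * ‖x‖ ^ (-β)}
      = Metric.closedBall 0 ((k / e) ^ (1 / β)) \ {0} := by
    ext x
    simp only [mem_ofPred_eq, Set.mem_sdiff, mem_closedBall_zero_iff, mem_singleton_iff]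
    rcases eq_or_ne x 0 with rfl | hx
    · simp [Real.zero_rpow (neg_ne_zero.2 hβ.ne'), he]
    · have hx' : 0 < ‖x‖ := norm_pos_iff.2 hx
      rw [Real.rpow_neg hx'.le, one_div, Real.le_rpow_inv_iff_of_pos, le_div_iff₀ he]
      rotate_left
      · exact hx'.le
      · positivity
      · exact hβ
      rw [← div_eq_mul_inv, le_div_iff₀ (by positivity), mul_comm]
      simp [hx]
  rw [hset, measure_sdiff_null (measure_singleton _), Measure.addHaar_closedBall_eq_addHaar_ball,
    volume_ball_plane (by positivity), ← Real.rpow_natCast, ← Real.rpow_mul (by positivity),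
    Real.div_rpow hk.le he.le, Real.rpow_neg he.le]
  congr 2
  rw [show (1 / β * ((2 : ℕ) : ℝ)) = 2 / β by push_cast; ring]
  rfl

/-- For independent exponential `E` and `H`, `P(E > t H) = 𝔼 exp(-t H) = 1 / (1 + t)`. The indicator
form allows the integral over the plane to be taken before those over `E` and `H`. -/
lemma one_sub_ofReal_eq_lintegral {t : ℝ} (ht : 0 ≤ t) :
    1 - ENNReal.ofReal (1 / (1 + t))
      = ∫⁻ h, ∫⁻ e, {e | e ≤ t * h}.indicator (fun _ => (1 : ℝ≥0∞)) e
          ∂(expMeasure 1) ∂(expMeasure 1) := by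
  have h1 : ∀ᵐ h ∂(expMeasure 1), ∫⁻ e, {e | e ≤ t * h}.indicator (fun _ => (1 : ℝ≥0∞)) e
      ∂(expMeasure 1) = 1 - expNeg (ENNReal.ofReal (t * h)) := by
    filter_upwards [ae_expMeasure_pos] with h hh
    have hset : {e | e ≤ t * h} = {e | ENNReal.ofReal (t * h) < ENNReal.ofReal e}ᶜ := by
      ext e
      simp only [mem_ofPred_eq, mem_compl_iff, not_lt]
      exact (ENNReal.ofReal_le_ofReal_iff (by positivity)).symm
    have hm : MeasurableSet {e | e ≤ t * h} := measurableSet_Iic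
    rw [lintegral_indicator_const hm, one_mul, hset,
      prob_compl_eq_one_sub (measurableSet_lt measurable_const ENNReal.measurable_ofReal),
      expMeasure_lt_ofReal]
  rw [lintegral_congr_ae h1, lintegral_sub, lintegral_expNeg_expMeasure ht]
  · simp
  · exact measurable_expNeg.comp (by fun_prop)
  · rw [lintegral_expNeg_expMeasure ht]; simp
  · exact ae_of_all _ fun h => expNeg_le_one _

/-- The integral which gives the interference of a Poisson process with Rayleigh fading. -/
lemma lintegral_one_sub_inv_one_add {β s : ℝ} (hβ : 2 < β) (hs : 0 < s) :
    ∫⁻ x : Plane, (1 - ENNReal.ofReal (1 / (1 + s * ‖x‖ ^ (-β))))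
      = ENNReal.ofReal (Real.pi * s ^ (2 / β)
          * (Real.Gamma (1 + 2 / β) * Real.Gamma (1 - 2 / β))) := by
  have hβ0 : 0 < β := by linarith
  have hb1 : 2 / β < 1 := by rw [div_lt_one hβ0]; exact hβ
  have hb0 : 0 < 2 / β := by positivity
  -- By Tonelli the plane is integrated first: the disc has area `π (s h / e) ^ (2 / β)`. The
  -- moments of order `2 / β` and `-(2 / β)` of the exponential law then give the two Gamma factors;
  -- the second is finite because `β > 2`.
  set F : Plane → ℝ → ℝ → ℝ≥0∞ := fun x h e =>
    {e | e ≤ s * ‖x‖ ^ (-β) * h}.indicator (fun _ => (1 : ℝ≥0∞)) e with hF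
  have hFm : Measurable fun p : (Plane × ℝ) × ℝ => F p.1.1 p.1.2 p.2 := by
    have : (fun p : (Plane × ℝ) × ℝ => F p.1.1 p.1.2 p.2)
        = {p : (Plane × ℝ) × ℝ | p.2 ≤ s * ‖p.1.1‖ ^ (-β) * p.1.2}.indicator (fun _ => 1) := by
      ext p; simp [hF, Set.indicator]
    rw [this]
    exact measurable_const.indicator (measurableSet_le (by fun_prop) (by fun_prop))
  calc ∫⁻ x : Plane, (1 - ENNReal.ofReal (1 / (1 + s * ‖x‖ ^ (-β))))
      = ∫⁻ x : Plane, ∫⁻ h, ∫⁻ e, F x h e ∂(expMeasure 1) ∂(expMeasure 1) :=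
        lintegral_congr fun x => one_sub_ofReal_eq_lintegral (by positivity)
    _ = ∫⁻ h, (∫⁻ x : Plane, ∫⁻ e, F x h e ∂(expMeasure 1)) ∂(expMeasure 1) :=
        lintegral_lintegral_swap hFm.lintegral_prod_right'.aemeasurable
    _ = ∫⁻ h, ∫⁻ e, (∫⁻ x : Plane, F x h e) ∂(expMeasure 1) ∂(expMeasure 1) := by
        refine lintegral_congr fun h => lintegral_lintegral_swap ?_
        have hg : Measurable fun p : Plane × ℝ => ((p.1, h), p.2) := by fun_prop
        exact (hFm.comp hg).aemeasurable
    _ = ∫⁻ h, ∫⁻ e, ENNReal.ofReal (Real.pi * s ^ (2 / β)) * ENNReal.ofReal (h ^ (2 / β))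
          * ENNReal.ofReal (e ^ (-(2 / β))) ∂(expMeasure 1) ∂(expMeasure 1) := by
        refine lintegral_congr_ae ?_
        filter_upwards [ae_expMeasure_pos] with h hh
        refine lintegral_congr_ae ?_
        filter_upwards [ae_expMeasure_pos] with e he
        have h1 : (fun x => F x h e)
            = {x : Plane | e ≤ s * h * ‖x‖ ^ (-β)}.indicator (fun _ => 1) := by
          ext x; simp [hF, Set.indicator, mul_right_comm]
        have hm : MeasurableSet {x : Plane | e ≤ s * h * ‖x‖ ^ (-β)} :=
          measurableSet_le (by fun_prop) (by fun_prop)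
        rw [h1, lintegral_indicator_const hm, one_mul,
          volume_le_mul_rpow_neg hβ0 (by positivity) he, Real.mul_rpow hs.le hh.le,
          ← ENNReal.ofReal_mul (by positivity), ← ENNReal.ofReal_mul (by positivity)]
        congr 1; ring
    _ = _ := by
        have hm : Measurable fun e : ℝ => ENNReal.ofReal (e ^ (-(2 / β))) := by fun_prop
        have hm' : Measurable fun e : ℝ => ENNReal.ofReal (e ^ (2 / β)) := by fun_prop
        simp_rw [lintegral_const_mul _ hm, lintegral_rpow_expMeasure
          (show -1 < -(2 / β) by linarith)]
        rw [lintegral_mul_const _ (hm'.const_mul _), lintegral_const_mul _ hm',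
          lintegral_rpow_expMeasure (by linarith), mul_assoc, ← ENNReal.ofReal_mul,
          ← ENNReal.ofReal_mul (by positivity), ← sub_eq_add_neg]
        exact (Real.Gamma_pos_of_pos (by linarith)).le

end

/-! ### The function `Z` as an integral outside a disc -/

section

lemma intervalIntegrable_rpow_neg_div {p g : ℝ} (hp : p < 1) (hg : 0 ≤ g) :
    IntervalIntegrable (fun t : ℝ => t ^ (-p) / (1 + g * t)) volume 0 1 := by
  have h1 : IntervalIntegrable (fun t : ℝ => t ^ (-p)) volume 0 1 :=
    intervalIntegral.intervalIntegrable_rpow' (by linarith)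
  refine h1.mono_fun (Measurable.aestronglyMeasurable (by fun_prop)) ?_
  rw [uIoc_of_le zero_le_one]
  refine (ae_restrict_iff' measurableSet_Ioc).2 (ae_of_all _ fun t ht => ?_)
  have ht0 : 0 < t := ht.1
  simp only [norm_div]
  refine div_le_self (norm_nonneg _) ?_
  rw [Real.norm_of_nonneg (by positivity)]
  nlinarith [mul_nonneg hg ht0.le]

namespace Params

variable {c : Params}

/-- With lower parameter `1 + b` the factor `(1 - t)` of Euler's integral has exponent 0, and the
Gamma quotient equals `b = 1 - 2 / β`, which cancels the denominator `β - 2`. -/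
lemma Z_eq (hβ : 2 < c.β) (g : ℝ) :
    c.Z g = 2 / c.β * g * ∫ t in (0 : ℝ)..1, t ^ (-(2 / c.β)) / (1 + g * t) := by
  have hβ0 : 0 < c.β := by linarith
  have hb1 : 2 / c.β < 1 := by rw [div_lt_one hβ0]; exact hβ
  have h1 : 0 < 1 - 2 / c.β := by linarith
  have h2 : Real.Gamma (2 - 2 / c.β) = (1 - 2 / c.β) * Real.Gamma (1 - 2 / c.β) := by
    rw [← Real.Gamma_add_one h1.ne']; congr 1; ring
  have h3 : 2 - 2 / c.β - (1 - 2 / c.β) = 1 := by ring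
  have hne : Real.Gamma (1 - 2 / c.β) ≠ 0 := (Real.Gamma_pos_of_pos h1).ne'
  have h4 : ∀ t : ℝ, t ^ (1 - 2 / c.β - 1) * (1 - t) ^ ((1 : ℝ) - 1) * (1 - -g * t) ^ (-1 : ℝ)
      = t ^ (-(2 / c.β)) / (1 + g * t) := fun t => by
    rw [sub_self, Real.rpow_zero, mul_one, Real.rpow_neg_one, ← div_eq_mul_inv]
    congr 2 <;> ring
  rw [Z, hyp2F1, h3, Real.Gamma_one, mul_one, h2, mul_div_cancel_right₀ _ hne]
  simp_rw [h4]
  have h5 : c.β - 2 ≠ 0 := by linarith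
  field_simp

lemma Z_nonneg (hβ : 2 < c.β) {g : ℝ} (hg : 0 ≤ g) : 0 ≤ c.Z g := by
  rw [Z_eq hβ]
  have hβ0 : 0 < c.β := by linarith
  refine mul_nonneg (by positivity) (intervalIntegral.integral_nonneg zero_le_one fun t ht => ?_)
  have := ht.1
  positivity

/-- The interference of a Poisson process with Rayleigh fading from beyond the distance `r`. -/
lemma lintegral_compl_ball_one_sub_inv_one_add (hβ : 2 < c.β) {g r : ℝ} (hg : 0 ≤ g)
    (hr : 0 < r) :
    ∫⁻ x in (Metric.ball (0 : Plane) r)ᶜ,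
        (1 - ENNReal.ofReal (1 / (1 + g * r ^ c.β * ‖x‖ ^ (-c.β))))
      = ENNReal.ofReal (Real.pi * r ^ 2 * c.Z g) := by
  have hβ0 : 0 < c.β := by linarith
  have hb1 : 2 / c.β < 1 := by rw [div_lt_one hβ0]; exact hβ
  set F : ℝ → ℝ := fun y => if r ≤ y then 1 - 1 / (1 + g * r ^ c.β * y ^ (-c.β)) else 0 with hF
  have hF0 : ∀ y, 0 ≤ F y := fun y => by
    simp only [hF]
    split_ifs with h
    · have : 0 ≤ g * r ^ c.β * y ^ (-c.β) := by have := hr.trans_le h; positivity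
      rw [sub_nonneg, div_le_one (by linarith)]; linarith
    · exact le_rfl
  -- In polar coordinates, the substitution `y = r t ^ (-1 / β)` maps `0 < t ≤ 1` onto `y ≥ r` and
  -- turns `g r ^ β y ^ (-β)` into `g t`, which gives the integral in `Z_eq`.
  set p : ℝ := -(1 / c.β) with hp
  have hpneg : p < 0 := by rw [hp, neg_lt_zero]; positivity
  set K : ℝ → ℝ := (Iic 1).indicator
    (fun t => r / c.β * g * (t ^ (-(2 / c.β)) / (1 + g * t))) with hK
  have hsub : ∀ t : ℝ, 0 < t → (|p| * t ^ (p - 1)) • ((r * t ^ p) * F (r * t ^ p)) = K t := by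
    intro t ht
    have hw : 0 < t ^ p := Real.rpow_pos_of_pos ht p
    have hiff : r ≤ r * t ^ p ↔ t ≤ 1 := by
      rw [le_mul_iff_one_le_right hr]
      constructor
      · intro h
        by_contra h'
        exact absurd (Real.rpow_lt_one_of_one_lt_of_neg (not_le.1 h') hpneg) (not_lt.2 h)
      · exact fun h => Real.one_le_rpow_of_pos_of_le_one_of_nonpos ht h hpneg.le
    by_cases h1 : t ≤ 1
    · rw [hK, Set.indicator_of_mem (show t ∈ Iic 1 from h1)]
      simp only [hF, if_pos (hiff.2 h1), smul_eq_mul]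
      have e1 : g * r ^ c.β * (r * t ^ p) ^ (-c.β) = g * t := by
        rw [Real.mul_rpow hr.le hw.le, ← Real.rpow_mul ht.le, hp,
          show -(1 / c.β) * -c.β = 1 by field_simp, Real.rpow_one, Real.rpow_neg hr.le]
        field_simp
      have e2 : t ^ (-(2 / c.β)) = t ^ (p - 1) * t ^ p * t := by
        rw [← Real.rpow_add ht, ← Real.rpow_add_one ht.ne']
        congr 1; rw [hp]; ring
      have e3 : |p| = 1 / c.β := by rw [hp, abs_neg, abs_of_pos (by positivity)]
      have e4 : 1 + g * t ≠ 0 := by positivity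
      rw [e1, e2, e3]
      field_simp
      ring
    · rw [hK, Set.indicator_of_notMem (show t ∉ Iic 1 from h1)]
      simp only [hF, if_neg (mt hiff.1 h1), mul_zero, smul_zero]
  have hKint : IntegrableOn K (Ioi 0) := by
    rw [hK, IntegrableOn, integrable_indicator_iff measurableSet_Iic, IntegrableOn,
      Measure.restrict_restrict measurableSet_Iic, inter_comm, Ioi_inter_Iic]
    exact ((intervalIntegrable_iff_integrableOn_Ioc_of_le zero_le_one).1
      (intervalIntegrable_rpow_neg_div hb1 hg)).const_mul _
  have hKval : ∫ t in Ioi 0, K t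
      = r / c.β * g * ∫ t in (0 : ℝ)..1, t ^ (-(2 / c.β)) / (1 + g * t) := by
    rw [hK, setIntegral_indicator measurableSet_Iic, Ioi_inter_Iic, integral_const_mul,
      intervalIntegral.integral_of_le zero_le_one]
  have hG1 : IntegrableOn (fun w => (r * w) * F (r * w)) (Ioi 0) := by
    rw [← integrableOn_Ioi_comp_rpow_iff _ hpneg.ne]
    exact hKint.congr_fun (fun t ht => (hsub t ht).symm) measurableSet_Ioi
  have hG : IntegrableOn (fun y => y * F y) (Ioi 0) := by
    have := integrableOn_Ioi_comp_mul_left_iff (fun y => y * F y) 0 hr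
    rw [mul_zero] at this
    exact this.1 hG1
  have hGval : ∫ y in Ioi 0, y * F y = r * ∫ t in Ioi 0, K t := by
    have h1 := integral_comp_mul_left_Ioi (fun y => y * F y) 0 hr
    rw [mul_zero, smul_eq_mul] at h1
    rw [← setIntegral_congr_fun measurableSet_Ioi (fun t ht => hsub t ht),
      integral_comp_rpow_Ioi (fun w => (r * w) * F (r * w)) hpneg.ne, h1]
    field_simp
  have hInt : Integrable (fun x : Plane => F ‖x‖) := by
    rw [integrable_fun_norm_addHaar]
    simpa using hG
  have hval : ∫ x : Plane, F ‖x‖ = Real.pi * r ^ 2 * c.Z g := by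
    rw [integral_fun_norm_addHaar, measureReal_def, volume_ball_plane zero_le_one,
      ENNReal.toReal_ofReal (by positivity)]
    simp only [finrank_euclideanSpace, Fintype.card_fin, one_pow, mul_one, smul_eq_mul,
      Nat.add_one_sub_one, pow_one, nsmul_eq_mul, Nat.cast_ofNat]
    rw [hGval, hKval, Z_eq hβ]
    ring
  rw [← hval, ofReal_integral_eq_lintegral_ofReal hInt (ae_of_all _ fun x => hF0 _),
    ← lintegral_indicator measurableSet_ball.compl]
  refine lintegral_congr fun x => ?_
  by_cases hx : r ≤ ‖x‖
  · have h0 : 0 ≤ g * r ^ c.β * ‖x‖ ^ (-c.β) := by positivity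
    rw [Set.indicator_of_mem (by simpa using hx)]
    simp only [hF, if_pos hx]
    rw [ENNReal.ofReal_sub _ (by positivity), ENNReal.ofReal_one]
  · rw [Set.indicator_of_notMem (by simpa using hx)]
    simp [hF, hx]

end Params

end

section

/-! ### Independence -/

/-- Two blocks are handled by `indep_iSup_of_disjoint`; a finite family follows by splitting off one
block from the union of the others. -/
lemma iIndep_iSup_of_pairwise_disjoint {Ω ι κ : Type*} {mΩ : MeasurableSpace Ω} {μ : Measure Ω}
    {m : ι → MeasurableSpace Ω} (hm : ∀ i, m i ≤ mΩ) (hind : iIndep m μ) {S : κ → Set ι}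
    (hS : Pairwise fun j k => Disjoint (S j) (S k)) :
    iIndep (fun k => ⨆ i ∈ S k, m i) μ := by
  classical
  have := hind.isProbabilityMeasure
  rw [iIndep_iff]
  intro s
  induction s using Finset.induction_on with
  | empty => intro f _; simp
  | insert a s ha ih =>
    intro f hf
    rw [Finset.set_biInter_insert, Finset.prod_insert ha,
      ← ih fun i hi => hf i (Finset.mem_insert_of_mem hi)]
    have hdis : Disjoint (S a) (⋃ k ∈ s, S k) := by
      simp only [Set.disjoint_iUnion_right]
      intro k hk
      exact hS fun h => ha (h ▸ hk)
    refine (Indep_iff _ _ μ).1 (indep_iSup_of_disjoint hm hind hdis) _ _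
      (hf a (Finset.mem_insert_self _ _)) ?_
    refine Finset.measurableSet_biInter s fun k hk => ?_
    have hle : ⨆ i ∈ S k, m i ≤ ⨆ i ∈ ⋃ k ∈ s, S k, m i :=
      biSup_mono fun i hi => Set.mem_biUnion hk hi
    exact hle _ (hf k (Finset.mem_insert_of_mem hk))

variable {Ω : Type*} [MeasurableSpace Ω] {μ : Measure Ω}

/-- Tonelli's theorem for independent random variables. -/
lemma lintegral_of_indepFun [IsProbabilityMeasure μ] {E F : Type*} [MeasurableSpace E]
    [MeasurableSpace F] {X : Ω → E} {Y : Ω → F} (h : IndepFun X Y μ) (hX : Measurable X)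
    (hY : Measurable Y) {Φ : E × F → ℝ≥0∞} (hΦ : Measurable Φ) :
    ∫⁻ ω, Φ (X ω, Y ω) ∂μ = ∫⁻ ω, ∫⁻ ω', Φ (X ω, Y ω') ∂μ ∂μ := by
  have := Measure.isProbabilityMeasure_map (μ := μ) hY.aemeasurable
  rw [← lintegral_map hΦ (hX.prodMk hY),
    (indepFun_iff_map_prod_eq_prod_map_map hX.aemeasurable hY.aemeasurable).1 h,
    lintegral_prod _ hΦ.aemeasurable, lintegral_map hΦ.lintegral_prod_right' hX]
  refine lintegral_congr fun ω => ?_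
  exact lintegral_map (hΦ.comp measurable_prodMk_left) hY

/-- The benefit of Rayleigh fading: given `T`, an exponential gain exceeds it with probability
`expNeg T`, so an outage question becomes a Laplace transform. -/
lemma measure_lt_ofReal_of_indepFun [IsProbabilityMeasure μ] {T : Ω → ℝ≥0∞} {h : Ω → ℝ}
    (hT : Measurable T) (hh : Measurable h) (hlaw : μ.map h = expMeasure 1)
    (hind : IndepFun T h μ) :
    μ {ω | T ω < ENNReal.ofReal (h ω)} = ∫⁻ ω, expNeg (T ω) ∂μ := by
  have hm : MeasurableSet {p : ℝ≥0∞ × ℝ | p.1 < ENNReal.ofReal p.2} :=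
    measurableSet_lt measurable_fst (by fun_prop)
  have h1 := lintegral_of_indepFun hind hT hh (Φ := {p : ℝ≥0∞ × ℝ |
    p.1 < ENNReal.ofReal p.2}.indicator fun _ => 1) (measurable_const.indicator hm)
  have h2 : MeasurableSet {ω | T ω < ENNReal.ofReal (h ω)} := (hT.prodMk hh) hm
  rw [← one_mul (μ _), ← lintegral_indicator_const h2]
  refine Eq.trans ?_ (h1.trans ?_)
  · rfl
  · refine lintegral_congr fun ω => ?_
    have h3 : MeasurableSet {x | T ω < ENNReal.ofReal x} :=
      measurableSet_lt measurable_const (by fun_prop)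
    rw [← expMeasure_lt_ofReal, ← hlaw, Measure.map_apply hh h3, ← one_mul (μ _),
      ← lintegral_indicator_const (hh h3)]
    rfl

lemma lintegral_expNeg_mul_of_map_eq {h : Ω → ℝ} (hh : Measurable h)
    (hlaw : μ.map h = expMeasure 1) {t : ℝ} (ht : 0 ≤ t) :
    ∫⁻ ω, expNeg (ENNReal.ofReal (t * h ω)) ∂μ = ENNReal.ofReal (1 / (1 + t)) := by
  have hm : Measurable fun h : ℝ => expNeg (ENNReal.ofReal (t * h)) :=
    measurable_expNeg.comp (by fun_prop)
  rw [← lintegral_expNeg_expMeasure ht, ← hlaw, lintegral_map hm hh]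

/-- The σ-algebra is a free variable, so that measurability can be tracked relative to `sigmaOn S`.
-/
lemma measurable_tsum_of_forall {Ω : Type*} {m : MeasurableSpace Ω} {Y : ℕ → Ω → ℝ≥0∞}
    (hY : ∀ n, Measurable[m] (Y n)) : Measurable[m] fun ω => ∑' n, Y n ω :=
  Measurable.tsum hY

lemma measurable_pi_of_forall {Ω E : Type*} {m : MeasurableSpace Ω} [MeasurableSpace E]
    {Y : ℕ → Ω → E} (hY : ∀ n, Measurable[m] (Y n)) : Measurable[m] fun ω n => Y n ω :=
  measurable_pi_lambda _ hY

/-- Finite products factor by independence, and dominated convergence with bound 1 passes to the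
infinite product. -/
lemma lintegral_expNeg_tsum_of_iIndepFun [IsProbabilityMeasure μ] {Y : ℕ → Ω → ℝ≥0∞}
    (hY : ∀ n, Measurable (Y n)) (hind : iIndepFun Y μ) :
    ∫⁻ ω, expNeg (∑' n, Y n ω) ∂μ = expNeg (∑' n, negLog (∫⁻ ω, expNeg (Y n ω) ∂μ)) := by
  have hle : ∀ n, ∫⁻ ω, expNeg (Y n ω) ∂μ ≤ 1 := fun n =>
    (lintegral_mono fun ω => expNeg_le_one _).trans (by simp)
  have hR := tendsto_prod_expNeg fun n => negLog (∫⁻ ω, expNeg (Y n ω) ∂μ)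
  simp_rw [expNeg_negLog (hle _)] at hR
  have hm : ∀ n, Measurable fun ω => expNeg (Y n ω) := fun n => measurable_expNeg.comp (hY n)
  have hL : Tendsto (fun N => ∫⁻ ω, ∏ n ∈ Finset.range N, expNeg (Y n ω) ∂μ) atTop
      (𝓝 (∫⁻ ω, expNeg (∑' n, Y n ω) ∂μ)) :=
    tendsto_lintegral_of_dominated_convergence (fun _ => 1)
      (fun N => Finset.measurable_prod _ fun n _ => hm n)
      (fun N => ae_of_all _ fun ω => Finset.prod_le_one' fun n _ => expNeg_le_one _) (by simp)
      (ae_of_all _ fun ω => tendsto_prod_expNeg _)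
  refine tendsto_nhds_unique hL (hR.congr fun N => ?_)
  exact (lintegral_prod_eq_prod_lintegral_of_indepFun _ _
    (hind.comp (fun _ => expNeg) fun _ => measurable_expNeg) hm).symm

/-! ### Measurability and independence relative to sets of sources -/

namespace Network

variable {Ω : Type*}

/-- The σ-algebra generated by a set of sources of randomness. -/
abbrev sigmaOn (W : Network Ω) (S : Set Source) : MeasurableSpace Ω := ⨆ i ∈ S, W.sigma i

section

variable (W : Network Ω) {S : Set Source}

lemma sigma_le_sigmaOn {i : Source} (hi : i ∈ S) : W.sigma i ≤ W.sigmaOn S :=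
  le_biSup W.sigma hi

lemma measurable_bs_sigmaOn (h : Source.bs ∈ S) (n : ℕ) : Measurable[W.sigmaOn S] (W.bs n) :=
  Measurable.of_comap_le <| (le_iSup (fun n => MeasurableSpace.comap (W.bs n) inferInstance) n).trans
    (W.sigma_le_sigmaOn h)

lemma measurable_state_sigmaOn {n : ℕ} (h : Source.state n ∈ S) :
    Measurable[W.sigmaOn S] (W.state n) :=
  Measurable.of_comap_le (W.sigma_le_sigmaOn h)

lemma measurable_gainU_sigmaOn {n : ℕ} (h : Source.gainU n ∈ S) :
    Measurable[W.sigmaOn S] (W.gainU n) :=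
  Measurable.of_comap_le (W.sigma_le_sigmaOn h)

lemma measurable_er_sigmaOn (h : Source.er ∈ S) (j : ℕ) : Measurable[W.sigmaOn S] (W.er j) :=
  Measurable.of_comap_le <| (le_iSup (fun n => MeasurableSpace.comap (W.er n) inferInstance) j).trans
    (W.sigma_le_sigmaOn h)

lemma measurable_gainE_sigmaOn {j : ℕ} (h : Source.gainE j ∈ S) :
    Measurable[W.sigmaOn S] (W.gainE j) :=
  Measurable.of_comap_le (W.sigma_le_sigmaOn h)

lemma measurable_field_sigmaOn {j : ℕ} (h : Source.field j ∈ S) (k : ℕ) :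
    Measurable[W.sigmaOn S] (W.field j k) :=
  Measurable.of_comap_le <|
    (le_iSup (fun n => MeasurableSpace.comap (W.field j n) inferInstance) k).trans
      (W.sigma_le_sigmaOn h)

lemma measurable_gainI_sigmaOn {j k : ℕ} (h : Source.gainI j k ∈ S) :
    Measurable[W.sigmaOn S] (W.gainI j k) :=
  Measurable.of_comap_le (W.sigma_le_sigmaOn h)

end

variable [mΩ : MeasurableSpace Ω] {μ : Measure Ω} {c : Params} {W : Network Ω}

lemma IsModel.sigma_le (h : W.IsModel μ c) (i : Source) : W.sigma i ≤ mΩ := by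
  cases i with
  | bs => exact iSup_le fun n => (h.bs_poisson.measurable n).comap_le
  | state n => exact (h.state_measurable n).comap_le
  | gainU n => exact (h.gainU_law n).1.comap_le
  | er => exact iSup_le fun n => (h.er_poisson.measurable n).comap_le
  | gainE n => exact (h.gainE_law n).1.comap_le
  | field j => exact iSup_le fun n => ((h.field_poisson j).measurable n).comap_le
  | gainI j k => exact (h.gainI_law j k).1.comap_le

lemma IsModel.indepFun_of_disjoint (h : W.IsModel μ c) {S T : Set Source} (hST : Disjoint S T)
    {E F : Type*} [MeasurableSpace E] [MeasurableSpace F] {f : Ω → E} {g : Ω → F}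
    (hf : Measurable[W.sigmaOn S] f) (hg : Measurable[W.sigmaOn T] g) : IndepFun f g μ :=
  (IndepFun_iff_Indep f g μ).2 <|
    indep_of_indep_of_le (indep_iSup_of_disjoint h.sigma_le h.indep hST) hf.comap_le hg.comap_le

lemma IsModel.iIndepFun_of_disjoint (h : W.IsModel μ c) {κ : Type*} {S : κ → Set Source}
    (hS : Pairwise fun j k => Disjoint (S j) (S k)) {E : κ → Type*}
    [∀ k, MeasurableSpace (E k)] {f : ∀ k, Ω → E k} (hf : ∀ k, Measurable[W.sigmaOn (S k)] (f k)) :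
    iIndepFun f μ :=
  (iIndepFun_iff_iIndep _ f μ).2 <|
    iIndep_of_iIndep_of_le (iIndep_iSup_of_pairwise_disjoint h.sigma_le h.indep hS)
      fun k => (hf k).comap_le

end Network

/-! ### Measurability of the signal-to-interference ratios -/

namespace Network

variable {Ω : Type*} [MeasurableSpace Ω] {c : Params} {W : Network Ω}

lemma measurable_serving (hb : ∀ n, Measurable (W.bs n)) : Measurable W.serving :=
  measurable_nearest.comp (measurable_path hb)

lemma measurable_bs_serving (hb : ∀ n, Measurable (W.bs n)) :
    Measurable fun ω => W.bs (W.serving ω) ω :=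
  measurable_apply_nearest.comp (measurable_path hb)

lemma measurable_interferenceU (hb : ∀ n, Measurable (W.bs n)) (hs : ∀ n, Measurable (W.state n))
    (hg : ∀ n, Measurable (W.gainU n)) (s : BSState) : Measurable (W.interferenceU c s) := by
  refine Measurable.tsum fun n => Measurable.ite ?_ ?_ measurable_const
  · have h1 : MeasurableSet {ω | W.serving ω = n} := measurable_serving hb (measurableSet_singleton n)
    have h2 : MeasurableSet {ω | W.state n ω = s} := hs n (measurableSet_singleton _)
    have : {ω | n ≠ W.serving ω ∧ W.state n ω = s}
        = {ω | W.serving ω = n}ᶜ ∩ {ω | W.state n ω = s} := by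
      ext ω; simp [eq_comm]
    rw [this]; exact h1.compl.inter h2
  · have := hb n
    have := hg n
    fun_prop

lemma measurable_sinrU (hb : ∀ n, Measurable (W.bs n)) (hs : ∀ n, Measurable (W.state n))
    (hg : ∀ n, Measurable (W.gainU n)) : Measurable (W.sinrU c) := by
  have h1 : Measurable fun ω => W.gainU (W.serving ω) ω :=
    (measurable_from_prod_countable_right (f := fun p : ℕ × Ω => W.gainU p.1 p.2) hg).comp
      ((measurable_serving hb).prodMk measurable_id)
  have h2 := measurable_bs_serving hb
  have h3 := measurable_interferenceU (c := c) hb hs hg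
  unfold sinrU
  refine Measurable.div (by fun_prop) ?_
  exact (((h3 _).const_mul _).add ((h3 _).const_mul _)).add measurable_const

lemma measurable_interferenceE {j : ℕ} (he : Measurable (W.er j))
    (hf : ∀ k, Measurable (W.field j k)) (hI : ∀ k, Measurable (W.gainI j k)) :
    Measurable (W.interferenceE c j) := by
  refine Measurable.tsum fun k => ?_
  have := hf k
  have := hI k
  fun_prop

lemma measurable_sinrE (hb : ∀ n, Measurable (W.bs n)) {j : ℕ} (he : Measurable (W.er j))
    (hg : Measurable (W.gainE j)) (hf : ∀ k, Measurable (W.field j k))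
    (hI : ∀ k, Measurable (W.gainI j k)) : Measurable (W.sinrE c j) := by
  have h1 := measurable_bs_serving hb
  have h2 := measurable_interferenceE (c := c) he hf hI
  unfold sinrE receivedE
  fun_prop

end Network

end

section

lemma negLog_antitone : Antitone negLog := fun _ _ h =>
  EReal.toENNReal_le_toENNReal (EReal.neg_le_neg_iff.2 (ENNReal.log_monotone h))

@[simp] lemma negLog_one : negLog 1 = 0 := by simp [negLog]

/-! ### The typical user -/

namespace Params

variable {c : Params}

/-- Strength of the interference of a base station at the user, relative to that of a base station
in secure transmission. -/
def weight (c : Params) : BSState → ℝ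
  | .secure => 1
  | .normalCached => 0
  | .normalUncached => 1 / c.θ

/-- `𝔼 exp (-τ · weight · gain)` for a base station with random state and Rayleigh fading. -/
def laplaceU (c : Params) (τ : ℝ) : ℝ :=
  c.stateProb .secure * (1 / (1 + τ)) + c.stateProb .normalCached
    + c.stateProb .normalUncached * (1 / (1 + τ / c.θ))

/-- Contribution of a base station at `y` to the exponent of the coverage probability of a user
whose serving base station is at distance `r`. -/
def exponentU (c : Params) (γ : ℝ) (y : Plane) (r : ℝ) : ℝ≥0∞ :=
  negLog (ENNReal.ofReal (c.laplaceU (γ * r ^ c.β * ‖y‖ ^ (-c.β))))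

lemma Valid.weight_nonneg (hc : c.Valid) (s : BSState) : 0 ≤ c.weight s := by
  have := hc.θ_pos
  cases s <;> simp [weight, this.le]

lemma Valid.δ_nonneg (hc : c.Valid) : 0 ≤ c.δ := Finset.sum_nonneg fun i _ => hc.p_nonneg i

lemma Valid.sum_requestShare_pos (hc : c.Valid) (hδ : c.δ < 1) :
    0 < c.requestShare .secure + c.requestShare .normalCached + c.requestShare .normalUncached := by
  have h1 := hc.α_nonneg
  have h2 := hc.α_le_one
  have h3 := hc.δ_nonneg
  simp only [requestShare]
  nlinarith [mul_le_mul_of_nonneg_right h2 h3]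

lemma Valid.stateProb_nonneg (hc : c.Valid) (hδ : c.δ < 1) (s : BSState) : 0 ≤ c.stateProb s := by
  have h1 := hc.α_nonneg
  have h2 : 0 ≤ 1 - c.α := sub_nonneg.2 hc.α_le_one
  have h3 := hc.δ_nonneg
  have h4 : 0 ≤ 1 - c.δ := by linarith
  refine div_nonneg ?_ (hc.sum_requestShare_pos hδ).le
  cases s <;> simp only [requestShare] <;> positivity

lemma Valid.sum_stateProb (hc : c.Valid) (hδ : c.δ < 1) :
    c.stateProb .secure + c.stateProb .normalCached + c.stateProb .normalUncached = 1 := by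
  rw [stateProb, stateProb, stateProb, ← add_div, ← add_div,
    div_self (hc.sum_requestShare_pos hδ).ne']

lemma Valid.one_sub_laplaceU (hc : c.Valid) (hδ : c.δ < 1) (τ : ℝ) :
    1 - c.laplaceU τ = c.stateProb .secure * (1 - 1 / (1 + τ))
      + c.stateProb .normalUncached * (1 - 1 / (1 + τ / c.θ)) := by
  rw [laplaceU]; linear_combination (-1 : ℝ) * hc.sum_stateProb hδ

lemma Valid.laplaceU_nonneg (hc : c.Valid) (hδ : c.δ < 1) {τ : ℝ} (hτ : 0 ≤ τ) :
    0 ≤ c.laplaceU τ := by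
  have := hc.θ_pos
  exact add_nonneg (add_nonneg (mul_nonneg (hc.stateProb_nonneg hδ _) (by positivity))
    (hc.stateProb_nonneg hδ _)) (mul_nonneg (hc.stateProb_nonneg hδ _) (by positivity))

lemma one_div_one_add_le_one {t : ℝ} (ht : 0 ≤ t) : 1 / (1 + t) ≤ 1 := by
  rw [div_le_one (by linarith)]; linarith

lemma Valid.laplaceU_le_one (hc : c.Valid) (hδ : c.δ < 1) {τ : ℝ} (hτ : 0 ≤ τ) :
    c.laplaceU τ ≤ 1 := by
  have h1 := hc.one_sub_laplaceU hδ τ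
  have h2 := mul_nonneg (hc.stateProb_nonneg hδ .secure)
    (sub_nonneg.2 (one_div_one_add_le_one hτ))
  have h3 := mul_nonneg (hc.stateProb_nonneg hδ .normalUncached)
    (sub_nonneg.2 (one_div_one_add_le_one (div_nonneg hτ hc.θ_pos.le)))
  linarith

lemma Valid.laplaceU_antitoneOn (hc : c.Valid) (hδ : c.δ < 1) :
    AntitoneOn c.laplaceU (Ici 0) := by
  intro a ha b hb hab
  have ha' : 0 ≤ a := ha
  have h1 := hc.stateProb_nonneg hδ
  have h2 := hc.θ_pos
  unfold laplaceU
  gcongr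
  · exact h1 _
  · exact h1 _

/-- A more distant serving station makes every interferer relatively stronger. This is the
monotonicity in `r` on which the shell comparison relies. -/
lemma Valid.monotoneOn_exponentU (hc : c.Valid) (hδ : c.δ < 1) {γ : ℝ} (hγ : 0 ≤ γ) (y : Plane) :
    MonotoneOn (c.exponentU γ y) (Ici 0) := by
  intro a ha b hb hab
  have ha' : 0 ≤ a := ha
  have hb' : 0 ≤ b := hb
  have hβ : 0 ≤ c.β := by linarith [hc.two_lt_β]
  refine negLog_antitone (ENNReal.ofReal_le_ofReal (hc.laplaceU_antitoneOn hδ ?_ ?_ ?_))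
  · exact mem_Ici.2 (by positivity)
  · exact mem_Ici.2 (by positivity)
  · have := Real.rpow_le_rpow ha' hab hβ
    gcongr

lemma measurable_exponentU (γ r : ℝ) : Measurable fun y => c.exponentU γ y r := by
  refine measurable_negLog.comp (Measurable.ennreal_ofReal ?_)
  unfold laplaceU
  fun_prop

/-- The exponent `Z(γ) λ_b₁ / λ_b + Z(γ/θ) λ_b₃ / λ_b`. -/
def totalZ (c : Params) (γ : ℝ) : ℝ :=
  c.Z γ * (c.lamB1 / c.lamB) + c.Z (γ / c.θ) * (c.lamB3 / c.lamB)

lemma Valid.totalZ_eq (hc : c.Valid) (γ : ℝ) :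
    c.totalZ γ = c.stateProb .secure * c.Z γ + c.stateProb .normalUncached * c.Z (γ / c.θ) := by
  have := hc.lamB_pos.ne'
  rw [totalZ, lamB1, lamB3]; field_simp

lemma Valid.totalZ_nonneg (hc : c.Valid) (hδ : c.δ < 1) {γ : ℝ} (hγ : 0 ≤ γ) :
    0 ≤ c.totalZ γ := by
  rw [hc.totalZ_eq]
  exact add_nonneg (mul_nonneg (hc.stateProb_nonneg hδ _) (Z_nonneg hc.two_lt_β hγ))
    (mul_nonneg (hc.stateProb_nonneg hδ _)
      (Z_nonneg hc.two_lt_β (div_nonneg hγ hc.θ_pos.le)))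

/-- `1 - laplaceU` is a mixture over the states. Pre-cached transmissions drop out; uncached ones,
sent with power `P` instead of `θ P`, act like secure ones at the threshold `γ / θ`. -/
lemma Valid.lintegral_exponentU (hc : c.Valid) (hδ : c.δ < 1) {γ r : ℝ} (hγ : 0 ≤ γ)
    (hr : 0 < r) :
    ∫⁻ x in (Metric.ball 0 r)ᶜ, (1 - expNeg (c.exponentU γ x r))
      = ENNReal.ofReal (Real.pi * r ^ 2 * c.totalZ γ) := by
  have hp := hc.stateProb_nonneg hδ
  have hθ := hc.θ_pos
  have h1 : ∀ x : Plane, 1 - expNeg (c.exponentU γ x r)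
      = ENNReal.ofReal (c.stateProb .secure)
          * (1 - ENNReal.ofReal (1 / (1 + γ * r ^ c.β * ‖x‖ ^ (-c.β))))
        + ENNReal.ofReal (c.stateProb .normalUncached)
          * (1 - ENNReal.ofReal (1 / (1 + γ / c.θ * r ^ c.β * ‖x‖ ^ (-c.β)))) := by
    intro x
    have hτ : 0 ≤ γ * r ^ c.β * ‖x‖ ^ (-c.β) := by positivity
    have hτ' : 0 ≤ γ / c.θ * r ^ c.β * ‖x‖ ^ (-c.β) := by positivity
    have h2 : ∀ t : ℝ, 0 ≤ t → 1 - ENNReal.ofReal (1 / (1 + t)) = ENNReal.ofReal (1 - 1 / (1 + t)) :=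
      fun t ht => by rw [ENNReal.ofReal_sub _ (by positivity), ENNReal.ofReal_one]
    have h3 : ∀ t : ℝ, 0 ≤ t → 0 ≤ 1 - 1 / (1 + t) := fun t ht =>
      sub_nonneg.2 (one_div_one_add_le_one ht)
    rw [exponentU, expNeg_negLog (ENNReal.ofReal_le_one.2 (hc.laplaceU_le_one hδ hτ)),
      ← ENNReal.ofReal_one, ← ENNReal.ofReal_sub _ (hc.laplaceU_nonneg hδ hτ),
      hc.one_sub_laplaceU hδ, ENNReal.ofReal_one, h2 _ hτ, h2 _ hτ', ← ENNReal.ofReal_mul (hp _),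
      ← ENNReal.ofReal_mul (hp _), ← ENNReal.ofReal_add (mul_nonneg (hp _) (h3 _ hτ))
      (mul_nonneg (hp _) (h3 _ hτ'))]
    congr 5
    ring
  have hZ1 := Z_nonneg hc.two_lt_β hγ
  have hZ2 := Z_nonneg hc.two_lt_β (div_nonneg hγ hθ.le)
  rw [lintegral_congr h1, lintegral_add_left (by fun_prop), lintegral_const_mul _ (by fun_prop),
    lintegral_const_mul _ (by fun_prop),
    lintegral_compl_ball_one_sub_inv_one_add hc.two_lt_β hγ hr,
    lintegral_compl_ball_one_sub_inv_one_add hc.two_lt_β (div_nonneg hγ hθ.le) hr,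
    ← ENNReal.ofReal_mul (hp _), ← ENNReal.ofReal_mul (hp _), ← ENNReal.ofReal_add, hc.totalZ_eq]
  · congr 1; ring
  · exact mul_nonneg (hp _) (by positivity)
  · exact mul_nonneg (hp _) (by positivity)

end Params

namespace Network

variable {Ω : Type*} {c : Params} {W : Network Ω}

/-- The network with the base stations placed at the points of a given configuration. -/
def withBs (W : Network Ω) (x : ℕ → Plane) : Network Ω := { W with bs := fun n _ => x n }

/-- Division by the mean received power `θ P R ^ (-β)` isolates the serving gain on one side, as
`measure_lt_ofReal_of_indepFun` requires; `weight` merges the two interference sums into one. -/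
lemma lt_sinrU_withBs_iff (hc : c.Valid) (hσ : c.σ2 = 0) {γ : ℝ} (hγ : 0 < γ) {x : ℕ → Plane}
    (hx : x (nearest x) ≠ 0) (ω : Ω) :
    ENNReal.ofReal γ < (W.withBs x).sinrU c ω ↔
      ∑' n, (if n = nearest x then 0 else ENNReal.ofReal (γ * ‖x (nearest x)‖ ^ c.β
        * ‖x n‖ ^ (-c.β) * c.weight (W.state n ω) * W.gainU n ω))
        < ENNReal.ofReal (W.gainU (nearest x) ω) := by
  have hθ := hc.θ_pos
  have hP := hc.P_pos
  have hR : 0 < ‖x (nearest x)‖ := norm_pos_iff.2 hx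
  set R := ‖x (nearest x)‖ with hRdef
  have hA : 0 < c.θ * c.P * R ^ (-c.β) := by positivity
  have hserv : (W.withBs x).serving ω = nearest x := rfl
  have hγ0 : ENNReal.ofReal γ ≠ 0 := by simpa using hγ
  have hsum : ENNReal.ofReal γ * (ENNReal.ofReal (c.θ * c.P) * (W.withBs x).interferenceU c .secure ω
        + ENNReal.ofReal c.P * (W.withBs x).interferenceU c .normalUncached ω)
      = ENNReal.ofReal (c.θ * c.P * R ^ (-c.β)) *
        ∑' n, (if n = nearest x then 0 else ENNReal.ofReal (γ * R ^ c.β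
        * ‖x n‖ ^ (-c.β) * c.weight (W.state n ω) * W.gainU n ω)) := by
    rw [interferenceU, interferenceU, ← ENNReal.tsum_mul_left, ← ENNReal.tsum_mul_left,
      ← ENNReal.tsum_add, ← ENNReal.tsum_mul_left, ← ENNReal.tsum_mul_left]
    refine tsum_congr fun n => ?_
    have hst : (W.withBs x).state n ω = W.state n ω := rfl
    have hbs : (W.withBs x).bs n ω = x n := rfl
    have hgn : (W.withBs x).gainU n ω = W.gainU n ω := rfl
    rw [hserv, hst, hbs, hgn]
    by_cases hn : n = nearest x
    · simp [hn]
    · have hRR : R ^ (-c.β) * R ^ c.β = 1 := by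
        rw [← Real.rpow_add hR]; simp
      rw [if_neg hn]
      cases hs : W.state n ω with
      | secure =>
        simp only [ne_eq, hn, not_false_eq_true, true_and, if_true, reduceCtorEq, if_false,
          mul_zero, add_zero, Params.weight]
        rw [← ENNReal.ofReal_mul (by positivity), ← ENNReal.ofReal_mul hγ.le,
          ← ENNReal.ofReal_mul hA.le]
        congr 1
        linear_combination (-(c.θ * c.P * γ * ‖x n‖ ^ (-c.β) * W.gainU n ω)) * hRR
      | normalCached => simp [Params.weight]
      | normalUncached =>
        simp only [ne_eq, hn, not_false_eq_true, true_and, if_true, reduceCtorEq, if_false,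
          mul_zero, zero_add, Params.weight]
        rw [← ENNReal.ofReal_mul (by positivity), ← ENNReal.ofReal_mul hγ.le,
          ← ENNReal.ofReal_mul hA.le]
        congr 1
        have : c.θ * (1 / c.θ) = 1 := by field_simp
        linear_combination (-(c.P * γ * ‖x n‖ ^ (-c.β) * W.gainU n ω)) * hRR
          - (c.P * γ * ‖x n‖ ^ (-c.β) * W.gainU n ω * R ^ (-c.β) * R ^ c.β) * this
  rw [sinrU, hσ, ENNReal.ofReal_zero, add_zero, ENNReal.lt_div_iff_mul_lt
    (Or.inr ENNReal.ofReal_ne_top) (Or.inr hγ0), hsum, hserv]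
  have h2 : ENNReal.ofReal (c.θ * c.P * ‖(W.withBs x).bs (nearest x) ω‖ ^ (-c.β)
      * (W.withBs x).gainU (nearest x) ω)
      = ENNReal.ofReal (c.θ * c.P * R ^ (-c.β)) * ENNReal.ofReal (W.gainU (nearest x) ω) := by
    rw [← ENNReal.ofReal_mul hA.le]; rfl
  rw [h2, ENNReal.mul_lt_mul_iff_right (by simpa using hA) ENNReal.ofReal_ne_top]

variable [MeasurableSpace Ω] {μ : Measure Ω} [IsProbabilityMeasure μ]

lemma IsModel.lintegral_expNeg_weight_gainU (h : W.IsModel μ c) (hc : c.Valid) (hδ : c.δ < 1)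
    {τ : ℝ} (hτ : 0 ≤ τ) (n : ℕ) :
    ∫⁻ ω, expNeg (ENNReal.ofReal (τ * c.weight (W.state n ω) * W.gainU n ω)) ∂μ
      = ENNReal.ofReal (c.laplaceU τ) := by
  have hθ := hc.θ_pos
  have hp := hc.stateProb_nonneg hδ
  have hw : Measurable c.weight := measurable_from_top
  have hind : IndepFun (W.state n) (W.gainU n) μ :=
    h.indepFun_of_disjoint (S := {.state n}) (T := {.gainU n}) (by simp)
      (W.measurable_state_sigmaOn rfl) (W.measurable_gainU_sigmaOn rfl)
  have hΦ : Measurable fun p : BSState × ℝ =>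
      expNeg (ENNReal.ofReal (τ * c.weight p.1 * p.2)) :=
    measurable_expNeg.comp (by fun_prop)
  rw [lintegral_of_indepFun hind (h.state_measurable n) (h.gainU_law n).1 hΦ]
  have h1 : ∀ ω, ∫⁻ ω', expNeg (ENNReal.ofReal (τ * c.weight (W.state n ω) * W.gainU n ω')) ∂μ
      = ENNReal.ofReal (1 / (1 + τ * c.weight (W.state n ω))) := fun ω =>
    lintegral_expNeg_mul_of_map_eq (h.gainU_law n).1 (h.gainU_law n).2
      (mul_nonneg hτ (hc.weight_nonneg _))
  have hm : ∀ s, MeasurableSet {ω | W.state n ω = s} := fun s =>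
    h.state_measurable n (measurableSet_singleton s)
  have h2 : ∀ ω, ENNReal.ofReal (1 / (1 + τ * c.weight (W.state n ω)))
      = {ω | W.state n ω = .secure}.indicator (fun _ => ENNReal.ofReal (1 / (1 + τ))) ω
        + {ω | W.state n ω = .normalCached}.indicator (fun _ => 1) ω
        + {ω | W.state n ω = .normalUncached}.indicator
            (fun _ => ENNReal.ofReal (1 / (1 + τ / c.θ))) ω := fun ω => by
    cases hs : W.state n ω <;> simp [Set.indicator, hs, Params.weight, div_eq_mul_inv]
  simp only [h1]
  have hτ' : 0 ≤ τ / c.θ := by positivity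
  rw [lintegral_congr h2, lintegral_add_right _ (measurable_const.indicator (hm _)),
    lintegral_add_right _ (measurable_const.indicator (hm _)), lintegral_indicator_const (hm _),
    lintegral_indicator_const (hm _), lintegral_indicator_const (hm _), h.state_law, h.state_law,
    h.state_law, one_mul, ← ENNReal.ofReal_mul (by positivity), ← ENNReal.ofReal_mul (by positivity),
    ← ENNReal.ofReal_add (mul_nonneg (by positivity) (hp _)) (hp _),
    ← ENNReal.ofReal_add (add_nonneg (mul_nonneg (by positivity) (hp _)) (hp _))
      (mul_nonneg (by positivity) (hp _)), Params.laplaceU]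
  congr 1; ring

/-- The coverage probability of the user given the locations of the base stations. -/
lemma IsModel.measure_lt_sinrU_withBs (h : W.IsModel μ c) (hc : c.Valid) (hδ : c.δ < 1)
    (hσ : c.σ2 = 0) {γ : ℝ} (hγ : 0 < γ) {x : ℕ → Plane} (hx : x (nearest x) ≠ 0) :
    μ {ω | ENNReal.ofReal γ < (W.withBs x).sinrU c ω}
      = expNeg (sumBeyond (c.exponentU γ) x) := by
  simp only [lt_sinrU_withBs_iff hc hσ hγ hx]
  have hw : Measurable c.weight := measurable_from_top
  have hR : 0 ≤ ‖x (nearest x)‖ := norm_nonneg _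
  set Y : ℕ → Ω → ℝ≥0∞ := fun n ω => if n = nearest x then 0 else
    ENNReal.ofReal (γ * ‖x (nearest x)‖ ^ c.β * ‖x n‖ ^ (-c.β) * c.weight (W.state n ω)
      * W.gainU n ω) with hY
  -- The term of the serving station is constant, so the whole sum can be measured without the
  -- serving gain.
  have hYm : ∀ (S : Set Source) n, (n ≠ nearest x → Source.state n ∈ S ∧ Source.gainU n ∈ S) →
      Measurable[W.sigmaOn S] (Y n) := by
    intro S n hS
    simp only [hY]
    by_cases hn : n = nearest x
    · simp only [if_pos hn]; exact measurable_const
    · simp only [if_neg hn]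
      have h1 := W.measurable_state_sigmaOn (hS hn).1
      have h2 := W.measurable_gainU_sigmaOn (hS hn).2
      exact ((((hw.comp h1).const_mul _).mul h2)).ennreal_ofReal
  have hYm' : ∀ n, Measurable (Y n) := fun n =>
    (hYm univ n fun _ => ⟨trivial, trivial⟩).mono (iSup₂_le fun i _ => h.sigma_le i) le_rfl
  have hind : IndepFun (fun ω => ∑' n, Y n ω) (W.gainU (nearest x)) μ := by
    refine h.indepFun_of_disjoint (S := {i | i ≠ .gainU (nearest x)}) (T := {.gainU (nearest x)}) (by simp)
      (measurable_tsum_of_forall fun n => hYm _ n fun hn => ⟨?_, ?_⟩) (W.measurable_gainU_sigmaOn rfl)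
    · simp
    · simpa using hn
  have hiind : ProbabilityTheory.iIndepFun Y μ := by
    refine h.iIndepFun_of_disjoint (S := fun n => {.state n, .gainU n}) (fun i j hij => ?_)
      fun n => hYm _ n fun _ => ⟨by simp, by simp⟩
    refine Set.disjoint_left.2 ?_
    rintro a (rfl | rfl) <;> simpa using hij
  rw [measure_lt_ofReal_of_indepFun (Measurable.tsum hYm') (h.gainU_law _).1 (h.gainU_law _).2 hind,
    lintegral_expNeg_tsum_of_iIndepFun hYm' hiind, sumBeyond]
  congr 1
  refine tsum_congr fun n => ?_
  by_cases hn : n = nearest x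
  · simp [hY, hn]
  · simp only [hY, if_neg hn]
    rw [h.lintegral_expNeg_weight_gainU hc hδ (by positivity) n]
    rfl

end Network

end

section

/-! ### The eavesdroppers -/

namespace Params

variable {c : Params}

/-- SINR of an eavesdropper at distance `d` from the serving base station, with power gain `h`
and interference `I`. -/
def sinrAt (c : Params) (h d : ℝ) (I : ℝ≥0∞) : ℝ≥0∞ :=
  ENNReal.ofReal (c.θ * c.P * (h * d ^ (-c.β))) /
    (ENNReal.ofReal c.P * I + ENNReal.ofReal ((1 - c.θ) * c.P * (h * d ^ (-c.β)))
      + ENNReal.ofReal c.σ2)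

/-- Interference at the point `e` of the base stations `x` with power gains `g`. -/
def interferenceAt (c : Params) (e : Plane) (x : ℕ → Plane) (g : ℕ → ℝ) : ℝ≥0∞ :=
  ∑' k, ENNReal.ofReal (dist e (x k) ^ (-c.β) * g k)

lemma measurable_interferenceAt {Ω : Type*} {m : MeasurableSpace Ω} {e : Ω → Plane}
    {x : ℕ → Ω → Plane} {g : ℕ → Ω → ℝ} (he : Measurable e) (hx : ∀ k, Measurable (x k))
    (hg : ∀ k, Measurable (g k)) :
    Measurable fun ω => c.interferenceAt (e ω) (fun k => x k ω) (fun k => g k ω) :=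
  Measurable.tsum fun k => (((he.dist (hx k)).pow_const _).mul (hg k)).ennreal_ofReal

lemma measurable_sinrAt {Ω : Type*} {m : MeasurableSpace Ω} {h d : Ω → ℝ} {I : Ω → ℝ≥0∞}
    (hh : Measurable h) (hd : Measurable d) (hI : Measurable I) :
    Measurable fun ω => c.sinrAt (h ω) (d ω) (I ω) := by
  unfold sinrAt
  fun_prop

/-- The ratio `γ / (θ - (1 - θ) γ)`. -/
def ratio (c : Params) (γ : ℝ) : ℝ := γ / (c.θ - (1 - c.θ) * γ)

/-- The self-interference `(1 - θ) γ` moves to the signal side, leaving the coefficient `θ - (1 - θ)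
γ`; it may be divided out while it is positive, that is below `θ / (1 - θ)`. -/
lemma Valid.lt_sinrAt_iff (hc : c.Valid) (hσ : c.σ2 = 0) {γ : ℝ} (hγ : 0 < γ)
    (hγθ : 0 < c.θ - (1 - c.θ) * γ) {d : ℝ} (hd : 0 < d) (h : ℝ) (I : ℝ≥0∞) :
    ENNReal.ofReal γ < c.sinrAt h d I ↔
      ENNReal.ofReal (c.ratio γ * d ^ c.β) * I < ENNReal.ofReal h := by
  have hP := hc.P_pos
  have hθ := hc.θ_pos
  have hθ1 : 0 ≤ 1 - c.θ := sub_nonneg.2 hc.θ_le_one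
  have hs : 0 < c.ratio γ * d ^ c.β := by unfold ratio; positivity
  have hγ0 : ENNReal.ofReal γ ≠ 0 := by simpa using hγ
  rw [sinrAt, hσ, ENNReal.ofReal_zero, add_zero,
    ENNReal.lt_div_iff_mul_lt (Or.inr ENNReal.ofReal_ne_top) (Or.inr hγ0)]
  rcases eq_or_ne I ∞ with rfl | hI
  · have h1 : ENNReal.ofReal c.P ≠ 0 := by simpa using hP
    have h2 : ENNReal.ofReal (c.ratio γ * d ^ c.β) ≠ 0 := by simpa using hs
    simp only [ENNReal.mul_top h1, ENNReal.mul_top h2, top_add, ENNReal.mul_top hγ0, not_top_lt]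
  rcases le_or_gt h 0 with hh | hh
  · have h1 : c.θ * c.P * (h * d ^ (-c.β)) ≤ 0 :=
      mul_nonpos_of_nonneg_of_nonpos (by positivity)
        (mul_nonpos_of_nonpos_of_nonneg hh (by positivity))
    rw [ENNReal.ofReal_of_nonpos h1, ENNReal.ofReal_of_nonpos hh]
    simp
  lift I to ℝ≥0 using hI
  have hI0 : (0 : ℝ) ≤ I := I.coe_nonneg
  rw [← ENNReal.ofReal_coe_nnreal, ← ENNReal.ofReal_mul hP.le,
    ← ENNReal.ofReal_add (by positivity) (by positivity), ← ENNReal.ofReal_mul hγ.le,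
    ← ENNReal.ofReal_mul hs.le, ENNReal.ofReal_lt_ofReal_iff (by positivity),
    ENNReal.ofReal_lt_ofReal_iff hh, ratio, Real.rpow_neg hd.le]
  have hdβ : 0 < d ^ c.β := by positivity
  have h1 : γ / (c.θ - (1 - c.θ) * γ) * d ^ c.β * I < h
      ↔ γ * I < (c.θ - (1 - c.θ) * γ) * (h * (d ^ c.β)⁻¹) := by
    rw [← div_eq_mul_inv, ← mul_div_assoc, lt_div_iff₀ hdβ, div_mul_eq_mul_div,
      div_mul_eq_mul_div, div_lt_iff₀ hγθ, mul_comm h, mul_right_comm]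
  rw [h1]
  constructor
  · intro h2
    refine lt_of_mul_lt_mul_left ?_ hP.le
    linarith
  · intro h2
    have := mul_lt_mul_of_pos_left h2 hP
    linarith

/-- With the convention `0 ^ (-β) = 0` the signal vanishes at distance 0; this concerns only a null
set of positions. -/
lemma Valid.not_lt_sinrAt_zero (hc : c.Valid) (γ h : ℝ) (I : ℝ≥0∞) :
    ¬ ENNReal.ofReal γ < c.sinrAt h 0 I := by
  have hβ : -c.β ≠ 0 := by linarith [hc.two_lt_β]
  simp [sinrAt, Real.zero_rpow hβ]

/-- The pre-cached component of the same signal already suffices as interference, whatever the gain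
and `I`. -/
lemma Valid.sinrAt_le (hc : c.Valid) {γ : ℝ} (hγ : 0 ≤ γ)
    (hγθ : c.θ - (1 - c.θ) * γ ≤ 0) {d : ℝ} (hd : 0 ≤ d) (h : ℝ) (I : ℝ≥0∞) :
    c.sinrAt h d I ≤ ENNReal.ofReal γ := by
  have hP := hc.P_pos
  have hθ := hc.θ_pos
  refine ENNReal.div_le_of_le_mul ?_
  rcases le_or_gt h 0 with hh | hh
  · have h1 : c.θ * c.P * (h * d ^ (-c.β)) ≤ 0 :=
      mul_nonpos_of_nonneg_of_nonpos (by positivity)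
        (mul_nonpos_of_nonpos_of_nonneg hh (by positivity))
    rw [ENNReal.ofReal_of_nonpos h1]; exact zero_le
  calc ENNReal.ofReal (c.θ * c.P * (h * d ^ (-c.β)))
      ≤ ENNReal.ofReal (γ * ((1 - c.θ) * c.P * (h * d ^ (-c.β)))) := by
        refine ENNReal.ofReal_le_ofReal ?_
        have : 0 ≤ c.P * (h * d ^ (-c.β)) := by positivity
        nlinarith [mul_nonneg (sub_nonneg.2 hγθ) this]
    _ = ENNReal.ofReal γ * ENNReal.ofReal ((1 - c.θ) * c.P * (h * d ^ (-c.β))) :=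
        ENNReal.ofReal_mul hγ
    _ ≤ _ := by
        gcongr
        exact le_add_right (le_add_left le_rfl)

/-- The constant `Γ(1 + 2/β) Γ(1 - 2/β)`. -/
def gammaFactor (c : Params) : ℝ := Real.Gamma (1 + 2 / c.β) * Real.Gamma (1 - 2 / c.β)

lemma Valid.gammaFactor_pos (hc : c.Valid) : 0 < c.gammaFactor := by
  have hβ := hc.two_lt_β
  have hβ0 : 0 < c.β := by linarith
  have hb1 : 2 / c.β < 1 := by rw [div_lt_one hβ0]; exact hβ
  have hb0 : 0 < 2 / c.β := by positivity
  exact mul_pos (Real.Gamma_pos_of_pos (by linarith)) (Real.Gamma_pos_of_pos (by linarith))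

/-- An eavesdropper at distance `d` has SINR above `γ` with probability `exp (-rateE γ * d ^ 2)`. -/
def rateE (c : Params) (γ : ℝ) : ℝ :=
  c.lamB * Real.pi * c.ratio γ ^ (2 / c.β) * c.gammaFactor

/-- The probability that all eavesdroppers have SINR at most `γ`, for small `γ`. -/
def probE (c : Params) (γ : ℝ) : ℝ :=
  Real.exp (-((c.lamE / c.lamB) / (c.gammaFactor * c.ratio γ ^ (2 / c.β))))

end Params

namespace Network

variable {Ω : Type*} [mΩ : MeasurableSpace Ω] {μ : Measure Ω} [IsProbabilityMeasure μ]
  {c : Params} {W : Network Ω}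

/-- The Laplace transform of the interference at an eavesdropper. -/
lemma IsModel.lintegral_expNeg_interferenceAt (h : W.IsModel μ c) (hc : c.Valid) {s : ℝ}
    (hs : 0 < s) (e : Plane) (j : ℕ) :
    ∫⁻ ω, expNeg (ENNReal.ofReal s
        * c.interferenceAt e (fun k => W.field j k ω) (fun k => W.gainI j k ω)) ∂μ
      = ENNReal.ofReal (Real.exp (-(c.lamB * (Real.pi * s ^ (2 / c.β) * c.gammaFactor)))) := by
  have hG := hc.gammaFactor_pos
  have hlam := hc.lamB_pos
  have hfm := (h.field_poisson j).measurable
  have hgm : ∀ k, Measurable (W.gainI j k) := fun k => (h.gainI_law j k).1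
  have hΦ : Measurable fun p : (ℕ → Plane) × (ℕ → ℝ) =>
      expNeg (ENNReal.ofReal s * c.interferenceAt e p.1 p.2) := by
    refine measurable_expNeg.comp (Measurable.const_mul (Measurable.tsum fun k => ?_) _)
    fun_prop
  have hind : IndepFun (fun ω k => W.field j k ω) (fun ω k => W.gainI j k ω) μ := by
    have h1 : ∀ k, Measurable[W.sigmaOn {.field j}] (W.field j k) :=
      W.measurable_field_sigmaOn (mem_singleton _)
    have h2 : ∀ k, Measurable[W.sigmaOn (range (Source.gainI j))] (W.gainI j k) :=
      fun k => W.measurable_gainI_sigmaOn (mem_range_self k)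
    exact h.indepFun_of_disjoint (by simp) (measurable_pi_of_forall h1)
      (measurable_pi_of_forall h2)
  rw [lintegral_of_indepFun hind (measurable_path hfm) (measurable_pi_lambda _ hgm) hΦ]
  have h1 : ∀ x : ℕ → Plane,
      ∫⁻ ω, expNeg (ENNReal.ofReal s * c.interferenceAt e x fun k => W.gainI j k ω) ∂μ
        = expNeg (∑' k, negLog (ENNReal.ofReal (1 / (1 + s * dist e (x k) ^ (-c.β))))) := by
    intro x
    set Y : ℕ → Ω → ℝ≥0∞ := fun k ω =>
      ENNReal.ofReal (s * dist e (x k) ^ (-c.β) * W.gainI j k ω) with hY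
    have hYm : ∀ k (S : Set Source), Source.gainI j k ∈ S → Measurable[W.sigmaOn S] (Y k) :=
      fun k S hS => ((W.measurable_gainI_sigmaOn hS).const_mul _).ennreal_ofReal
    have hYm' : ∀ k, Measurable (Y k) := fun k => ((hgm k).const_mul _).ennreal_ofReal
    have hiind : ProbabilityTheory.iIndepFun Y μ :=
      h.iIndepFun_of_disjoint (S := fun k => {.gainI j k})
        (fun i k hik => by simpa using hik) fun k => hYm k _ rfl
    have h2 := lintegral_expNeg_tsum_of_iIndepFun hYm' hiind
    have h3 : ∀ k, ∫⁻ ω, expNeg (Y k ω) ∂μ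
        = ENNReal.ofReal (1 / (1 + s * dist e (x k) ^ (-c.β))) := fun k =>
      lintegral_expNeg_mul_of_map_eq (hgm k) (h.gainI_law j k).2 (by positivity)
    simp only [h3] at h2
    rw [← h2]
    refine lintegral_congr fun ω => ?_
    rw [Params.interferenceAt, ← ENNReal.tsum_mul_left]
    congr 1
    refine tsum_congr fun k => ?_
    rw [← ENNReal.ofReal_mul hs.le, ← mul_assoc]
  simp only [h1]
  have hm : Measurable fun z : Plane =>
      negLog (ENNReal.ofReal (1 / (1 + s * dist e z ^ (-c.β)))) :=
    measurable_negLog.comp (by fun_prop)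
  rw [(h.field_poisson j).lintegral_expNeg_tsum hlam.le hm]
  -- Translation invariance of the area moves `e` to the origin.
  have h4 : ∫⁻ z : Plane, (1 - expNeg (negLog (ENNReal.ofReal (1 / (1 + s * dist e z ^ (-c.β))))))
      = ENNReal.ofReal (Real.pi * s ^ (2 / c.β) * c.gammaFactor) := by
    rw [Params.gammaFactor, ← lintegral_one_sub_inv_one_add hc.two_lt_β hs,
      ← lintegral_sub_right_eq_self
        (fun x : Plane => 1 - ENNReal.ofReal (1 / (1 + s * ‖x‖ ^ (-c.β)))) e]
    refine lintegral_congr fun z => ?_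
    rw [expNeg_negLog (ENNReal.ofReal_le_one.2 (Params.one_div_one_add_le_one (by positivity))),
      dist_comm, dist_eq_norm]
  rw [h4, ← ENNReal.ofReal_mul hlam.le, expNeg_ofReal (by positivity)]

/-- The probability that an eavesdropper at `e` has SINR above `γ`. -/
lemma IsModel.measure_lt_sinrAt (h : W.IsModel μ c) (hc : c.Valid) (hσ : c.σ2 = 0) {γ : ℝ}
    (hγ : 0 < γ) (hγθ : 0 < c.θ - (1 - c.θ) * γ) {d : ℝ} (hd : 0 < d) (e : Plane) (j : ℕ) :
    μ {ω | ENNReal.ofReal γ < c.sinrAt (W.gainE j ω) d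
        (c.interferenceAt e (fun k => W.field j k ω) (fun k => W.gainI j k ω))}
      = ENNReal.ofReal (Real.exp (-(c.rateE γ) * d ^ 2)) := by
  have hr : 0 < c.ratio γ := div_pos hγ hγθ
  have hβ0 : 0 < c.β := by linarith [hc.two_lt_β]
  simp only [hc.lt_sinrAt_iff hσ hγ hγθ hd]
  have hTm : ∀ S : Set Source, Source.field j ∈ S → (∀ k, Source.gainI j k ∈ S) →
      Measurable[W.sigmaOn S] fun ω => ENNReal.ofReal (c.ratio γ * d ^ c.β)
        * c.interferenceAt e (fun k => W.field j k ω) (fun k => W.gainI j k ω) := by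
    intro S h1 h2
    have h5 : Measurable[W.sigmaOn S] fun ω =>
        c.interferenceAt e (fun k => W.field j k ω) (fun k => W.gainI j k ω) :=
      Params.measurable_interferenceAt measurable_const (W.measurable_field_sigmaOn h1)
        fun k => W.measurable_gainI_sigmaOn (h2 k)
    exact h5.const_mul _
  have hind : IndepFun (fun ω => ENNReal.ofReal (c.ratio γ * d ^ c.β)
      * c.interferenceAt e (fun k => W.field j k ω) (fun k => W.gainI j k ω)) (W.gainE j) μ :=
    h.indepFun_of_disjoint (S := {i | i ≠ .gainE j}) (T := {.gainE j}) (by simp)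
      (hTm _ (by simp) (by simp)) (W.measurable_gainE_sigmaOn rfl)
  rw [measure_lt_ofReal_of_indepFun ((hTm univ trivial fun _ => trivial).mono
      (iSup₂_le fun i _ => h.sigma_le i) le_rfl) (h.gainE_law j).1 (h.gainE_law j).2 hind,
    h.lintegral_expNeg_interferenceAt hc (by positivity) e j, Params.rateE,
    Real.mul_rpow hr.le (by positivity), ← Real.rpow_mul hd.le,
    show c.β * (2 / c.β) = ((2 : ℕ) : ℝ) by push_cast; field_simp, Real.rpow_natCast]
  congr 2; ring

end Network

end

/-! ### The strongest eavesdropper -/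

section

/-- Writes "none of the events occurs" as the exponential of a series, so that a supremum over
eavesdroppers is accessible to the Laplace functional. `Unit` merely supplies a space for the
indicator. -/
lemma expNeg_tsum_ite_top (p : ℕ → Prop) [DecidablePred p] :
    expNeg (∑' n, if p n then ∞ else 0) = {_u : Unit | ∀ n, ¬ p n}.indicator 1 () := by
  by_cases h : ∀ n, ¬ p n
  · rw [Set.indicator_of_mem (show () ∈ {_u : Unit | ∀ n, ¬ p n} from h)]
    simp [h]
  · rw [Set.indicator_of_notMem (show () ∉ {_u : Unit | ∀ n, ¬ p n} from h)]
    push Not at h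
    obtain ⟨n, hn⟩ := h
    have : ∑' n, (if p n then ∞ else 0 : ℝ≥0∞) = ∞ :=
      top_le_iff.1 (le_trans (by simp [hn]) (ENNReal.le_tsum n))
    rw [this, expNeg_top]

lemma measurable_ite_lt_top {Ω : Type*} {m : MeasurableSpace Ω} {f : Ω → ℝ≥0∞}
    (hf : Measurable f) (a : ℝ≥0∞) : Measurable fun ω => if a < f ω then (∞ : ℝ≥0∞) else 0 :=
  Measurable.ite (measurableSet_lt measurable_const hf) measurable_const measurable_const

/-- The integral of a Gaussian over the plane. -/
lemma lintegral_exp_neg_mul_dist_sq {κ : ℝ} (hκ : 0 < κ) (y : Plane) :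
    ∫⁻ e : Plane, ENNReal.ofReal (Real.exp (-κ * dist e y ^ 2)) = ENNReal.ofReal (Real.pi / κ) := by
  have hval := GaussianFourier.integral_rexp_neg_mul_sq_norm (V := Plane) hκ
  simp only [finrank_euclideanSpace, Fintype.card_fin, Nat.cast_ofNat, ne_eq, OfNat.ofNat_ne_zero,
    not_false_eq_true, div_self, Real.rpow_one] at hval
  have hInt : Integrable fun v : Plane => Real.exp (-κ * ‖v‖ ^ 2) := by
    -- Without integrability the Bochner integral would be 0, whereas its value is positive.
    by_contra hcon
    rw [integral_undef hcon] at hval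
    have : 0 < Real.pi / κ := by positivity
    linarith
  rw [← hval, ofReal_integral_eq_lintegral_ofReal hInt (ae_of_all _ fun v => (Real.exp_pos _).le),
    ← lintegral_sub_right_eq_self (fun v : Plane => ENNReal.ofReal (Real.exp (-κ * ‖v‖ ^ 2))) y]
  simp_rw [dist_eq_norm]

namespace Network

variable {Ω : Type*} {c : Params} {W : Network Ω}

/-- SINR of eavesdropper `j`, if it is at `e` and the serving base station is at `y`. -/
def sinrEFrom (W : Network Ω) (c : Params) (y e : Plane) (j : ℕ) (ω : Ω) : ℝ≥0∞ :=
  c.sinrAt (W.gainE j ω) (dist e y)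
    (c.interferenceAt e (fun k => W.field j k ω) fun k => W.gainI j k ω)

lemma sinrE_withBs (x : ℕ → Plane) (j : ℕ) (ω : Ω) :
    (W.withBs x).sinrE c j ω = W.sinrEFrom c (x (nearest x)) (W.er j ω) j ω := rfl

lemma measurable_sinrEFrom {m : MeasurableSpace Ω} {e : Ω → Plane} {j : ℕ} (he : Measurable e)
    (hg : Measurable (W.gainE j)) (hf : ∀ k, Measurable (W.field j k))
    (hI : ∀ k, Measurable (W.gainI j k)) (y : Plane) :
    Measurable fun ω => W.sinrEFrom c y (e ω) j ω :=
  Params.measurable_sinrAt hg (he.dist measurable_const)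
    (Params.measurable_interferenceAt he hf hI)

/-- The random gains and interference fields seen by the eavesdroppers. -/
def eveMarks (W : Network Ω) (ω : Ω) : (ℕ → ℝ) × (ℕ → ℕ → Plane) × (ℕ → ℕ → ℝ) :=
  (fun j => W.gainE j ω, fun j k => W.field j k ω, fun j k => W.gainI j k ω)

lemma measurable_eveMarks {m : MeasurableSpace Ω} (hg : ∀ j, Measurable (W.gainE j))
    (hf : ∀ j k, Measurable (W.field j k)) (hI : ∀ j k, Measurable (W.gainI j k)) :
    Measurable W.eveMarks :=
  (measurable_pi_of_forall hg).prodMk ((measurable_pi_of_forall fun j =>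
    measurable_pi_of_forall (hf j)).prodMk (measurable_pi_of_forall fun j =>
    measurable_pi_of_forall (hI j)))

variable [mΩ : MeasurableSpace Ω] {μ : Measure Ω}

lemma IsModel.indepFun_er_eveMarks (h : W.IsModel μ c) :
    IndepFun (fun ω j => W.er j ω) W.eveMarks μ := by
  have h1 : ∀ j, Measurable[W.sigmaOn {.er}] (W.er j) :=
    W.measurable_er_sigmaOn (mem_singleton _)
  have h2 : ∀ j, Measurable[W.sigmaOn {i | i ≠ .er}] (W.gainE j) :=
    fun j => W.measurable_gainE_sigmaOn (by simp)
  have h3 : ∀ j k, Measurable[W.sigmaOn {i | i ≠ .er}] (W.field j k) :=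
    fun j k => W.measurable_field_sigmaOn (by simp) k
  have h4 : ∀ j k, Measurable[W.sigmaOn {i | i ≠ .er}] (W.gainI j k) :=
    fun j k => W.measurable_gainI_sigmaOn (by simp)
  exact h.indepFun_of_disjoint (by simp) (measurable_pi_of_forall h1)
    (measurable_eveMarks h2 h3 h4)

variable [IsProbabilityMeasure μ]

/-- The probability that an eavesdropper at `e` has SINR above `γ`, if the serving base station
is at `y`. -/
def exceedE (c : Params) (γ : ℝ) (y e : Plane) : ℝ≥0∞ :=
  if e = y then 0 else ENNReal.ofReal (Real.exp (-(c.rateE γ) * dist e y ^ 2))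

lemma measurable_exceedE (γ : ℝ) (y : Plane) : Measurable (exceedE c γ y) :=
  Measurable.ite (measurableSet_singleton y) measurable_const (by fun_prop)

lemma IsModel.measure_lt_sinrEFrom (h : W.IsModel μ c) (hc : c.Valid) (hσ : c.σ2 = 0)
    {γ : ℝ} (hγ : 0 < γ) (hγθ : 0 < c.θ - (1 - c.θ) * γ) (y e : Plane) (j : ℕ) :
    μ {ω | ENNReal.ofReal γ < W.sinrEFrom c y e j ω} = exceedE c γ y e := by
  rw [exceedE]
  split_ifs with he
  · have : {ω | ENNReal.ofReal γ < W.sinrEFrom c y e j ω} = ∅ := by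
      refine Set.eq_empty_of_forall_notMem fun ω hω => ?_
      have hω' : ENNReal.ofReal γ < W.sinrEFrom c y e j ω := hω
      rw [sinrEFrom, he, dist_self] at hω'
      exact hc.not_lt_sinrAt_zero _ _ _ hω'
    rw [this, measure_empty]
  · exact h.measure_lt_sinrAt hc hσ hγ hγθ (dist_pos.2 he) e j

/-- At fixed locations eavesdropper `j` uses only its own gain and its own interference field. These
blocks of sources are disjoint in `j`, so the probability that no one exceeds `γ` is the product of
the factors `1 - exceedE`. -/
lemma IsModel.lintegral_expNeg_exceedances (h : W.IsModel μ c) (hc : c.Valid) (hσ : c.σ2 = 0)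
    {γ : ℝ} (hγ : 0 < γ) (hγθ : 0 < c.θ - (1 - c.θ) * γ) (y : Plane) (e : ℕ → Plane) :
    ∫⁻ ω, expNeg (∑' j, if ENNReal.ofReal γ < W.sinrEFrom c y (e j) j ω then ∞ else 0) ∂μ
      = expNeg (∑' j, negLog (1 - exceedE c γ y (e j))) := by
  set Y : ℕ → Ω → ℝ≥0∞ := fun j ω =>
    if ENNReal.ofReal γ < W.sinrEFrom c y (e j) j ω then ∞ else 0 with hY
  let S : ℕ → Set Source := fun j => {.gainE j, .field j} ∪ range (Source.gainI j)
  have hsj : ∀ j, Measurable fun ω => W.sinrEFrom c y (e j) j ω := fun j =>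
    measurable_sinrEFrom measurable_const (h.gainE_law j).1 (h.field_poisson j).measurable
      (fun k => (h.gainI_law j k).1) y
  have hSm : ∀ j, MeasurableSet {ω | ENNReal.ofReal γ < W.sinrEFrom c y (e j) j ω} := fun j =>
    measurableSet_lt measurable_const (hsj j)
  have hYm : ∀ j, Measurable (Y j) := fun j => measurable_ite_lt_top (hsj j) _
  have hYloc : ∀ j, Measurable[W.sigmaOn (S j)] (Y j) := by
    intro j
    have h1 : Measurable[W.sigmaOn (S j)] (W.gainE j) :=
      W.measurable_gainE_sigmaOn (by simp [S])
    have h2 : ∀ k, Measurable[W.sigmaOn (S j)] (W.field j k) :=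
      W.measurable_field_sigmaOn (by simp [S])
    have h3 : ∀ k, Measurable[W.sigmaOn (S j)] (W.gainI j k) :=
      fun k => W.measurable_gainI_sigmaOn (by simp [S])
    exact measurable_ite_lt_top (measurable_sinrEFrom measurable_const h1 h2 h3 y) _
  have hdis : Pairwise fun i j => Disjoint (S i) (S j) := by
    intro i j hij
    refine Set.disjoint_left.2 ?_
    rintro a ((rfl | rfl) | ⟨k, rfl⟩) <;> simp [S, hij, Ne.symm hij]
  have hiind : ProbabilityTheory.iIndepFun Y μ := h.iIndepFun_of_disjoint hdis hYloc
  rw [lintegral_expNeg_tsum_of_iIndepFun hYm hiind]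
  congr 1
  refine tsum_congr fun j => ?_
  congr 1
  have h1 : ∀ ω, expNeg (Y j ω)
      = {ω | ENNReal.ofReal γ < W.sinrEFrom c y (e j) j ω}ᶜ.indicator 1 ω := by
    intro ω
    by_cases hω : ENNReal.ofReal γ < W.sinrEFrom c y (e j) j ω <;> simp [hY, hω]
  rw [lintegral_congr h1, lintegral_indicator_one (hSm j).compl, prob_compl_eq_one_sub (hSm j),
    h.measure_lt_sinrEFrom hc hσ hγ hγθ]

/-- All eavesdroppers have SINR at most `γ` with probability `probE γ`, wherever the serving base
station is located. -/
theorem IsModel.measure_forall_sinrEFrom_le (h : W.IsModel μ c) (hc : c.Valid) (hσ : c.σ2 = 0)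
    {γ : ℝ} (hγ : 0 < γ) (hγθ : 0 < c.θ - (1 - c.θ) * γ) (y : Plane) :
    μ {ω | ∀ j, W.sinrEFrom c y (W.er j ω) j ω ≤ ENNReal.ofReal γ}
      = ENNReal.ofReal (c.probE γ) := by
  have hr : 0 < c.ratio γ := div_pos hγ hγθ
  have hG := hc.gammaFactor_pos
  have hlamB := hc.lamB_pos
  have hlamE := hc.lamE_pos
  have hκ : 0 < c.rateE γ := by unfold Params.rateE; positivity
  have hgm : ∀ j, Measurable (W.gainE j) := fun j => (h.gainE_law j).1
  have hfm : ∀ j k, Measurable (W.field j k) := fun j => (h.field_poisson j).measurable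
  have hIm : ∀ j k, Measurable (W.gainI j k) := fun j k => (h.gainI_law j k).1
  let Φ : (ℕ → Plane) × (ℕ → ℝ) × (ℕ → ℕ → Plane) × (ℕ → ℕ → ℝ) → ℝ≥0∞ := fun p =>
    expNeg (∑' j, if ENNReal.ofReal γ < c.sinrAt (p.2.1 j) (dist (p.1 j) y)
      (c.interferenceAt (p.1 j) (fun k => p.2.2.1 j k) (fun k => p.2.2.2 j k)) then ∞ else 0)
  have hΦ : Measurable Φ := by
    refine measurable_expNeg.comp (measurable_tsum_of_forall fun j =>
      measurable_ite_lt_top (Params.measurable_sinrAt (by fun_prop) (by fun_prop)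
        (Params.measurable_interferenceAt (by fun_prop) (by fun_prop) (by fun_prop))) _)
  have hmeas : MeasurableSet {ω | ∀ j, W.sinrEFrom c y (W.er j ω) j ω ≤ ENNReal.ofReal γ} := by
    simp only [Set.ofPred_forall]
    exact .iInter fun j => measurableSet_le (measurable_sinrEFrom
      (h.er_poisson.measurable j) (hgm j) (hfm j) (hIm j) y) measurable_const
  have hev : ∀ ω, Φ (fun j => W.er j ω, W.eveMarks ω)
      = {ω | ∀ j, W.sinrEFrom c y (W.er j ω) j ω ≤ ENNReal.ofReal γ}.indicator 1 ω := fun ω => by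
    refine (expNeg_tsum_ite_top _).trans ?_
    simp only [not_lt]
    rfl
  have hq1 : ∀ e, exceedE c γ y e ≤ 1 := fun e => by
    rw [← h.measure_lt_sinrEFrom hc hσ hγ hγθ y e 0]
    exact prob_le_one
  have hm2 : Measurable fun e => negLog (1 - exceedE c γ y e) :=
    measurable_negLog.comp ((measurable_exceedE γ y).const_sub 1)
  calc μ {ω | ∀ j, W.sinrEFrom c y (W.er j ω) j ω ≤ ENNReal.ofReal γ}
      = ∫⁻ ω, Φ (fun j => W.er j ω, W.eveMarks ω) ∂μ := by
        rw [lintegral_congr hev, lintegral_indicator_one hmeas]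
    _ = ∫⁻ ω, expNeg (∑' j, negLog (1 - exceedE c γ y (W.er j ω))) ∂μ := by
        rw [lintegral_of_indepFun h.indepFun_er_eveMarks
          (measurable_pi_of_forall h.er_poisson.measurable) (measurable_eveMarks hgm hfm hIm) hΦ]
        exact lintegral_congr fun ω =>
          h.lintegral_expNeg_exceedances hc hσ hγ hγθ y fun j => W.er j ω
    _ = expNeg (ENNReal.ofReal c.lamE * ∫⁻ e, (1 - expNeg (negLog (1 - exceedE c γ y e)))) :=
        h.er_poisson.lintegral_expNeg_tsum hlamE.le hm2
    _ = expNeg (ENNReal.ofReal c.lamE * ENNReal.ofReal (Real.pi / c.rateE γ)) := by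
        -- `1 - expNeg (negLog (1 - q)) = q`, and off the null set `{y}` this `q` is a Gaussian
        -- centred at `y`. Its integral, hence the result, no longer depends on `y`.
        congr 2
        rw [← lintegral_exp_neg_mul_dist_sq hκ y]
        refine lintegral_congr_ae ?_
        filter_upwards [measure_eq_zero_iff_ae_notMem.1 (measure_singleton y)] with e he
        rw [expNeg_negLog tsub_le_self, ENNReal.sub_sub_cancel ENNReal.one_ne_top (hq1 e),
          exceedE, if_neg (show ¬ e = y from he)]
    _ = _ := by
        rw [← ENNReal.ofReal_mul hlamE.le, expNeg_ofReal (by positivity), Params.probE,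
          Params.rateE]
        congr 3
        have := Real.pi_pos
        have : 0 < c.ratio γ ^ (2 / c.β) := by positivity
        field_simp

end Network

end

section

/-! ### The joint law of the two signal-to-interference ratios -/

namespace Params

/-- The probability that all eavesdroppers have SINR at most `γ`. -/
def cdfE (c : Params) (γ : ℝ) : ℝ := if 0 < c.θ - (1 - c.θ) * γ then c.probE γ else 1

end Params

namespace Network

variable {Ω : Type*} {c : Params} {W : Network Ω}

/-- All sources of randomness except for the locations of the base stations. -/
def marks (W : Network Ω) (ω : Ω) :
    (ℕ → BSState) × (ℕ → ℝ) × (ℕ → Plane) × (ℕ → ℝ) × (ℕ → ℕ → Plane) × (ℕ → ℕ → ℝ) :=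
  (fun n => W.state n ω, fun n => W.gainU n ω, fun j => W.er j ω, W.eveMarks ω)

/-- The network on the space of all possible values of the sources of randomness. -/
def canonical : Network ((ℕ → Plane) × (ℕ → BSState) × (ℕ → ℝ) × (ℕ → Plane) ×
    (ℕ → ℝ) × (ℕ → ℕ → Plane) × (ℕ → ℕ → ℝ)) where
  bs n p := p.1 n
  state n p := p.2.1 n
  gainU n p := p.2.2.1 n
  er j p := p.2.2.2.1 j
  gainE j p := p.2.2.2.2.1 j
  field j k p := p.2.2.2.2.2.1 j k
  gainI j k p := p.2.2.2.2.2.2 j k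

lemma measurable_marks {m : MeasurableSpace Ω} (hs : ∀ n, Measurable (W.state n))
    (hu : ∀ n, Measurable (W.gainU n)) (he : ∀ j, Measurable (W.er j))
    (hg : ∀ j, Measurable (W.gainE j)) (hf : ∀ j k, Measurable (W.field j k))
    (hI : ∀ j k, Measurable (W.gainI j k)) : Measurable W.marks :=
  (measurable_pi_of_forall hs).prodMk ((measurable_pi_of_forall hu).prodMk
    ((measurable_pi_of_forall he).prodMk (measurable_eveMarks hg hf hI)))

lemma measurable_sinrMaxE {m : MeasurableSpace Ω} (hb : ∀ n, Measurable (W.bs n))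
    (he : ∀ j, Measurable (W.er j)) (hg : ∀ j, Measurable (W.gainE j))
    (hf : ∀ j k, Measurable (W.field j k)) (hI : ∀ j k, Measurable (W.gainI j k)) :
    Measurable (W.sinrMaxE c) :=
  Measurable.iSup fun j => measurable_sinrE hb (he j) (hg j) (hf j) (hI j)

lemma measurable_canonical_sinrU : Measurable (canonical.sinrU c) :=
  measurable_sinrU (fun n => (measurable_pi_apply n).comp measurable_fst)
    (fun n => (measurable_pi_apply n).comp measurable_snd.fst)
    (fun n => (measurable_pi_apply n).comp measurable_snd.snd.fst)

lemma measurable_canonical_sinrMaxE : Measurable (canonical.sinrMaxE c) := by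
  refine measurable_sinrMaxE (fun n => ?_) (fun n => ?_) (fun n => ?_) (fun j k => ?_)
    (fun j k => ?_) <;> simp only [canonical] <;> fun_prop

lemma measurable_sinrU_withBs {m : MeasurableSpace Ω} (hs : ∀ n, Measurable (W.state n))
    (hg : ∀ n, Measurable (W.gainU n)) (x : ℕ → Plane) : Measurable ((W.withBs x).sinrU c) :=
  measurable_sinrU (fun _ => measurable_const) hs hg

lemma measurable_sinrMaxE_withBs {m : MeasurableSpace Ω} (he : ∀ j, Measurable (W.er j))
    (hg : ∀ j, Measurable (W.gainE j)) (hf : ∀ j k, Measurable (W.field j k))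
    (hI : ∀ j k, Measurable (W.gainI j k)) (x : ℕ → Plane) :
    Measurable ((W.withBs x).sinrMaxE c) :=
  measurable_sinrMaxE (fun _ => measurable_const) he hg hf hI

variable [mΩ : MeasurableSpace Ω] {μ : Measure Ω}

lemma IsModel.measurable_sinrU (h : W.IsModel μ c) : Measurable (W.sinrU c) :=
  Network.measurable_sinrU h.bs_poisson.measurable h.state_measurable fun n => (h.gainU_law n).1

lemma IsModel.measurable_sinrMaxE (h : W.IsModel μ c) : Measurable (W.sinrMaxE c) :=
  Network.measurable_sinrMaxE h.bs_poisson.measurable h.er_poisson.measurable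
    (fun j => (h.gainE_law j).1) (fun j => (h.field_poisson j).measurable)
    fun j k => (h.gainI_law j k).1

lemma IsModel.measurable_marks (h : W.IsModel μ c) : Measurable W.marks :=
  Network.measurable_marks h.state_measurable (fun n => (h.gainU_law n).1)
    h.er_poisson.measurable (fun j => (h.gainE_law j).1)
    (fun j => (h.field_poisson j).measurable) fun j k => (h.gainI_law j k).1

lemma IsModel.indepFun_bs_marks (h : W.IsModel μ c) :
    IndepFun (fun ω n => W.bs n ω) W.marks μ := by
  have h0 : ∀ n, Measurable[W.sigmaOn {.bs}] (W.bs n) :=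
    W.measurable_bs_sigmaOn (mem_singleton _)
  have h1 : ∀ j, Measurable[W.sigmaOn {i | i ≠ .bs}] (W.er j) :=
    W.measurable_er_sigmaOn (by simp)
  have h2 : ∀ j, Measurable[W.sigmaOn {i | i ≠ .bs}] (W.gainE j) :=
    fun j => W.measurable_gainE_sigmaOn (by simp)
  have h3 : ∀ j k, Measurable[W.sigmaOn {i | i ≠ .bs}] (W.field j k) :=
    fun j k => W.measurable_field_sigmaOn (by simp) k
  have h4 : ∀ j k, Measurable[W.sigmaOn {i | i ≠ .bs}] (W.gainI j k) :=
    fun j k => W.measurable_gainI_sigmaOn (by simp)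
  have h5 : ∀ n, Measurable[W.sigmaOn {i | i ≠ .bs}] (W.state n) :=
    fun j => W.measurable_state_sigmaOn (by simp)
  have h6 : ∀ n, Measurable[W.sigmaOn {i | i ≠ .bs}] (W.gainU n) :=
    fun j => W.measurable_gainU_sigmaOn (by simp)
  exact h.indepFun_of_disjoint (by simp) (measurable_pi_of_forall h0)
    (Network.measurable_marks h5 h6 h1 h2 h3 h4)

/-- Once the locations are frozen, the user depends on states and user gains only, and the
eavesdroppers on the remaining sources. -/
lemma IsModel.indepFun_withBs (h : W.IsModel μ c) (x : ℕ → Plane) :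
    IndepFun ((W.withBs x).sinrU c) ((W.withBs x).sinrMaxE c) μ := by
  let S : Set Source := range Source.state ∪ range Source.gainU
  have h1 : ∀ j, Measurable[W.sigmaOn Sᶜ] (W.er j) := W.measurable_er_sigmaOn (by simp [S])
  have h2 : ∀ j, Measurable[W.sigmaOn Sᶜ] (W.gainE j) :=
    fun j => W.measurable_gainE_sigmaOn (by simp [S])
  have h3 : ∀ j k, Measurable[W.sigmaOn Sᶜ] (W.field j k) :=
    fun j k => W.measurable_field_sigmaOn (by simp [S]) k
  have h4 : ∀ j k, Measurable[W.sigmaOn Sᶜ] (W.gainI j k) :=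
    fun j k => W.measurable_gainI_sigmaOn (by simp [S])
  have h5 : ∀ n, Measurable[W.sigmaOn S] (W.state n) :=
    fun j => W.measurable_state_sigmaOn (by simp [S])
  have h6 : ∀ n, Measurable[W.sigmaOn S] (W.gainU n) :=
    fun j => W.measurable_gainU_sigmaOn (by simp [S])
  exact h.indepFun_of_disjoint disjoint_compl_right (measurable_sinrU_withBs h5 h6 x)
    (measurable_sinrMaxE_withBs h1 h2 h3 h4 x)

variable [IsProbabilityMeasure μ]

/-- Given the locations of the base stations, the SINR of the user and the largest SINR of the
eavesdroppers are independent. -/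
lemma IsModel.measure_sinrU_mem_sinrMaxE_mem (h : W.IsModel μ c) {A B : Set ℝ≥0∞}
    (hA : MeasurableSet A) (hB : MeasurableSet B) :
    μ {ω | W.sinrU c ω ∈ A ∧ W.sinrMaxE c ω ∈ B}
      = ∫⁻ ω, μ ((W.withBs fun n => W.bs n ω).sinrU c ⁻¹' A)
          * μ ((W.withBs fun n => W.bs n ω).sinrMaxE c ⁻¹' B) ∂μ := by
  -- Joint measurability in locations and marks is obtained on the canonical space; the event for
  -- `W` is the preimage of this set under the pair of base station locations and `marks`.
  have hD : MeasurableSet (canonical.sinrU c ⁻¹' A ∩ canonical.sinrMaxE c ⁻¹' B) :=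
    (measurable_canonical_sinrU hA).inter (measurable_canonical_sinrMaxE hB)
  have h1 := lintegral_of_indepFun h.indepFun_bs_marks
    (measurable_pi_of_forall h.bs_poisson.measurable) h.measurable_marks
    ((measurable_const (a := (1 : ℝ≥0∞))).indicator hD)
  have h2 : MeasurableSet {ω | W.sinrU c ω ∈ A ∧ W.sinrMaxE c ω ∈ B} :=
    (h.measurable_sinrU hA).inter (h.measurable_sinrMaxE hB)
  rw [← lintegral_indicator_one h2]
  refine Eq.trans ?_ (h1.trans (lintegral_congr fun ω => ?_))
  · rfl
  · have hu : Measurable ((W.withBs fun n => W.bs n ω).sinrU c) :=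
      measurable_sinrU_withBs h.state_measurable (fun n => (h.gainU_law n).1) _
    have he : Measurable ((W.withBs fun n => W.bs n ω).sinrMaxE c) :=
      measurable_sinrMaxE_withBs h.er_poisson.measurable
        (fun j => (h.gainE_law j).1) (fun j => (h.field_poisson j).measurable)
        (fun j k => (h.gainI_law j k).1) _
    rw [← (h.indepFun_withBs fun n => W.bs n ω).measure_inter_preimage_eq_mul _ _ hA hB,
      ← lintegral_indicator_one ((hu hA).inter (he hB))]
    rfl

/-- The value is free of `x`; this makes the joint probability factor after averaging over the base
stations. -/
lemma IsModel.measure_sinrMaxE_withBs_le (h : W.IsModel μ c) (hc : c.Valid) (hσ : c.σ2 = 0)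
    {γ : ℝ} (hγ : 0 < γ) (x : ℕ → Plane) :
    μ ((W.withBs x).sinrMaxE c ⁻¹' Iic (ENNReal.ofReal γ)) = ENNReal.ofReal (c.cdfE γ) := by
  have hset : (W.withBs x).sinrMaxE c ⁻¹' Iic (ENNReal.ofReal γ)
      = {ω | ∀ j, W.sinrEFrom c (x (nearest x)) (W.er j ω) j ω ≤ ENNReal.ofReal γ} := by
    ext ω
    simp only [mem_preimage, mem_Iic, sinrMaxE, iSup_le_iff, sinrE_withBs, mem_ofPred_eq]
  rw [hset, Params.cdfE]
  split_ifs with hγθ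
  · exact h.measure_forall_sinrEFrom_le hc hσ hγ hγθ _
  · have : {ω | ∀ j, W.sinrEFrom c (x (nearest x)) (W.er j ω) j ω ≤ ENNReal.ofReal γ} = univ :=
      Set.eq_univ_of_forall fun ω j => hc.sinrAt_le hγ.le (not_lt.1 hγθ) dist_nonneg _ _
    rw [this, measure_univ, ENNReal.ofReal_one]

/-- The joint distribution function of the SINR of the user and the largest SINR of the
eavesdroppers. -/
theorem IsModel.measure_lt_sinrU_and_sinrMaxE_le (h : W.IsModel μ c) (hc : c.Valid) (hδ : c.δ < 1)
    (hσ : c.σ2 = 0) {γ : ℝ} (hγ : 0 < γ) :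
    μ {ω | ENNReal.ofReal γ < W.sinrU c ω ∧ W.sinrMaxE c ω ≤ ENNReal.ofReal γ}
      = ENNReal.ofReal (1 / (1 + c.totalZ γ)) * ENNReal.ofReal (c.cdfE γ) := by
  have h1 := h.measure_sinrU_mem_sinrMaxE_mem (measurableSet_Ioi (a := ENNReal.ofReal γ))
    (measurableSet_Iic (a := ENNReal.ofReal γ))
  simp only [h.measure_sinrMaxE_withBs_le hc hσ hγ] at h1
  refine h1.trans ?_
  rw [lintegral_mul_const' _ _ ENNReal.ofReal_ne_top,
    ← h.bs_poisson.lintegral_expNeg_sumBeyond hc.lamB_pos (Params.measurable_exponentU γ)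
      (hc.monotoneOn_exponentU hδ hγ.le) (hc.totalZ_nonneg hδ hγ.le)
      fun r hr => hc.lintegral_exponentU hδ hγ.le hr]
  congr 1
  refine lintegral_congr_ae ?_
  filter_upwards [h.bs_poisson.ae_forall_notMem (measurableSet_singleton 0)
    (measure_singleton (0 : Plane))] with ω hω
  exact h.measure_lt_sinrU_withBs hc hδ hσ hγ (hω _)

lemma IsModel.measure_sinrMaxE_le (h : W.IsModel μ c) (hc : c.Valid) (hσ : c.σ2 = 0)
    {γ : ℝ} (hγ : 0 < γ) :
    μ {ω | W.sinrMaxE c ω ≤ ENNReal.ofReal γ} = ENNReal.ofReal (c.cdfE γ) := by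
  have h1 := h.measure_sinrU_mem_sinrMaxE_mem MeasurableSet.univ
    (measurableSet_Iic (a := ENNReal.ofReal γ))
  simp only [h.measure_sinrMaxE_withBs_le hc hσ hγ] at h1
  simpa using h1

end Network

end

section

/-! ### Integrability of the closed form -/

/-- `∫₀¹ t ^ (-p) / (1 + g t) dt` decays like `g ^ (p - 1)`. -/
lemma le_integral_rpow_neg_div {p g : ℝ} (hp : p < 1) (hg : 1 ≤ g) :
    g ^ (p - 1) / (2 * (1 - p)) ≤ ∫ t in (0 : ℝ)..1, t ^ (-p) / (1 + g * t) := by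
  have hg0 : 0 < g := by linarith
  have hi := intervalIntegrable_rpow_neg_div hp hg0.le
  -- Only `t ≤ 1 / g` is kept, where the denominator is at most 2.
  have h1 : g⁻¹ ∈ Icc (0 : ℝ) 1 := ⟨by positivity, inv_le_one_of_one_le₀ hg⟩
  have hsub : uIcc (0 : ℝ) g⁻¹ ⊆ uIcc 0 1 := by
    rw [uIcc_of_le h1.1, uIcc_of_le zero_le_one]; exact Icc_subset_Icc_right h1.2
  calc g ^ (p - 1) / (2 * (1 - p)) = ∫ t in (0 : ℝ)..g⁻¹, t ^ (-p) / 2 := by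
        rw [intervalIntegral.integral_div, integral_rpow (Or.inl (by linarith)),
          Real.zero_rpow (by linarith), Real.inv_rpow hg0.le, ← Real.rpow_neg hg0.le]
        have : 1 - p ≠ 0 := by linarith
        rw [show -(-p + 1) = p - 1 by ring, show -p + 1 = 1 - p by ring]
        field_simp
        ring
    _ ≤ ∫ t in (0 : ℝ)..g⁻¹, t ^ (-p) / (1 + g * t) := by
        refine intervalIntegral.integral_mono_on h1.1
          ((intervalIntegral.intervalIntegrable_rpow' (by linarith)).div_const _)
          (hi.mono_set hsub) fun t ht => ?_
        have h2 : g * t ≤ 1 := by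
          calc g * t ≤ g * g⁻¹ := by gcongr; exact ht.2
            _ = 1 := mul_inv_cancel₀ hg0.ne'
        have h3 : 0 ≤ g * t := mul_nonneg hg0.le ht.1
        have h4 : 0 ≤ t ^ (-p) := Real.rpow_nonneg ht.1 _
        gcongr
        linarith
    _ ≤ ∫ t in (0 : ℝ)..1, t ^ (-p) / (1 + g * t) := by
        refine intervalIntegral.integral_mono_interval le_rfl h1.1 h1.2 ?_ hi
        refine (ae_restrict_iff' measurableSet_Ioc).2 (Eventually.of_forall fun t ht => ?_)
        have h3 : 0 ≤ g * t := mul_nonneg hg0.le ht.1.le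
        exact div_nonneg (Real.rpow_nonneg ht.1.le _) (by linarith)

namespace Params

variable {c : Params}

lemma Valid.two_div_β_mem (hc : c.Valid) : 2 / c.β ∈ Ioo (0 : ℝ) 1 := by
  have := hc.two_lt_β
  exact ⟨by positivity, by rw [div_lt_one (by linarith)]; exact this⟩

/-- The constant in the lower bound of `Z`. -/
def growthZ (c : Params) : ℝ := 2 / c.β / (2 * (1 - 2 / c.β))

lemma Valid.growthZ_pos (hc : c.Valid) : 0 < c.growthZ :=
  div_pos hc.two_div_β_mem.1 (by linarith [hc.two_div_β_mem.2])

lemma Valid.le_Z (hc : c.Valid) {g : ℝ} (hg : 1 ≤ g) : c.growthZ * g ^ (2 / c.β) ≤ c.Z g := by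
  have hp := hc.two_div_β_mem
  have hg0 : 0 < g := by linarith
  rw [Z_eq hc.two_lt_β]
  refine le_trans (le_of_eq ?_)
    (mul_le_mul_of_nonneg_left (le_integral_rpow_neg_div hp.2 hg) (mul_nonneg hp.1.le hg0.le))
  rw [Real.rpow_sub_one hg0.ne', growthZ]
  field_simp

/-- Probability that a base station interferes at the user. -/
def probInterfere (c : Params) : ℝ := c.stateProb .secure + c.stateProb .normalUncached

lemma Valid.probInterfere_pos (hc : c.Valid) (hδ : c.δ < 1) : 0 < c.probInterfere := by
  rw [probInterfere, stateProb, stateProb, ← add_div]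
  refine div_pos ?_ (hc.sum_requestShare_pos hδ)
  simp only [requestShare]
  -- The two shares add up to `1 - δ` for every `α`.
  linarith

lemma Valid.le_totalZ (hc : c.Valid) (hδ : c.δ < 1) {γ : ℝ} (hγ : 1 ≤ γ) :
    c.probInterfere * c.growthZ * γ ^ (2 / c.β) ≤ c.totalZ γ := by
  have h0 : 0 < γ := by linarith
  have h1 : γ ≤ γ / c.θ := by
    rw [le_div_iff₀ hc.θ_pos]; nlinarith [hc.θ_le_one]
  have h2 := hc.le_Z hγ
  have h3 : c.growthZ * γ ^ (2 / c.β) ≤ c.Z (γ / c.θ) :=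
    le_trans (mul_le_mul_of_nonneg_left
      (Real.rpow_le_rpow h0.le h1 hc.two_div_β_mem.1.le) hc.growthZ_pos.le)
      (hc.le_Z (hγ.trans h1))
  rw [hc.totalZ_eq, probInterfere, mul_assoc, add_mul]
  exact add_le_add (mul_le_mul_of_nonneg_left h2 (hc.stateProb_nonneg hδ _))
    (mul_le_mul_of_nonneg_left h3 (hc.stateProb_nonneg hδ _))

lemma Valid.measurable_Z (hc : c.Valid) : Measurable c.Z := by
  have h1 : Measurable fun x : ℝ × ℝ => x.2 ^ (-(2 / c.β)) / (1 + x.1 * x.2) := by fun_prop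
  have h2 := h1.stronglyMeasurable.integral_prod_right' (ν := volume.restrict (Ioc (0 : ℝ) 1))
  have h3 : c.Z = fun g => 2 / c.β * g * ∫ t in Ioc (0 : ℝ) 1, t ^ (-(2 / c.β)) / (1 + g * t) := by
    ext g
    rw [Z_eq hc.two_lt_β, intervalIntegral.integral_of_le zero_le_one]
  rw [h3]
  exact (measurable_id.const_mul _).mul h2.measurable

lemma tailIntegrand_eq (γ : ℝ) : c.tailIntegrand γ = 1 / (1 + γ) * (1 / (1 + c.totalZ γ)) := by
  rw [tailIntegrand, totalZ, add_comm (1 : ℝ) (_ + _), one_div_mul_one_div]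

lemma Valid.measurable_totalZ (hc : c.Valid) : Measurable c.totalZ :=
  (hc.measurable_Z.mul_const _).add
    ((hc.measurable_Z.comp (measurable_id.div_const _)).mul_const _)

lemma Valid.measurable_tailIntegrand (hc : c.Valid) : Measurable c.tailIntegrand := by
  have := hc.measurable_totalZ
  have h : c.tailIntegrand = fun γ => 1 / (1 + γ) * (1 / (1 + c.totalZ γ)) :=
    funext tailIntegrand_eq
  rw [h]
  fun_prop

lemma Valid.tailIntegrand_nonneg (hc : c.Valid) (hδ : c.δ < 1) {γ : ℝ} (hγ : 0 ≤ γ) :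
    0 ≤ c.tailIntegrand γ := by
  have := hc.totalZ_nonneg hδ hγ
  rw [tailIntegrand_eq]
  positivity

lemma Valid.tailIntegrand_le_one (hc : c.Valid) (hδ : c.δ < 1) {γ : ℝ} (hγ : 0 ≤ γ) :
    c.tailIntegrand γ ≤ 1 := by
  have := hc.totalZ_nonneg hδ hγ
  rw [tailIntegrand_eq]
  exact mul_le_one₀ (one_div_one_add_le_one hγ) (by positivity) (one_div_one_add_le_one this)

lemma Valid.tailIntegrand_le (hc : c.Valid) (hδ : c.δ < 1) {γ : ℝ} (hγ : 1 ≤ γ) :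
    c.tailIntegrand γ ≤ 1 / (c.probInterfere * c.growthZ) * γ ^ (-1 - 2 / c.β) := by
  have h0 : 0 < γ := by linarith
  have h1 := hc.probInterfere_pos hδ
  have h2 := hc.growthZ_pos
  have h3 := hc.le_totalZ hδ hγ
  have h4 : 0 < c.probInterfere * c.growthZ * γ ^ (2 / c.β) := by positivity
  rw [tailIntegrand_eq]
  calc 1 / (1 + γ) * (1 / (1 + c.totalZ γ))
      ≤ 1 / γ * (1 / (c.probInterfere * c.growthZ * γ ^ (2 / c.β))) := by
        have : 0 ≤ c.totalZ γ := h4.le.trans h3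
        gcongr <;> linarith
    _ = 1 / (c.probInterfere * c.growthZ) * γ ^ (-1 - 2 / c.β) := by
        rw [Real.rpow_sub h0, Real.rpow_neg_one]
        field_simp

/-- Bounded by 1 up to `γ = 1`, and by a multiple of `γ ^ (-1 - 2 / β)` beyond, thanks to the growth
of `totalZ`. -/
lemma Valid.integrableOn_tailIntegrand (hc : c.Valid) (hδ : c.δ < 1) :
    IntegrableOn c.tailIntegrand (Ioi 0) := by
  have hm := hc.measurable_tailIntegrand
  rw [← Ioc_union_Ioi_eq_Ioi (zero_le_one' ℝ)]
  refine IntegrableOn.union ?_ ?_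
  · refine Integrable.mono' (g := fun _ => (1 : ℝ)) (integrable_const _) hm.aestronglyMeasurable
      ((ae_restrict_iff' measurableSet_Ioc).2 (Eventually.of_forall fun γ hγ => ?_))
    rw [Real.norm_of_nonneg (hc.tailIntegrand_nonneg hδ hγ.1.le)]
    exact hc.tailIntegrand_le_one hδ hγ.1.le
  · have hp := hc.two_div_β_mem.1
    refine Integrable.mono' ((integrableOn_Ioi_rpow_of_lt (a := -1 - 2 / c.β) (by linarith)
      zero_lt_one).const_mul (1 / (c.probInterfere * c.growthZ))) hm.aestronglyMeasurable
      ((ae_restrict_iff' measurableSet_Ioi).2 (Eventually.of_forall fun γ hγ => ?_))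
    have hγ' : (1 : ℝ) < γ := hγ
    rw [Real.norm_of_nonneg (hc.tailIntegrand_nonneg hδ (by linarith))]
    exact hc.tailIntegrand_le hδ hγ'.le

lemma Valid.lt_gammaTh0_iff (hc : c.Valid) (γ : ℝ) :
    ENNReal.ofReal γ < c.gammaTh0 ↔ 0 < c.θ - (1 - c.θ) * γ := by
  have hθ := hc.θ_pos
  rcases hc.θ_le_one.eq_or_lt with h1 | h1
  -- For `θ = 1` the threshold is `1 / 0 = ∞` in `ℝ≥0∞`, and the right side reads `0 < 1`.
  · simp [gammaTh0, h1]
  · have h2 : 0 < 1 - c.θ := by linarith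
    rw [gammaTh0, ← ENNReal.ofReal_div_of_pos h2, ENNReal.ofReal_lt_ofReal_iff (by positivity),
      lt_div_iff₀ h2, sub_pos, mul_comm]

lemma Valid.headSet_eq (hc : c.Valid) :
    c.headSet = {γ | 0 < γ ∧ 0 < c.θ - (1 - c.θ) * γ} := by
  ext γ
  exact and_congr_right fun _ => hc.lt_gammaTh0_iff γ

lemma Valid.tailSet_eq (hc : c.Valid) :
    c.tailSet = {γ | 0 < γ ∧ ¬ 0 < c.θ - (1 - c.θ) * γ} := by
  ext γ
  exact and_congr_right fun _ => by rw [← hc.lt_gammaTh0_iff γ, not_lt]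

lemma headSet_union_tailSet : c.headSet ∪ c.tailSet = Ioi 0 := by
  ext γ
  simp only [headSet, tailSet, mem_union, mem_ofPred_eq, mem_Ioi, ← and_or_left, lt_or_ge, and_true]

lemma disjoint_headSet_tailSet : Disjoint c.headSet c.tailSet :=
  Set.disjoint_left.2 fun _ h1 h2 => not_lt.2 h2.2 h1.2

lemma measurableSet_headSet : MeasurableSet c.headSet :=
  measurableSet_Ioi.inter (measurableSet_lt ENNReal.measurable_ofReal measurable_const)

lemma measurableSet_tailSet : MeasurableSet c.tailSet :=
  measurableSet_Ioi.inter (measurableSet_le measurable_const ENNReal.measurable_ofReal)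

lemma measurable_cdfE : Measurable c.cdfE := by
  refine Measurable.ite (measurableSet_lt measurable_const (by fun_prop)) ?_ measurable_const
  unfold probE ratio
  fun_prop

lemma cdfE_nonneg (γ : ℝ) : 0 ≤ c.cdfE γ := by
  rw [cdfE]; split_ifs
  · exact (Real.exp_pos _).le
  · exact zero_le_one

lemma Valid.cdfE_le_one (hc : c.Valid) {γ : ℝ} (hγ : 0 ≤ γ) : c.cdfE γ ≤ 1 := by
  rw [cdfE]; split_ifs with h
  · have h1 := hc.gammaFactor_pos
    have h2 := hc.lamB_pos
    have h3 := hc.lamE_pos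
    have h4 : 0 ≤ c.ratio γ := div_nonneg hγ h.le
    rw [probE, Real.exp_le_one_iff, neg_nonpos]
    positivity
  · exact le_rfl

/-- For `θ = 1` the ratio is `γ` itself and the exponent tends to 0; for `θ < 1` the function equals
1 from `θ / (1 - θ)` on. -/
lemma Valid.tendsto_cdfE (hc : c.Valid) : Tendsto c.cdfE atTop (𝓝 1) := by
  have hp := hc.two_div_β_mem.1
  rcases hc.θ_le_one.eq_or_lt with h1 | h1
  · have h2 : c.cdfE = c.probE := by
      ext γ
      simp [cdfE, h1]
    have h3 : Tendsto (fun γ : ℝ => c.gammaFactor * γ ^ (2 / c.β)) atTop atTop :=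
      (tendsto_rpow_atTop hp).const_mul_atTop hc.gammaFactor_pos
    have h4 := (h3.const_div_atTop (c.lamE / c.lamB)).neg.rexp
    rw [neg_zero, Real.exp_zero] at h4
    rw [h2]
    refine h4.congr fun γ => ?_
    simp [probE, ratio, h1]
  · refine tendsto_const_nhds.congr' ?_
    filter_upwards [eventually_ge_atTop (c.θ / (1 - c.θ))] with γ hγ
    rw [div_le_iff₀ (by linarith)] at hγ
    rw [cdfE, if_neg (by linarith)]

/-- The density of the average secrecy rate with respect to the threshold. -/
def rateIntegrand (c : Params) (γ : ℝ) : ℝ := c.cdfE γ * c.tailIntegrand γ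

lemma Valid.rateIntegrand_nonneg (hc : c.Valid) (hδ : c.δ < 1) {γ : ℝ} (hγ : 0 ≤ γ) :
    0 ≤ c.rateIntegrand γ :=
  mul_nonneg (cdfE_nonneg γ) (hc.tailIntegrand_nonneg hδ hγ)

lemma Valid.integrableOn_rateIntegrand (hc : c.Valid) (hδ : c.δ < 1) :
    IntegrableOn c.rateIntegrand (Ioi 0) := by
  refine Integrable.mono' (hc.integrableOn_tailIntegrand hδ)
    (measurable_cdfE.mul hc.measurable_tailIntegrand).aestronglyMeasurable
    ((ae_restrict_iff' measurableSet_Ioi).2 (Eventually.of_forall fun γ hγ => ?_))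
  have hγ' : (0 : ℝ) ≤ γ := le_of_lt hγ
  rw [Real.norm_of_nonneg (hc.rateIntegrand_nonneg hδ hγ')]
  exact mul_le_of_le_one_left (hc.tailIntegrand_nonneg hδ hγ') (hc.cdfE_le_one hγ')

lemma Valid.eqOn_headSet (hc : c.Valid) : EqOn c.rateIntegrand c.headIntegrand c.headSet := by
  intro γ hγ
  rw [hc.headSet_eq] at hγ
  rw [rateIntegrand, cdfE, if_pos hγ.2, tailIntegrand, mul_one_div]
  rfl

lemma Valid.eqOn_tailSet (hc : c.Valid) : EqOn c.rateIntegrand c.tailIntegrand c.tailSet := by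
  intro γ hγ
  rw [hc.tailSet_eq] at hγ
  rw [rateIntegrand, cdfE, if_neg hγ.2, one_mul]

lemma Valid.integrableOn_headSet (hc : c.Valid) (hδ : c.δ < 1) :
    IntegrableOn c.headIntegrand c.headSet :=
  ((hc.integrableOn_rateIntegrand hδ).mono_set
    (headSet_union_tailSet (c := c) ▸ subset_union_left)).congr_fun hc.eqOn_headSet
    measurableSet_headSet

lemma Valid.integrableOn_tailSet (hc : c.Valid) (hδ : c.δ < 1) :
    IntegrableOn c.tailIntegrand c.tailSet :=
  (hc.integrableOn_tailIntegrand hδ).mono_set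
    (headSet_union_tailSet (c := c) ▸ subset_union_right)

lemma Valid.integral_rateIntegrand (hc : c.Valid) (hδ : c.δ < 1) :
    ∫ γ in Ioi 0, c.rateIntegrand γ
      = (∫ γ in c.headSet, c.headIntegrand γ) + ∫ γ in c.tailSet, c.tailIntegrand γ := by
  have h := hc.integrableOn_rateIntegrand hδ
  rw [← headSet_union_tailSet (c := c)] at h ⊢
  rw [setIntegral_union disjoint_headSet_tailSet measurableSet_tailSet h.left_of_union
    h.right_of_union, setIntegral_congr_fun measurableSet_headSet hc.eqOn_headSet,
    setIntegral_congr_fun measurableSet_tailSet hc.eqOn_tailSet]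

end Params

/-! ### The average secrecy rate -/

/-- Layer-cake representation of the secrecy rate. -/
lemma lintegral_indicator_one_div_eq_rate {u e : ℝ≥0∞} (hu : u ≠ ∞) (he : e ≠ ∞) :
    ∫⁻ γ in Ioi (0 : ℝ), {γ | ENNReal.ofReal γ < u ∧ e ≤ ENNReal.ofReal γ}.indicator
        (fun γ => ENNReal.ofReal (1 / (1 + γ) * (1 / Real.log 2))) γ
      = ENNReal.ofReal (max (Real.logb 2 (1 + u.toReal) - Real.logb 2 (1 + e.toReal)) 0) := by
  lift u to ℝ≥0 using hu
  lift e to ℝ≥0 using he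
  have hl : 0 < Real.log 2 := Real.log_pos one_lt_two
  have hmeas : MeasurableSet {γ | ENNReal.ofReal γ < (u : ℝ≥0∞) ∧ (e : ℝ≥0∞) ≤ ENNReal.ofReal γ} :=
    (measurableSet_lt ENNReal.measurable_ofReal measurable_const).inter
      (measurableSet_le measurable_const ENNReal.measurable_ofReal)
  -- Changing the endpoints, a null set, gives the interval form needed for the fundamental theorem
  -- of calculus. The interval is empty for `u ≤ e`, which yields the positive part.
  have hset : ({γ | ENNReal.ofReal γ < (u : ℝ≥0∞) ∧ (e : ℝ≥0∞) ≤ ENNReal.ofReal γ} ∩ Ioi 0 : Set ℝ)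
      =ᵐ[volume] Ioc (e : ℝ) u := by
    have h0 : ∀ᵐ γ : ℝ, γ ≠ u ∧ γ ≠ e := by
      filter_upwards [measure_eq_zero_iff_ae_notMem.1 (measure_singleton (μ := volume) (u : ℝ)),
        measure_eq_zero_iff_ae_notMem.1 (measure_singleton (μ := volume) (e : ℝ))] with γ h1 h2
      exact ⟨h1, h2⟩
    filter_upwards [h0] with γ hγ
    refine propext ?_
    change (ENNReal.ofReal γ < u ∧ (e : ℝ≥0∞) ≤ ENNReal.ofReal γ) ∧ 0 < γ ↔ (e : ℝ) < γ ∧ γ ≤ u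
    rw [← ENNReal.ofReal_coe_nnreal (p := u), ← ENNReal.ofReal_coe_nnreal (p := e)]
    have h1 := e.coe_nonneg
    constructor
    · rintro ⟨⟨h2, h3⟩, h4⟩
      exact ⟨lt_of_le_of_ne ((ENNReal.ofReal_le_ofReal_iff h4.le).1 h3) hγ.2.symm,
        ((ENNReal.ofReal_lt_ofReal_iff_of_nonneg h4.le).1 h2).le⟩
    · rintro ⟨h2, h3⟩
      have h4 : 0 < γ := h1.trans_lt h2
      exact ⟨⟨(ENNReal.ofReal_lt_ofReal_iff_of_nonneg h4.le).2 (lt_of_le_of_ne h3 hγ.1),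
        ENNReal.ofReal_le_ofReal h2.le⟩, h4⟩
  rw [lintegral_indicator hmeas, Measure.restrict_restrict hmeas, Measure.restrict_congr_set hset,
    ENNReal.coe_toReal, ENNReal.coe_toReal]
  rcases le_total (e : ℝ) u with h | h
  · have h1 : ∀ x ∈ uIcc (e : ℝ) u, 0 < 1 + x := fun x hx => by
      rw [uIcc_of_le h] at hx
      linarith [hx.1, e.coe_nonneg]
    have hder : ∀ x ∈ uIcc (e : ℝ) u, HasDerivAt (fun x => Real.logb 2 (1 + x))
        (1 / (1 + x) * (1 / Real.log 2)) x := fun x hx => by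
      have := (((hasDerivAt_id x).const_add 1).log (h1 x hx).ne').div_const (Real.log 2)
      exact HasDerivAt.congr_deriv this (by simp [div_eq_mul_inv])
    have hcont : ContinuousOn (fun x : ℝ => 1 / (1 + x) * (1 / Real.log 2)) (uIcc (e : ℝ) u) :=
      (continuousOn_const.div (by fun_prop) fun x hx => (h1 x hx).ne').mul continuousOn_const
    have hInt := hcont.intervalIntegrable (μ := volume)
    have h2 := intervalIntegral.integral_eq_sub_of_hasDerivAt hder hInt
    rw [intervalIntegral.integral_of_le h] at h2
    rw [← ofReal_integral_eq_lintegral_ofReal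
      ((intervalIntegrable_iff_integrableOn_Ioc_of_le h).1 hInt)
      ((ae_restrict_iff' measurableSet_Ioc).2 (Eventually.of_forall fun x hx => ?_)), h2,
      max_eq_left]
    · rw [sub_nonneg]
      exact Real.logb_le_logb_of_le one_lt_two (h1 _ left_mem_uIcc) (by linarith)
    · have := h1 x (uIcc_of_le h ▸ Ioc_subset_Icc_self hx)
      simp only [Pi.zero_apply]
      positivity
  · rw [Ioc_eq_empty (not_lt.2 h), Measure.restrict_empty, lintegral_zero_measure, max_eq_right,
      ENNReal.ofReal_zero]
    rw [sub_nonpos]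
    exact Real.logb_le_logb_of_le one_lt_two (by linarith [u.coe_nonneg]) (by linarith)

namespace Network

variable {Ω : Type*} {W : Network Ω} {c : Params}

lemma secrecyRate_nonneg (ω : Ω) : 0 ≤ W.secrecyRate c ω := le_max_right _ _

variable [MeasurableSpace Ω] {μ : Measure Ω}

lemma IsModel.measurable_secrecyRate (h : W.IsModel μ c) : Measurable (W.secrecyRate c) := by
  have h1 := h.measurable_sinrU.ennreal_toReal
  have h2 := h.measurable_sinrMaxE.ennreal_toReal
  exact (((h1.const_add 1).log.div_const _).sub ((h2.const_add 1).log.div_const _)).max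
    measurable_const

variable [IsProbabilityMeasure μ]

/-- Needed because `secrecyRate` applies `toReal`, which sends `∞` to 0. The probability of `∞` is
at most `1 - cdfE γ` for every `γ > 0`. -/
lemma IsModel.ae_sinrMaxE_ne_top (h : W.IsModel μ c) (hc : c.Valid) (hσ : c.σ2 = 0) :
    ∀ᵐ ω ∂μ, W.sinrMaxE c ω ≠ ∞ := by
  rw [ae_iff]
  simp only [not_not]
  have h1 : Tendsto (fun γ => 1 - ENNReal.ofReal (c.cdfE γ)) atTop (𝓝 (1 - ENNReal.ofReal 1)) :=
    ENNReal.Tendsto.sub tendsto_const_nhds (ENNReal.tendsto_ofReal hc.tendsto_cdfE)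
      (Or.inl ENNReal.one_ne_top)
  rw [ENNReal.ofReal_one, tsub_self] at h1
  refine le_antisymm (ge_of_tendsto h1 ?_) bot_le
  filter_upwards [eventually_gt_atTop 0] with γ hγ
  have hm : MeasurableSet {ω | W.sinrMaxE c ω ≤ ENNReal.ofReal γ} :=
    h.measurable_sinrMaxE measurableSet_Iic
  rw [← h.measure_sinrMaxE_le hc hσ hγ, ← prob_compl_eq_one_sub hm]
  refine measure_mono fun ω hω => ?_
  have hω' : W.sinrMaxE c ω = ∞ := hω
  simp [hω']

/-- On the event `γ_e ≤ n` the joint law at any `γ ≥ n` bounds the probability of `γ_u = ∞` by `1 /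
(1 + totalZ γ)`, which tends to 0. These events exhaust the space as `γ_e` is almost surely finite.
-/
lemma IsModel.ae_sinrU_ne_top (h : W.IsModel μ c) (hc : c.Valid) (hδ : c.δ < 1)
    (hσ : c.σ2 = 0) : ∀ᵐ ω ∂μ, W.sinrU c ω ≠ ∞ := by
  have hlim : Tendsto (fun γ => ENNReal.ofReal (1 / (1 + c.totalZ γ))) atTop (𝓝 0) := by
    rw [← ENNReal.ofReal_zero]
    refine ENNReal.tendsto_ofReal (Tendsto.const_div_atTop ?_ 1)
    refine tendsto_atTop_add_const_left _ _ (tendsto_atTop_mono' _ ?_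
      ((tendsto_rpow_atTop hc.two_div_β_mem.1).const_mul_atTop
        (mul_pos (hc.probInterfere_pos hδ) hc.growthZ_pos)))
    filter_upwards [eventually_ge_atTop 1] with γ hγ using hc.le_totalZ hδ hγ
  have hn : ∀ n : ℕ, ∀ᵐ ω ∂μ, ¬ (W.sinrU c ω = ∞ ∧ W.sinrMaxE c ω ≤ n) := by
    intro n
    rw [ae_iff]
    simp only [not_not]
    refine le_antisymm (ge_of_tendsto hlim ?_) bot_le
    filter_upwards [eventually_gt_atTop 0, eventually_ge_atTop (n : ℝ)] with γ hγ hγn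
    calc μ {ω | W.sinrU c ω = ∞ ∧ W.sinrMaxE c ω ≤ n}
        ≤ μ {ω | ENNReal.ofReal γ < W.sinrU c ω ∧ W.sinrMaxE c ω ≤ ENNReal.ofReal γ} := by
          refine measure_mono fun ω hω => ⟨?_, hω.2.trans ?_⟩
          · rw [hω.1]; exact ENNReal.ofReal_lt_top
          · rw [← ENNReal.ofReal_natCast]; exact ENNReal.ofReal_le_ofReal hγn
      _ = ENNReal.ofReal (1 / (1 + c.totalZ γ)) * ENNReal.ofReal (c.cdfE γ) :=
          h.measure_lt_sinrU_and_sinrMaxE_le hc hδ hσ hγ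
      _ ≤ ENNReal.ofReal (1 / (1 + c.totalZ γ)) :=
          mul_le_of_le_one_right' (ENNReal.ofReal_le_one.2 (hc.cdfE_le_one hγ.le))
  filter_upwards [h.ae_sinrMaxE_ne_top hc hσ, ae_all_iff.2 hn] with ω h1 h2 h3
  obtain ⟨n, hn⟩ := ENNReal.exists_nat_gt h1
  exact h2 n ⟨h3, hn.le⟩

/-- Tonelli exchanges expectation and threshold in the layer-cake formula, after which the inner
integral is the joint probability. In this form the finiteness of the mean follows from that of the
closed form. -/
lemma IsModel.lintegral_secrecyRate (h : W.IsModel μ c) (hc : c.Valid) (hδ : c.δ < 1)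
    (hσ : c.σ2 = 0) :
    ∫⁻ ω, ENNReal.ofReal (W.secrecyRate c ω) ∂μ
      = ENNReal.ofReal (1 / Real.log 2 * ∫ γ in Ioi 0, c.rateIntegrand γ) := by
  have hl : 0 < Real.log 2 := Real.log_pos one_lt_two
  have hu := h.measurable_sinrU
  have he := h.measurable_sinrMaxE
  have hS : MeasurableSet {x : Ω × ℝ | ENNReal.ofReal x.2 < W.sinrU c x.1
      ∧ W.sinrMaxE c x.1 ≤ ENNReal.ofReal x.2} :=
    (measurableSet_lt (by fun_prop) (hu.comp measurable_fst)).inter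
      (measurableSet_le (he.comp measurable_fst) (by fun_prop))
  have hmeas : Measurable (Function.uncurry fun (ω : Ω) (γ : ℝ) =>
      {γ | ENNReal.ofReal γ < W.sinrU c ω ∧ W.sinrMaxE c ω ≤ ENNReal.ofReal γ}.indicator
        (fun γ => ENNReal.ofReal (1 / (1 + γ) * (1 / Real.log 2))) γ) :=
    Measurable.indicator (f := fun x : Ω × ℝ =>
      ENNReal.ofReal (1 / (1 + x.2) * (1 / Real.log 2))) (by fun_prop) hS
  calc ∫⁻ ω, ENNReal.ofReal (W.secrecyRate c ω) ∂μ
      = ∫⁻ ω, (∫⁻ γ in Ioi (0 : ℝ), {γ | ENNReal.ofReal γ < W.sinrU c ω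
          ∧ W.sinrMaxE c ω ≤ ENNReal.ofReal γ}.indicator
            (fun γ => ENNReal.ofReal (1 / (1 + γ) * (1 / Real.log 2))) γ) ∂μ := by
        refine lintegral_congr_ae ?_
        filter_upwards [h.ae_sinrMaxE_ne_top hc hσ, h.ae_sinrU_ne_top hc hδ hσ] with ω h1 h2
        exact (lintegral_indicator_one_div_eq_rate h2 h1).symm
    _ = ∫⁻ γ in Ioi (0 : ℝ), ∫⁻ ω, {γ | ENNReal.ofReal γ < W.sinrU c ω
          ∧ W.sinrMaxE c ω ≤ ENNReal.ofReal γ}.indicator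
            (fun γ => ENNReal.ofReal (1 / (1 + γ) * (1 / Real.log 2))) γ ∂μ :=
        lintegral_lintegral_swap hmeas.aemeasurable
    _ = ∫⁻ γ in Ioi (0 : ℝ), ENNReal.ofReal (1 / Real.log 2 * c.rateIntegrand γ) := by
        refine setLIntegral_congr_fun measurableSet_Ioi fun γ hγ => ?_
        have hγ' : (0 : ℝ) < γ := hγ
        have hT : MeasurableSet {ω | ENNReal.ofReal γ < W.sinrU c ω
            ∧ W.sinrMaxE c ω ≤ ENNReal.ofReal γ} :=
          (measurableSet_lt measurable_const hu).inter (measurableSet_le he measurable_const)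
        have h0 := hc.totalZ_nonneg hδ hγ'.le
        refine (lintegral_indicator_const (μ := μ) hT
          (ENNReal.ofReal (1 / (1 + γ) * (1 / Real.log 2)))).trans ?_
        rw [h.measure_lt_sinrU_and_sinrMaxE_le hc hδ hσ hγ', ← ENNReal.ofReal_mul (by positivity),
          ← ENNReal.ofReal_mul (by positivity), Params.rateIntegrand, Params.tailIntegrand_eq]
        congr 1
        ring
    _ = ENNReal.ofReal (1 / Real.log 2 * ∫ γ in Ioi 0, c.rateIntegrand γ) := by
        rw [← integral_const_mul, ofReal_integral_eq_lintegral_ofReal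
          ((hc.integrableOn_rateIntegrand hδ).const_mul _)]
        refine (ae_restrict_iff' measurableSet_Ioi).2 (Eventually.of_forall fun γ hγ => ?_)
        exact mul_nonneg (by positivity) (hc.rateIntegrand_nonneg hδ (le_of_lt hγ))

end Network

end

end CacheNet

end

theorem theorem1 {Ω : Type*} [MeasurableSpace Ω] (μ : Measure Ω) [IsProbabilityMeasure μ]
    (c : CacheNet.Params) (hc : c.Valid) (hδ : c.δ < 1) (hσ : c.σ2 = 0)
    (W : CacheNet.Network Ω) (hW : W.IsModel μ c) :
    Integrable (W.secrecyRate c) μ ∧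
    IntegrableOn c.headIntegrand c.headSet ∧
    IntegrableOn c.tailIntegrand c.tailSet ∧
    ∫ ω, W.secrecyRate c ω ∂μ =
      1 / Real.log 2 * (∫ γ in c.headSet, c.headIntegrand γ)
        + 1 / Real.log 2 * (∫ γ in c.tailSet, c.tailIntegrand γ) := by
  have hl := hW.lintegral_secrecyRate hc hδ hσ
  have h0 : 0 ≤ᵐ[μ] W.secrecyRate c :=
    Filter.Eventually.of_forall CacheNet.Network.secrecyRate_nonneg
  have hm := hW.measurable_secrecyRate.aestronglyMeasurable (μ := μ)
  refine ⟨(lintegral_ofReal_ne_top_iff_integrable hm h0).1 (hl ▸ ENNReal.ofReal_ne_top),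
    hc.integrableOn_headSet hδ, hc.integrableOn_tailSet hδ, ?_⟩
  rw [integral_eq_lintegral_of_nonneg_ae h0 hm, hl, ENNReal.toReal_ofReal,
    hc.integral_rateIntegrand hδ, mul_add]
  exact mul_nonneg (one_div_nonneg.2 (Real.log_nonneg one_le_two))
    (setIntegral_nonneg measurableSet_Ioi fun γ hγ => hc.rateIntegrand_nonneg hδ (le_of_lt hγ))
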